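/- A two-terminal series-parallel digraph is a finite directed multigraph with a source and a sink that is obtained from single directed edges by series compositions (identify the sink of one with the source of the next) and parallel compositions (identify the two sources and identify the two sinks); a single vertex without edges also counts as series-parallel. Call it degree-three (a flowchart of a loop-free algorithm) if every vertex has in-degree plus out-degree at most $3$, in-degree at most $2$ and out-degree at most $2$. An orthogonal drawing of a digraph places its vertices at distinct points of the integer grid and represents each edge by a simple polygonal path from its tail to its head, composed of horizontal and vertical segments with all bends ($90^\circ$ turns) at grid points, such that no edge passes through a vertex other than its ends and two distinct edges meet only in common end vertices. A junction is a vertex whose in-degree is strictly greater than its out-degree. The drawing is Knuthian if no non-junction vertex has an incoming edge that arrives at its bottom (last segment pointing upwards) or an outgoing edge that leaves from its top (first segment pointing upwards). The drawing has width at most $w$ and height at most $h$ if it lies in a rectangle $[x,x+w]\times[y,y+h]$. Theorem. There is a constant $C$ such that every degree-three series-parallel digraph with $n$ vertices has a Knuthian orthogonal drawing of width at most $Cn$ and height at most $C\log n$ in which every edge has at most two bends and the total number of bends is at most $1.25\,n$. -/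

import Mathlib

/-- A directed multigraph with vertex type `V` and edge type `E`. -/
structure MultiDigraph (V : Type*) (E : Type*) where
  src : E → V
  tgt : E → V

namespace MultiDigraph

variable {V V' E E' : Type*}

/-- The number of edges entering `v`. -/
noncomputable def inDeg (G : MultiDigraph V E) (v : V) : ℕ := {e | G.tgt e = v}.ncard

/-- The number of edges leaving `v`. -/
noncomputable def outDeg (G : MultiDigraph V E) (v : V) : ℕ := {e | G.src e = v}.ncard

/-- A junction is a vertex with in-degree strictly greater than its out-degree. -/
def IsJunction (G : MultiDigraph V E) (v : V) : Prop := G.outDeg v < G.inDeg v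

/-- Isomorphisms of directed multigraphs. -/
structure Iso (G : MultiDigraph V E) (G' : MultiDigraph V' E') where
  vert : V ≃ V'
  edge : E ≃ E'
  src_edge : ∀ e, G'.src (edge e) = vert (G.src e)
  tgt_edge : ∀ e, G'.tgt (edge e) = vert (G.tgt e)

end MultiDigraph

/-- Decomposition trees of two-terminal series-parallel digraphs. -/
inductive SPTree where
  | edge : SPTree
  | series (a b : SPTree) : SPTree
  | parallel (a b : SPTree) : SPTree

/-- The vertices of a two-terminal digraph: its source, its sink, and the inner vertices. -/
inductive SPVertex (I : Type) where
  | source : SPVertex I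
  | sink : SPVertex I
  | inner (i : I) : SPVertex I

/-- Send the source to `s`, the sink to `t`, and the inner vertices along `f`. -/
def SPVertex.glue {I J : Type} (s t : SPVertex J) (f : I → J) : SPVertex I → SPVertex J
  | source => s
  | sink => t
  | inner i => inner (f i)

namespace SPTree

/-- The inner vertices; a series composition creates one new inner vertex, which is the sink of
the first part identified with the source of the second part. -/
def Inner : SPTree → Type
  | edge => Empty
  | series a b => Inner a ⊕ Unit ⊕ Inner b
  | parallel a b => Inner a ⊕ Inner b

/-- The edges. -/
def Edge : SPTree → Type
  | edge => Unit
  | series a b => Edge a ⊕ Edge b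
  | parallel a b => Edge a ⊕ Edge b

/-- Vertices of the first part of a series composition, inside the composition. -/
def serL (a b : SPTree) : SPVertex a.Inner → SPVertex (series a b).Inner :=
  SPVertex.glue .source (.inner (Sum.inr (Sum.inl ()))) (fun i => Sum.inl i)

/-- Vertices of the second part of a series composition, inside the composition. -/
def serR (a b : SPTree) : SPVertex b.Inner → SPVertex (series a b).Inner :=
  SPVertex.glue (.inner (Sum.inr (Sum.inl ()))) .sink (fun i => Sum.inr (Sum.inr i))

/-- Vertices of the first part of a parallel composition, inside the composition. -/
def parL (a b : SPTree) : SPVertex a.Inner → SPVertex (parallel a b).Inner :=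
  SPVertex.glue .source .sink (fun i => Sum.inl i)

/-- Vertices of the second part of a parallel composition, inside the composition. -/
def parR (a b : SPTree) : SPVertex b.Inner → SPVertex (parallel a b).Inner :=
  SPVertex.glue .source .sink (fun i => Sum.inr i)

/-- The two-terminal series-parallel digraph described by a decomposition tree. -/
def graph : (T : SPTree) → MultiDigraph (SPVertex T.Inner) T.Edge
  | edge => ⟨fun _ => .source, fun _ => .sink⟩
  | series a b =>
      ⟨Sum.elim (fun e => serL a b (a.graph.src e)) (fun e => serR a b (b.graph.src e)),
        Sum.elim (fun e => serL a b (a.graph.tgt e)) (fun e => serR a b (b.graph.tgt e))⟩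
  | parallel a b =>
      ⟨Sum.elim (fun e => parL a b (a.graph.src e)) (fun e => parR a b (b.graph.src e)),
        Sum.elim (fun e => parL a b (a.graph.tgt e)) (fun e => parR a b (b.graph.tgt e))⟩

end SPTree

namespace MultiDigraph

variable {V E : Type*}

/-- `G` is series-parallel: it arises from single edges by series and parallel compositions, or
it consists of one vertex only. -/
def IsSeriesParallel (G : MultiDigraph V E) : Prop :=
  (∃ T : SPTree, Nonempty (G.Iso T.graph)) ∨ (Nonempty (Unique V) ∧ IsEmpty E)

/-- Every vertex has total degree at most three, and splits and joins are two-way. -/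
def IsDegreeThree (G : MultiDigraph V E) : Prop :=
  ∀ v, G.inDeg v + G.outDeg v ≤ 3 ∧ G.inDeg v ≤ 2 ∧ G.outDeg v ≤ 2

end MultiDigraph

/-- Points of the integer grid; the second coordinate grows upwards. -/
abbrev GridPt : Type := ℤ × ℤ

namespace GridPt

/-- A grid point as a point of the plane. -/
def toPlane (p : GridPt) : ℝ × ℝ := ((p.1 : ℝ), (p.2 : ℝ))

end GridPt

/-- The segments of a polygonal path, given by the list of its successive points. -/
def pathSegs (l : List GridPt) : List (GridPt × GridPt) := l.zip l.tail

/-- A nondegenerate horizontal segment. -/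
def SegHorizontal (s : GridPt × GridPt) : Prop := s.1.2 = s.2.2 ∧ s.1.1 ≠ s.2.1

/-- A nondegenerate vertical segment. -/
def SegVertical (s : GridPt × GridPt) : Prop := s.1.1 = s.2.1 ∧ s.1.2 ≠ s.2.2

/-- A vertical segment that is traversed upwards. -/
def SegUpward (s : GridPt × GridPt) : Prop := s.1.1 = s.2.1 ∧ s.1.2 < s.2.2

/-- The set of points of the plane on a horizontal or vertical segment. -/
def segPoints (s : GridPt × GridPt) : Set (ℝ × ℝ) :=
  Set.uIcc (s.1.1 : ℝ) (s.2.1 : ℝ) ×ˢ Set.uIcc (s.1.2 : ℝ) (s.2.2 : ℝ)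

/-- The set of points of the plane on a polygonal path. -/
def pathPoints (l : List GridPt) : Set (ℝ × ℝ) := {p | ∃ s ∈ pathSegs l, p ∈ segPoints s}

/-- The path consists of horizontal and vertical segments, and it makes a right-angled turn at
each of its intermediate points. -/
def IsOrthogonalPath (l : List GridPt) : Prop :=
  (∀ s ∈ pathSegs l, SegHorizontal s ∨ SegVertical s) ∧
  (pathSegs l).IsChain
    (fun s t => (SegHorizontal s ∧ SegVertical t) ∨ (SegVertical s ∧ SegHorizontal t))

/-- The orthogonal path does not meet itself: segments that are not consecutive are disjoint
(consecutive ones are perpendicular, hence meet in their common end only). -/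
def IsSimplePath (l : List GridPt) : Prop :=
  ∀ i j : Fin (pathSegs l).length, i.val + 1 < j.val →
    Disjoint (segPoints ((pathSegs l).get i)) (segPoints ((pathSegs l).get j))

/-- A crossing-free orthogonal grid drawing of a directed multigraph. The edge `e` is drawn as the
polygonal path through `pos (src e)`, the points of `bend e`, and `pos (tgt e)`, in this order. -/
structure OrthogonalDrawing {V E : Type*} (G : MultiDigraph V E) where
  pos : V → GridPt
  bend : E → List GridPt
  /-- Distinct vertices have distinct positions. -/
  pos_injective : Function.Injective pos
  orthogonal : ∀ e, IsOrthogonalPath (pos (G.src e) :: (bend e ++ [pos (G.tgt e)]))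
  simple : ∀ e, IsSimplePath (pos (G.src e) :: (bend e ++ [pos (G.tgt e)]))
  /-- An edge passes through no vertex other than its ends. -/
  avoids : ∀ e v, GridPt.toPlane (pos v) ∈ pathPoints (pos (G.src e) :: (bend e ++ [pos (G.tgt e)])) →
    v = G.src e ∨ v = G.tgt e
  /-- Two distinct edges meet in common end vertices only. -/
  noncrossing : ∀ e f, e ≠ f → ∀ p,
    p ∈ pathPoints (pos (G.src e) :: (bend e ++ [pos (G.tgt e)])) →
    p ∈ pathPoints (pos (G.src f) :: (bend f ++ [pos (G.tgt f)])) →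
    ∃ v, (v = G.src e ∨ v = G.tgt e) ∧ (v = G.src f ∨ v = G.tgt f) ∧ p = GridPt.toPlane (pos v)

namespace OrthogonalDrawing

variable {V E : Type*} {G : MultiDigraph V E}

/-- The successive points of the path that represents `e`. -/
def route (D : OrthogonalDrawing G) (e : E) : List GridPt :=
  D.pos (G.src e) :: (D.bend e ++ [D.pos (G.tgt e)])

/-- The number of bends of `e`. -/
def bends (D : OrthogonalDrawing G) (e : E) : ℕ := (D.bend e).length

/-- No non-junction vertex has an incoming edge at its bottom (the last segment of that edge would
be traversed upwards) or an outgoing edge at its top (its first segment would be). -/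
def IsKnuthian (D : OrthogonalDrawing G) : Prop :=
  ∀ v, ¬ G.IsJunction v →
    (∀ e, G.tgt e = v → ∀ s ∈ (pathSegs (D.route e)).getLast?, ¬ SegUpward s) ∧
    (∀ e, G.src e = v → ∀ s ∈ (pathSegs (D.route e)).head?, ¬ SegUpward s)

/-- The drawing (all vertices and bends, hence all edges) lies in an axis-parallel rectangle of
width `w` and height `h` with corners at grid points. -/
def FitsIn (D : OrthogonalDrawing G) (w h : ℕ) : Prop :=
  ∃ x y : ℤ,
    (∀ v, D.pos v ∈ Set.Icc x (x + w) ×ˢ Set.Icc y (y + h)) ∧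
    (∀ e, ∀ p ∈ D.bend e, p ∈ Set.Icc x (x + w) ×ˢ Set.Icc y (y + h))

end OrthogonalDrawing

/-! Attach an edge in front of the source and one behind the sink. By the degree bounds the result
is a `Chain`: an edge, followed by a vertex or by the parallel composition of two chains between a
split and a join, followed by a chain again, until a last edge. If `p` is the number of parallel
compositions, then `2 * p ≤ n`, because each one owns a split and a join. Hence it suffices to spend
5/2 bends per parallel composition and `O(log p)` rows.

Three kinds of drawings are built by one induction, `Chain.draws`: from left to right in the top row
(`DrawsTop`), from left to right down to the bottom row (`DrawsDown`), and a U-turn back to the left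
side (`DrawsTurn`). In `node A B R`, with `B` at least as heavy as `A`, the heavy child is `R` or
`B`. Every other child has at most half of the parallel compositions, so the binary length of its
`par` is smaller; with ten rows per binary digit it may lose a few rows. The heavy child must be
treated more carefully.

A U-turn never takes rows from the heavy child. Either `R` turns and the returning wire passes below
`A` and `B`, or `B` turns and `A` and `R` run backwards below the initial edge. The second layout
needs only two new bends and so saves half a bend; `heavy` counts these savings. The edge that ends
the heavy path needs two bends, whence the bound `2 * bends + heavy ≤ 5 * par + 4`.

A drawing from left to right can place `B` beside `A`, with two bends and the loss of one row, or
let `B` turn, with up to four bends besides those of the turn. Turning is affordable if `7 ≤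
B.heavy`, since `2 * 4 + 4 - 7 = 5`. Otherwise the lost row is charged to `heavy`, which is small
then. So `10 * par.size + min heavy 8` rows suffice.

Planarity is handled on the grid. A `FrameDrawing` labels every grid point by one vertex or one
edge, and `Skeleton.exists_frameDrawing` glues drawings in disjoint rectangles along wires, so that
each layout reduces to linear arithmetic. `FrameDrawing.exists_orthogonalDrawing` passes to the
plane and discards the two attached edges. The drawing is Knuthian since only joins have upward
segments at their bottom or top. -/

/-! ### Axis-parallel grid paths and their directions -/

/-- The four directions of axis-parallel segments. -/
inductive Dir where
  | right | left | up | down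
  deriving DecidableEq

namespace Dir

/-- A horizontal direction. -/
def IsHor : Dir → Prop
  | right => True
  | left => True
  | _ => False

/-- Perpendicular directions. -/
def Perp (d e : Dir) : Prop := ¬ (d.IsHor ↔ e.IsHor)

/-- Reflection in a vertical line. -/
def flip : Dir → Dir
  | right => left
  | left => right
  | up => up
  | down => down

end Dir

/-- The nondegenerate segment from `a` to `b` has direction `d`. -/
def SegDir (a b : GridPt) : Dir → Prop
  | .right => a.2 = b.2 ∧ a.1 < b.1
  | .left => a.2 = b.2 ∧ b.1 < a.1
  | .up => a.1 = b.1 ∧ a.2 < b.2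
  | .down => a.1 = b.1 ∧ b.2 < a.2

/-- The grid point `p` lies on the segment from `a` to `b`. -/
def OnSeg (p a b : GridPt) : Prop :=
  min a.1 b.1 ≤ p.1 ∧ p.1 ≤ max a.1 b.1 ∧ min a.2 b.2 ≤ p.2 ∧ p.2 ≤ max a.2 b.2

/-- The grid point `p` lies on a polygonal path. -/
def OnPath (p : GridPt) : List GridPt → Prop
  | [] => False
  | [_] => False
  | a :: b :: l => OnSeg p a b ∨ OnPath p (b :: l)

/-- An orthogonal path with given first and last directions. -/
def IsPath : List GridPt → Dir → Dir → Prop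
  | [], _, _ => False
  | [_], _, _ => False
  | [a, b], s, e => SegDir a b s ∧ s = e
  | a :: b :: c :: l, s, e => SegDir a b s ∧ ∃ s', Dir.Perp s s' ∧ IsPath (b :: c :: l) s' e

/-- Directions survive when two collinear segments are joined. -/
theorem SegDir.trans {a b c : GridPt} {d : Dir} (h : SegDir a b d) (h' : SegDir b c d) :
    SegDir a c d := by
  cases d <;> simp only [SegDir] at * <;> omega

theorem SegDir.onSeg_iff {a b c p : GridPt} {d : Dir} (h : SegDir a b d) (h' : SegDir b c d) :
    OnSeg p a c ↔ OnSeg p a b ∨ OnSeg p b c := by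
  cases d <;> simp only [SegDir, OnSeg] at * <;> omega

theorem IsPath.join_singleton {q a : GridPt} {l : List GridPt} {s d e : Dir}
    (h : IsPath [q, a] s d) (h' : IsPath (a :: l) d e) :
    IsPath (q :: l) s e ∧ ∀ p, OnPath p (q :: l) ↔ OnPath p [q, a] ∨ OnPath p (a :: l) := by
  obtain ⟨h, rfl⟩ := h
  match l, h' with
  | [b], h' =>
    refine ⟨⟨h.trans h'.1, h'.2⟩, fun p => ?_⟩
    simp only [OnPath, or_false]
    exact h.onSeg_iff h'.1
  | b :: c :: l, ⟨h1, s', h2⟩ =>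
    refine ⟨⟨h.trans h1, s', h2⟩, fun p => ?_⟩
    simp only [OnPath, or_false]
    rw [h.onSeg_iff h1]
    tauto

/-- Two paths that meet head to tail in the same direction are joined; the meeting point ceases to
be a vertex of the polygonal path. -/
theorem IsPath.join {a : GridPt} {l' : List GridPt} {d e : Dir} (h' : IsPath (a :: l') d e) :
    ∀ {l : List GridPt} {s : Dir}, IsPath (l ++ [a]) s d →
    IsPath (l ++ l') s e ∧ ∀ p, OnPath p (l ++ l') ↔ OnPath p (l ++ [a]) ∨ OnPath p (a :: l')
  | [], _, h => h.elim
  | [q], _, h => h.join_singleton h'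
  | [q, r], s, ⟨h1, s', h2, h3⟩ => by
    obtain ⟨h4, h5⟩ := IsPath.join (l := [r]) h' h3
    cases l' with
    | nil => exact h'.elim
    | cons b l' =>
      refine ⟨⟨h1, s', h2, h4⟩, fun p => ?_⟩
      have := h5 p
      simp only [List.cons_append, List.nil_append, OnPath] at this ⊢
      rw [this]
      tauto
  | q :: r :: t :: l, s, ⟨h1, s', h2, h3⟩ => by
    obtain ⟨h4, h5⟩ := IsPath.join (l := r :: t :: l) h' h3
    refine ⟨⟨h1, s', h2, h4⟩, fun p => ?_⟩
    have := h5 p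
    simp only [List.cons_append, OnPath] at this ⊢
    rw [this]
    tauto

/-! ### Orthogonal paths in the plane -/

section PathPoints

theorem pathSegs_cons_cons (a b : GridPt) (l : List GridPt) :
    pathSegs (a :: b :: l) = (a, b) :: pathSegs (b :: l) := rfl

theorem SegDir.segHorizontal {a b : GridPt} {d : Dir} (h : SegDir a b d) (hd : d.IsHor) :
    SegHorizontal (a, b) := by
  cases d <;> simp only [SegDir, Dir.IsHor, SegHorizontal] at * <;> omega

theorem SegDir.segVertical {a b : GridPt} {d : Dir} (h : SegDir a b d) (hd : ¬ d.IsHor) :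
    SegVertical (a, b) := by
  cases d <;> simp [SegDir, Dir.IsHor, SegVertical] at * <;> omega

theorem SegDir.segUpward {a b : GridPt} {d : Dir} (h : SegDir a b d) (hu : SegUpward (a, b)) :
    d = .up := by
  cases d <;> simp only [SegDir, SegUpward] at * <;> first | rfl | omega

theorem SegDir.hor_or_vert {a b : GridPt} {d : Dir} (h : SegDir a b d) :
    SegHorizontal (a, b) ∨ SegVertical (a, b) := by
  by_cases hd : d.IsHor
  · exact .inl (h.segHorizontal hd)
  · exact .inr (h.segVertical hd)

theorem SegDir.perp {a b c : GridPt} {d e : Dir} (h : SegDir a b d) (h' : SegDir b c e)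
    (hp : d.Perp e) :
    (SegHorizontal (a, b) ∧ SegVertical (b, c)) ∨ (SegVertical (a, b) ∧ SegHorizontal (b, c)) := by
  unfold Dir.Perp at hp
  by_cases hd : d.IsHor <;> by_cases he : e.IsHor
  · exact absurd (iff_of_true hd he) hp
  · exact .inl ⟨h.segHorizontal hd, h'.segVertical he⟩
  · exact .inr ⟨h.segVertical hd, h'.segHorizontal he⟩
  · exact absurd (iff_of_false hd he) hp

theorem IsPath.exists_head {s e : Dir} :
    ∀ {l : List GridPt}, IsPath l s e → ∃ a b t, l = a :: b :: t ∧ SegDir a b s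
  | [a, b], h => ⟨a, b, [], rfl, h.1⟩
  | a :: b :: c :: l, h => ⟨a, b, c :: l, rfl, h.1⟩

theorem IsPath.isOrthogonalPath {e : Dir} :
    ∀ {l : List GridPt} {s : Dir}, IsPath l s e → IsOrthogonalPath l
  | [a, b], s, h => by
    refine ⟨?_, ?_⟩
    · simpa [pathSegs] using h.1.hor_or_vert
    · simp [pathSegs]
  | a :: b :: c :: l, s, ⟨h1, s', h2, h3⟩ => by
    obtain ⟨h4, h5⟩ := IsPath.isOrthogonalPath h3
    obtain ⟨_, _, _, heq, h6⟩ := h3.exists_head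
    simp only [List.cons.injEq] at heq
    obtain ⟨rfl, rfl, rfl⟩ := heq
    rw [IsOrthogonalPath, pathSegs_cons_cons, pathSegs_cons_cons] at *
    refine ⟨fun t ht => ?_, ?_⟩
    · rcases List.mem_cons.1 ht with rfl | ht
      · exact h1.hor_or_vert
      · exact h4 t ht
    · rw [List.isChain_cons_cons]
      exact ⟨h1.perp h6 h2, h5⟩

theorem IsPath.head_upward {l : List GridPt} {s e : Dir} (h : IsPath l s e) :
    ∀ t ∈ (pathSegs l).head?, SegUpward t → s = .up := by
  obtain ⟨a, b, l, rfl, h'⟩ := h.exists_head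
  intro t ht hu
  simp only [pathSegs_cons_cons, List.head?_cons, Option.mem_def, Option.some.injEq] at ht
  exact h'.segUpward (ht ▸ hu)

theorem IsPath.getLast_upward {e : Dir} :
    ∀ {l : List GridPt} {s : Dir}, IsPath l s e →
      ∀ t ∈ (pathSegs l).getLast?, SegUpward t → e = .up
  | [a, b], s, ⟨h, hs⟩, t, ht, hu => by
    simp only [pathSegs, List.tail, List.zip_cons_cons, List.zip_nil_right,
      List.getLast?_singleton, Option.mem_def, Option.some.injEq] at ht
    exact hs ▸ h.segUpward (ht ▸ hu)
  | a :: b :: c :: l, s, ⟨h1, s', h2, h3⟩, t, ht, hu => by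
    refine IsPath.getLast_upward h3 t ?_ hu
    rwa [pathSegs_cons_cons, pathSegs_cons_cons, List.getLast?_cons_cons,
      ← pathSegs_cons_cons] at ht

theorem onPath_of_mem_pathSegs {p : GridPt} {s : GridPt × GridPt} (hp : OnSeg p s.1 s.2) :
    ∀ {l : List GridPt}, s ∈ pathSegs l → OnPath p l
  | [], hs => by simp [pathSegs] at hs
  | [_], hs => by simp [pathSegs] at hs
  | a :: b :: l, hs => by
    rw [pathSegs_cons_cons] at hs
    rcases List.mem_cons.1 hs with rfl | hs
    · exact .inl hp
    · exact .inr (onPath_of_mem_pathSegs hp hs)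

/-- A segment through a point of the plane contains the neighbouring grid points. -/
theorem onSeg_floor_ceil {s : GridPt × GridPt} {x : ℝ × ℝ} (h : x ∈ segPoints s) :
    OnSeg (⌊x.1⌋, ⌊x.2⌋) s.1 s.2 ∧ OnSeg (⌈x.1⌉, ⌈x.2⌉) s.1 s.2 := by
  obtain ⟨h1, h2⟩ := h
  rw [Set.mem_uIcc] at h1 h2
  have aux : ∀ (u v : ℤ) (r : ℝ), ((u : ℝ) ≤ r ∧ r ≤ v ∨ (v : ℝ) ≤ r ∧ r ≤ u) →
      (min u v ≤ ⌊r⌋ ∧ ⌊r⌋ ≤ max u v) ∧ (min u v ≤ ⌈r⌉ ∧ ⌈r⌉ ≤ max u v) := by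
    intro u v r h
    have hfc := Int.floor_le_ceil r
    rcases h with ⟨h, h'⟩ | ⟨h, h'⟩
    · have := Int.le_floor.2 h
      have := Int.ceil_le.2 h'
      omega
    · have := Int.le_floor.2 h
      have := Int.ceil_le.2 h'
      omega
  have a1 := aux _ _ _ h1
  have a2 := aux _ _ _ h2
  exact ⟨⟨a1.1.1, a1.1.2, a2.1.1, a2.1.2⟩, ⟨a1.2.1, a1.2.2, a2.2.1, a2.2.2⟩⟩

theorem toPlane_mem_pathPoints {l : List GridPt} {p : GridPt} (h : p.toPlane ∈ pathPoints l) :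
    OnPath p l := by
  obtain ⟨s, hs, hp⟩ := h
  refine onPath_of_mem_pathSegs ?_ hs
  simpa [GridPt.toPlane] using (onSeg_floor_ceil hp).1

/-- The first and the third segment are parallel, and the nondegenerate middle segment,
perpendicular to both, puts them on different lines. -/
theorem segs_disjoint {a b c d : GridPt}
    (h : (SegHorizontal (a, b) ∧ SegVertical (b, c)) ∨ (SegVertical (a, b) ∧ SegHorizontal (b, c)))
    (h' : (SegHorizontal (b, c) ∧ SegVertical (c, d)) ∨ (SegVertical (b, c) ∧ SegHorizontal (c, d))) :
    Disjoint (segPoints (a, b)) (segPoints (c, d)) := by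
  rw [Set.disjoint_left]
  rintro ⟨x, y⟩ ⟨hx, hy⟩ ⟨hx', hy'⟩
  simp only [SegHorizontal, SegVertical] at *
  rcases h with ⟨h, h2⟩ | ⟨h, h2⟩
  · rcases h' with ⟨h3, _⟩ | ⟨_, h4⟩
    · exact h2.2 h3.1
    · rw [h.1, Set.uIcc_self] at hy
      rw [← h4.1, Set.uIcc_self] at hy'
      have := (Set.mem_singleton_iff.1 hy).symm.trans (Set.mem_singleton_iff.1 hy')
      exact h2.2 (by exact_mod_cast this)
  · rcases h' with ⟨_, h4⟩ | ⟨h3, _⟩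
    · rw [h.1, Set.uIcc_self] at hx
      rw [← h4.1, Set.uIcc_self] at hx'
      have := (Set.mem_singleton_iff.1 hx).symm.trans (Set.mem_singleton_iff.1 hx')
      exact h2.2 (by exact_mod_cast this)
    · exact h2.2 h3.1

/-- An orthogonal path with at most two bends does not meet itself. -/
theorem IsOrthogonalPath.isSimplePath {a b : GridPt} {l : List GridPt} (hl : l.length ≤ 2)
    (h : IsOrthogonalPath (a :: (l ++ [b]))) : IsSimplePath (a :: (l ++ [b])) := by
  match l, hl with
  | [], _ =>
    intro i j hij
    have := j.isLt
    simp [pathSegs] at this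
    omega
  | [p], _ =>
    intro i j hij
    have := j.isLt
    simp [pathSegs] at this
    omega
  | [p, q], _ =>
    intro i j hij
    obtain ⟨i, hi⟩ := i
    obtain ⟨j, hj⟩ := j
    have hj' := hj
    simp [pathSegs] at hj' hij
    -- Among three segments, only the first and the last are not consecutive.
    obtain rfl : i = 0 := by omega
    obtain rfl : j = 2 := by omega
    have h2 := h.2
    simp [pathSegs] at h2
    exact segs_disjoint h2.1 h2.2

end PathPoints

/-! ### Two-terminal digraphs and their substitution for strands -/

/-- A finite two-terminal digraph whose source has one outgoing and whose sink has one incoming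
edge. -/
structure TwoTerminal : Type 1 where
  I : Type
  E : Type
  finI : Finite I
  finE : Fintype E
  G : MultiDigraph (SPVertex I) E
  fst : E
  lst : E
  src_iff : ∀ e, G.src e = .source ↔ e = fst
  tgt_iff : ∀ e, G.tgt e = .sink ↔ e = lst
  src_ne : ∀ e, G.src e ≠ .sink
  tgt_ne : ∀ e, G.tgt e ≠ .source

attribute [instance] TwoTerminal.finI TwoTerminal.finE

namespace SPVertex

variable {I J K : Type}

/-- Apply a map to the inner vertices. -/
def map (f : I → J) : SPVertex I → SPVertex J := glue .source .sink f

@[simp] theorem map_source (f : I → J) : map f .source = .source := rfl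
@[simp] theorem map_sink (f : I → J) : map f .sink = .sink := rfl
@[simp] theorem map_inner (f : I → J) (i : I) : map f (.inner i) = .inner (f i) := rfl
@[simp] theorem glue_source (s t : SPVertex J) (f : I → J) : glue s t f .source = s := rfl
@[simp] theorem glue_sink (s t : SPVertex J) (f : I → J) : glue s t f .sink = t := rfl
@[simp] theorem glue_inner (s t : SPVertex J) (f : I → J) (i : I) :
    glue s t f (.inner i) = .inner (f i) := rfl

theorem map_eq_source {f : I → J} {v : SPVertex I} : map f v = .source ↔ v = .source := by
  cases v <;> simp

theorem map_eq_sink {f : I → J} {v : SPVertex I} : map f v = .sink ↔ v = .sink := by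
  cases v <;> simp

/-- The position of a vertex, given those of the terminals and of the inner vertices. -/
def place (s t : GridPt) (f : I → GridPt) : SPVertex I → GridPt
  | source => s
  | sink => t
  | inner i => f i

end SPVertex

/-- An inner vertex with at least two incoming and at most one outgoing edge. -/
def IsJoin {I E : Type} (G : MultiDigraph (SPVertex I) E) (i : I) : Prop :=
  (∃ e f, e ≠ f ∧ G.tgt e = .inner i ∧ G.tgt f = .inner i) ∧
    ∀ e f, G.src e = .inner i → G.src f = .inner i → e = f

/-- Base vertices, strands between them, and the strands at the two terminals. -/
structure Skeleton (V S : Type) where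
  a : S → SPVertex V
  b : S → SPVertex V
  head : S
  last : S
  a_iff : ∀ σ, a σ = .source ↔ σ = head
  b_iff : ∀ σ, b σ = .sink ↔ σ = last
  a_ne : ∀ σ, a σ ≠ .sink
  b_ne : ∀ σ, b σ ≠ .source

namespace Skeleton

variable {V S : Type} (K : Skeleton V S) (X : S → TwoTerminal)

/-- Vertices of the digraph that replaces the strand `σ`. -/
def lift (σ : S) : SPVertex (X σ).I → SPVertex (V ⊕ Σ σ, (X σ).I) :=
  SPVertex.glue ((K.a σ).map Sum.inl) ((K.b σ).map Sum.inl) (fun i => Sum.inr ⟨σ, i⟩)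

/-- Replace the strands of a skeleton by two-terminal digraphs. -/
def graph : MultiDigraph (SPVertex (V ⊕ Σ σ, (X σ).I)) (Σ σ, (X σ).E) where
  src e := K.lift X e.1 ((X e.1).G.src e.2)
  tgt e := K.lift X e.1 ((X e.1).G.tgt e.2)

theorem lift_eq_inr {σ : S} {v : SPVertex (X σ).I} {y : Σ σ, (X σ).I} :
    K.lift X σ v = .inner (.inr y) ↔ ∃ i, v = .inner i ∧ y = ⟨σ, i⟩ := by
  cases v with
  | source => cases h : K.a σ <;> simp [lift, h]
  | sink => cases h : K.b σ <;> simp [lift, h]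
  | inner i => simp [lift, eq_comm]

theorem lift_eq_inl {σ : S} {v : SPVertex (X σ).I} {x : V} :
    K.lift X σ v = .inner (.inl x) ↔
      (v = .source ∧ K.a σ = .inner x) ∨ (v = .sink ∧ K.b σ = .inner x) := by
  cases v with
  | source => cases h : K.a σ <;> simp [lift, h]
  | sink => cases h : K.b σ <;> simp [lift, h]
  | inner i => simp [lift]

theorem lift_eq_source {σ : S} {v : SPVertex (X σ).I} :
    K.lift X σ v = .source ↔ v = .source ∧ σ = K.head := by
  cases v with
  | source => simp [lift, SPVertex.map_eq_source, K.a_iff]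
  | sink => simp [lift, SPVertex.map_eq_source, K.b_ne]
  | inner i => simp [lift]

theorem lift_eq_sink {σ : S} {v : SPVertex (X σ).I} :
    K.lift X σ v = .sink ↔ v = .sink ∧ σ = K.last := by
  cases v with
  | source => simp [lift, SPVertex.map_eq_sink, K.a_ne]
  | sink => simp [lift, SPVertex.map_eq_sink, K.b_iff]
  | inner i => simp [lift]

/-- All edges at an inner vertex of a strand belong to this strand, so the substitution does not
change its degrees. -/
theorem isJoin_inr {σ : S} {i : (X σ).I} (h : IsJoin (X σ).G i) :
    IsJoin (K.graph X) (.inr ⟨σ, i⟩) := by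
  obtain ⟨⟨e, f, hef, he, hf⟩, h2⟩ := h
  refine ⟨⟨⟨σ, e⟩, ⟨σ, f⟩, by simpa using hef, ?_, ?_⟩, ?_⟩
  · simp [graph, he, lift]
  · simp [graph, hf, lift]
  · rintro ⟨τ, e⟩ ⟨τ', f⟩ he hf
    obtain ⟨j, h3, h4⟩ := (K.lift_eq_inr X).1 he
    obtain ⟨j', h5, h6⟩ := (K.lift_eq_inr X).1 hf
    obtain rfl : σ = τ := congrArg Sigma.fst h4
    obtain rfl : σ = τ' := congrArg Sigma.fst h6
    obtain rfl : i = j := by simpa using h4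
    obtain rfl : i = j' := by simpa using h6
    rw [h2 e f h3 h5]

/-- A strand contributes exactly one edge at each of its ends, so the edges at a base vertex
correspond to the strands there. -/
theorem isJoin_inl {x : V} {σ₁ σ₂ σ₃ : S} (h : σ₁ ≠ σ₂) (h₁ : K.b σ₁ = .inner x)
    (h₂ : K.b σ₂ = .inner x) (h₃ : ∀ σ, K.a σ = .inner x → σ = σ₃) :
    IsJoin (K.graph X) (.inl x) := by
  refine ⟨⟨⟨σ₁, (X σ₁).lst⟩, ⟨σ₂, (X σ₂).lst⟩, fun h' => h (congrArg Sigma.fst h'), ?_, ?_⟩, ?_⟩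
  · simp [graph, lift, ((X σ₁).tgt_iff _).2 rfl, h₁]
  · simp [graph, lift, ((X σ₂).tgt_iff _).2 rfl, h₂]
  · have key : ∀ e : Σ σ, (X σ).E, (K.graph X).src e = .inner (.inl x) →
        e = ⟨σ₃, (X σ₃).fst⟩ := by
      rintro ⟨σ, e⟩ he
      rcases (K.lift_eq_inl X).1 he with ⟨h4, h5⟩ | ⟨h4, _⟩
      · obtain rfl := h₃ σ h5
        have h6 : e = (X σ).fst := ((X σ).src_iff _).1 h4
        rw [h6]
      · exact absurd h4 ((X σ).src_ne e)
    intro e f he hf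
    rw [key e he, key f hf]

end Skeleton

namespace TwoTerminal

/-- A single edge. -/
def single : TwoTerminal where
  I := Empty
  E := Unit
  finI := inferInstance
  finE := inferInstance
  G := ⟨fun _ => .source, fun _ => .sink⟩
  fst := ()
  lst := ()
  src_iff := by simp
  tgt_iff := by simp
  src_ne := by simp
  tgt_ne := by simp

/-- Replace the strands of a skeleton by two-terminal digraphs. -/
def subst {V S : Type} [Finite V] [Fintype S] (K : Skeleton V S) (X : S → TwoTerminal) :
    TwoTerminal where
  I := V ⊕ Σ σ, (X σ).I
  E := Σ σ, (X σ).E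
  finI := inferInstance
  finE := inferInstance
  G := K.graph X
  fst := ⟨K.head, (X K.head).fst⟩
  lst := ⟨K.last, (X K.last).lst⟩
  src_iff := by
    rintro ⟨σ, e⟩
    change K.lift X σ _ = _ ↔ _
    rw [K.lift_eq_source, (X σ).src_iff]
    constructor
    · rintro ⟨rfl, rfl⟩; rfl
    · intro h
      obtain rfl : σ = K.head := congrArg Sigma.fst h
      exact ⟨by simpa using h, rfl⟩
  tgt_iff := by
    rintro ⟨σ, e⟩
    change K.lift X σ _ = _ ↔ _
    rw [K.lift_eq_sink, (X σ).tgt_iff]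
    constructor
    · rintro ⟨rfl, rfl⟩; rfl
    · intro h
      obtain rfl : σ = K.last := congrArg Sigma.fst h
      exact ⟨by simpa using h, rfl⟩
  src_ne := by
    rintro ⟨σ, e⟩ h
    exact (X σ).src_ne e ((K.lift_eq_sink X).1 h).1
  tgt_ne := by
    rintro ⟨σ, e⟩ h
    exact (X σ).tgt_ne e ((K.lift_eq_source X).1 h).1

end TwoTerminal

/-! ### Labelled drawings in frames -/

/-- A grid rectangle with two terminals on it and the directions in which the edges at the terminals
pass through them. -/
structure Frame where
  x₀ : ℤ
  x₁ : ℤ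
  y₀ : ℤ
  y₁ : ℤ
  pin : GridPt
  pout : GridPt
  din : Dir
  dout : Dir

/-- The grid point `p` lies in the rectangle of the frame. -/
def Frame.Mem (F : Frame) (p : GridPt) : Prop :=
  F.x₀ ≤ p.1 ∧ p.1 ≤ F.x₁ ∧ F.y₀ ≤ p.2 ∧ p.2 ≤ F.y₁

/-- A Knuthian drawing in a frame of a digraph with two terminals, with at most two bends on every
edge. Planarity is witnessed by a labelling of the grid points by inner vertices and edges. -/
structure FrameDrawing {I E : Type} (G : MultiDigraph (SPVertex I) E) (F : Frame) where
  pos : I → GridPt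
  bend : E → List GridPt
  label : GridPt → I ⊕ E
  sdir : E → Dir
  edir : E → Dir
  label_pos : ∀ i, label (pos i) = .inl i
  mem_pos : ∀ i, F.Mem (pos i)
  isPath : ∀ e, IsPath (SPVertex.place F.pin F.pout pos (G.src e) ::
    (bend e ++ [SPVertex.place F.pin F.pout pos (G.tgt e)])) (sdir e) (edir e)
  bend_le : ∀ e, (bend e).length ≤ 2
  mem_path : ∀ e p, OnPath p (SPVertex.place F.pin F.pout pos (G.src e) ::
    (bend e ++ [SPVertex.place F.pin F.pout pos (G.tgt e)])) → F.Mem p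
  label_path : ∀ e p, OnPath p (SPVertex.place F.pin F.pout pos (G.src e) ::
    (bend e ++ [SPVertex.place F.pin F.pout pos (G.tgt e)])) →
    label p = .inr e ∨ ∃ i, p = pos i ∧ (G.src e = .inner i ∨ G.tgt e = .inner i)
  -- This excludes routes without grid points besides their end vertices; two such routes could
  -- coincide without any conflict of labels.
  exists_label : ∀ e, ∃ p, OnPath p (SPVertex.place F.pin F.pout pos (G.src e) ::
    (bend e ++ [SPVertex.place F.pin F.pout pos (G.tgt e)])) ∧ label p = .inr e
  sdir_up : ∀ e i, G.src e = .inner i → sdir e = .up → IsJoin G i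
  edir_up : ∀ e i, G.tgt e = .inner i → edir e = .up → IsJoin G i
  sdir_source : ∀ e, G.src e = .source → sdir e = F.din
  edir_sink : ∀ e, G.tgt e = .sink → edir e = F.dout

theorem onPath_head (a : GridPt) (l : List GridPt) (hl : l ≠ []) : OnPath a (a :: l) := by
  cases l with
  | nil => exact absurd rfl hl
  | cons b l => left; simp only [OnSeg]; omega

/-! ### Gluing drawings of strands along wires -/

namespace Skeleton

variable {V S : Type} (K : Skeleton V S) (X : S → TwoTerminal)

open Classical in
/-- The bends of the edges when the strands are extended by wires. -/
noncomputable def strandBend (pre post : S → List GridPt) (bend : ∀ σ, (X σ).E → List GridPt)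
    (e : Σ σ, (X σ).E) : List GridPt :=
  ((if e.2 = (X e.1).fst then pre e.1 else []) ++ bend e.1 e.2) ++
    (if e.2 = (X e.1).lst then post e.1 else [])

open Classical in
/-- Drawings of the strands, extended by wires at their ends, make up a drawing of the whole. The
plane outside the rectangles of the strands is labelled by `W`. -/
theorem exists_frameDrawing (F : Frame) (pos : V → GridPt) (Q : S → Frame)
    (D : ∀ σ, FrameDrawing (X σ).G (Q σ)) (pre post : S → List GridPt)
    (W : GridPt → V ⊕ S × Bool) (sd ed : S → Dir)
    (hpre : ∀ σ, IsPath ((SPVertex.place F.pin F.pout pos (K.a σ) :: pre σ) ++ [(Q σ).pin])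
      (sd σ) (Q σ).din)
    (hpost : ∀ σ, IsPath ((Q σ).pout :: (post σ ++ [SPVertex.place F.pin F.pout pos (K.b σ)]))
      (Q σ).dout (ed σ))
    (hdisj : ∀ σ τ p, (Q σ).Mem p → (Q τ).Mem p → σ = τ)
    (hsub : ∀ σ p, (Q σ).Mem p → F.Mem p)
    (hW : ∀ v, W (pos v) = .inl v) (hmem : ∀ v, F.Mem (pos v)) (hpos : ∀ v σ, ¬ (Q σ).Mem (pos v))
    (hin : ∀ σ p, OnPath p ((SPVertex.place F.pin F.pout pos (K.a σ) :: pre σ) ++ [(Q σ).pin]) →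
      F.Mem p ∧ (p = (Q σ).pin ∨ (∀ τ, ¬ (Q τ).Mem p) ∧
        (W p = .inr (σ, false) ∨ ∃ v, p = pos v ∧ K.a σ = .inner v)))
    (hout : ∀ σ p, OnPath p ((Q σ).pout :: (post σ ++ [SPVertex.place F.pin F.pout pos (K.b σ)])) →
      F.Mem p ∧ (p = (Q σ).pout ∨ (∀ τ, ¬ (Q τ).Mem p) ∧
        (W p = .inr (σ, true) ∨ ∃ v, p = pos v ∧ K.b σ = .inner v)))
    (hsd : ∀ σ v, K.a σ = .inner v → sd σ = .up → IsJoin (K.graph X) (.inl v))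
    (hed : ∀ σ v, K.b σ = .inner v → ed σ = .up → IsJoin (K.graph X) (.inl v))
    (hbend : ∀ e, (strandBend X pre post (fun σ => (D σ).bend) e).length ≤ 2)
    (hhead : sd K.head = F.din) (hlast : ed K.last = F.dout) :
    ∃ D' : FrameDrawing (K.graph X) F, D'.bend = strandBend X pre post (fun σ => (D σ).bend) := by
  set pos' : V ⊕ (Σ σ, (X σ).I) → GridPt := Sum.elim pos (fun y => (D y.1).pos y.2) with hpos'
  have hpl : ∀ v : SPVertex V, SPVertex.place F.pin F.pout pos' (v.map Sum.inl) =
      SPVertex.place F.pin F.pout pos v := by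
    intro v; cases v <;> rfl
  -- the paths
  have key : ∀ σ e, ∃ s d,
      IsPath (SPVertex.place F.pin F.pout pos' ((K.graph X).src ⟨σ, e⟩) ::
        (strandBend X pre post (fun σ => (D σ).bend) ⟨σ, e⟩ ++
          [SPVertex.place F.pin F.pout pos' ((K.graph X).tgt ⟨σ, e⟩)])) s d ∧
      (s = if e = (X σ).fst then sd σ else (D σ).sdir e) ∧
      (d = if e = (X σ).lst then ed σ else (D σ).edir e) ∧
      (∀ p, OnPath p (SPVertex.place (Q σ).pin (Q σ).pout (D σ).pos ((X σ).G.src e) ::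
          ((D σ).bend e ++ [SPVertex.place (Q σ).pin (Q σ).pout (D σ).pos ((X σ).G.tgt e)])) →
        OnPath p (SPVertex.place F.pin F.pout pos' ((K.graph X).src ⟨σ, e⟩) ::
        (strandBend X pre post (fun σ => (D σ).bend) ⟨σ, e⟩ ++
          [SPVertex.place F.pin F.pout pos' ((K.graph X).tgt ⟨σ, e⟩)]))) ∧
      ∀ p, OnPath p (SPVertex.place F.pin F.pout pos' ((K.graph X).src ⟨σ, e⟩) ::
        (strandBend X pre post (fun σ => (D σ).bend) ⟨σ, e⟩ ++
          [SPVertex.place F.pin F.pout pos' ((K.graph X).tgt ⟨σ, e⟩)])) →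
        (e = (X σ).fst ∧
          OnPath p ((SPVertex.place F.pin F.pout pos (K.a σ) :: pre σ) ++ [(Q σ).pin])) ∨
        (e = (X σ).lst ∧
          OnPath p ((Q σ).pout :: (post σ ++ [SPVertex.place F.pin F.pout pos (K.b σ)]))) ∨
        OnPath p (SPVertex.place (Q σ).pin (Q σ).pout (D σ).pos ((X σ).G.src e) ::
          ((D σ).bend e ++ [SPVertex.place (Q σ).pin (Q σ).pout (D σ).pos ((X σ).G.tgt e)])) := by
    intro σ e
    have h0 := (D σ).isPath e
    -- extend at the beginning
    have h1 : ∃ s, IsPath (SPVertex.place F.pin F.pout pos' ((K.graph X).src ⟨σ, e⟩) ::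
        (((if e = (X σ).fst then pre σ else []) ++ (D σ).bend e) ++
          [SPVertex.place (Q σ).pin (Q σ).pout (D σ).pos ((X σ).G.tgt e)])) s ((D σ).edir e) ∧
        (s = if e = (X σ).fst then sd σ else (D σ).sdir e) ∧
        (∀ p, OnPath p (SPVertex.place (Q σ).pin (Q σ).pout (D σ).pos ((X σ).G.src e) ::
          ((D σ).bend e ++ [SPVertex.place (Q σ).pin (Q σ).pout (D σ).pos ((X σ).G.tgt e)])) →
        OnPath p (SPVertex.place F.pin F.pout pos' ((K.graph X).src ⟨σ, e⟩) ::
        (((if e = (X σ).fst then pre σ else []) ++ (D σ).bend e) ++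
          [SPVertex.place (Q σ).pin (Q σ).pout (D σ).pos ((X σ).G.tgt e)]))) ∧
        ∀ p, OnPath p (SPVertex.place F.pin F.pout pos' ((K.graph X).src ⟨σ, e⟩) ::
        (((if e = (X σ).fst then pre σ else []) ++ (D σ).bend e) ++
          [SPVertex.place (Q σ).pin (Q σ).pout (D σ).pos ((X σ).G.tgt e)])) →
          (e = (X σ).fst ∧
          OnPath p ((SPVertex.place F.pin F.pout pos (K.a σ) :: pre σ) ++ [(Q σ).pin])) ∨
          OnPath p (SPVertex.place (Q σ).pin (Q σ).pout (D σ).pos ((X σ).G.src e) ::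
          ((D σ).bend e ++ [SPVertex.place (Q σ).pin (Q σ).pout (D σ).pos ((X σ).G.tgt e)])) := by
      by_cases he : e = (X σ).fst
      · have hs := ((X σ).src_iff e).2 he
        have hsrc : SPVertex.place F.pin F.pout pos' ((K.graph X).src ⟨σ, e⟩) =
            SPVertex.place F.pin F.pout pos (K.a σ) := by
          simp only [graph, lift, hs, SPVertex.glue_source, hpl]
        have hd := (D σ).sdir_source e hs
        rw [hs, hd] at h0
        obtain ⟨h2, h3⟩ := IsPath.join h0 (hpre σ)
        rw [hsrc, if_pos he, if_pos he]
        refine ⟨sd σ, by simpa using h2, rfl, fun p hp => ?_, fun p hp => ?_⟩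
        · rw [hs] at hp
          simpa using (h3 p).2 (.inr hp)
        rw [hs]
        rcases (h3 p).1 (by simpa using hp) with h | h
        · exact .inl ⟨he, h⟩
        · exact .inr h
      · have hsrc : SPVertex.place F.pin F.pout pos' ((K.graph X).src ⟨σ, e⟩) =
            SPVertex.place (Q σ).pin (Q σ).pout (D σ).pos ((X σ).G.src e) := by
          cases h : (X σ).G.src e with
          | source => exact absurd (((X σ).src_iff e).1 h) he
          | sink => exact absurd h ((X σ).src_ne e)
          | inner i => simp only [graph, lift, h, SPVertex.glue_inner]; rfl
        rw [hsrc, if_neg he, if_neg he]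
        exact ⟨_, h0, rfl, fun p hp => hp, fun p hp => .inr hp⟩
    obtain ⟨s, h2, hs, h7, h3⟩ := h1
    -- The wire at the end is joined to the path that has already been extended at its beginning,
    -- because the first and the last edge of a strand may coincide.
    by_cases he : e = (X σ).lst
    · have ht := ((X σ).tgt_iff e).2 he
      have htgt : SPVertex.place F.pin F.pout pos' ((K.graph X).tgt ⟨σ, e⟩) =
          SPVertex.place F.pin F.pout pos (K.b σ) := by
        simp only [graph, lift, ht, SPVertex.glue_sink, hpl]
      have hd := (D σ).edir_sink e ht
      rw [ht, hd] at h2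
      obtain ⟨h4, h5⟩ := IsPath.join (l := SPVertex.place F.pin F.pout pos' ((K.graph X).src ⟨σ, e⟩) ::
        ((if e = (X σ).fst then pre σ else []) ++ (D σ).bend e)) (hpost σ) h2
      refine ⟨s, ed σ, ?_, hs, by rw [if_pos he], fun p hp => ?_, fun p hp => ?_⟩
      · rw [htgt, strandBend, if_pos he]
        simpa using h4
      · have h8 := h7 p hp
        rw [ht] at h8
        have h8 := (h5 p).2 (.inl h8)
        rw [htgt, strandBend, if_pos he]
        simpa using h8
      · rw [htgt, strandBend, if_pos he] at hp
        rcases (h5 p).1 (by simpa using hp) with h | h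
        · rw [ht] at h3 ⊢
          rcases h3 p h with h | h
          · exact .inl h
          · exact .inr (.inr h)
        · exact .inr (.inl ⟨he, h⟩)
    · have htgt : SPVertex.place F.pin F.pout pos' ((K.graph X).tgt ⟨σ, e⟩) =
          SPVertex.place (Q σ).pin (Q σ).pout (D σ).pos ((X σ).G.tgt e) := by
        cases h : (X σ).G.tgt e with
        | sink => exact absurd (((X σ).tgt_iff e).1 h) he
        | source => exact absurd h ((X σ).tgt_ne e)
        | inner i => simp only [graph, lift, h, SPVertex.glue_inner]; rfl
      refine ⟨s, (D σ).edir e, ?_, hs, by rw [if_neg he], fun p hp => ?_, fun p hp => ?_⟩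
      · rw [htgt, strandBend, if_neg he, List.append_nil]
        exact h2
      · rw [htgt, strandBend, if_neg he, List.append_nil]
        exact h7 p hp
      · rw [htgt, strandBend, if_neg he, List.append_nil] at hp
        rcases h3 p hp with h | h
        · exact .inl h
        · exact .inr (.inr h)
  -- the labels
  let lab : GridPt → (V ⊕ Σ σ, (X σ).I) ⊕ (Σ σ, (X σ).E) := fun p =>
    if h : ∃ σ, (Q σ).Mem p then
      Sum.map (fun i => Sum.inr ⟨h.choose, i⟩) (fun e => ⟨h.choose, e⟩) ((D h.choose).label p)
    else match W p with
      | .inl v => .inl (.inl v)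
      | .inr (σ, false) => .inr ⟨σ, (X σ).fst⟩
      | .inr (σ, true) => .inr ⟨σ, (X σ).lst⟩
  have hlab : ∀ σ p, (Q σ).Mem p →
      lab p = Sum.map (fun i => Sum.inr ⟨σ, i⟩) (fun e => ⟨σ, e⟩) ((D σ).label p) := by
    intro σ p h
    have hex : ∃ σ, (Q σ).Mem p := ⟨σ, h⟩
    -- The rectangles are disjoint, so the label does not depend on the choice of the strand.
    have : hex.choose = σ := hdisj _ _ p hex.choose_spec h
    simp only [lab, dif_pos hex]
    rw [this]
  have hlab' : ∀ p, (∀ σ, ¬ (Q σ).Mem p) → lab p = match W p with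
      | .inl v => .inl (.inl v)
      | .inr (σ, false) => .inr ⟨σ, (X σ).fst⟩
      | .inr (σ, true) => .inr ⟨σ, (X σ).lst⟩ := by
    intro p h
    exact dif_neg (not_exists.2 h)
  -- points of sub-drawings
  have hmid : ∀ σ e p, OnPath p (SPVertex.place (Q σ).pin (Q σ).pout (D σ).pos ((X σ).G.src e) ::
      ((D σ).bend e ++ [SPVertex.place (Q σ).pin (Q σ).pout (D σ).pos ((X σ).G.tgt e)])) →
      F.Mem p ∧ (lab p = .inr ⟨σ, e⟩ ∨ ∃ i, p = pos' i ∧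
        ((K.graph X).src ⟨σ, e⟩ = .inner i ∨ (K.graph X).tgt ⟨σ, e⟩ = .inner i)) := by
    intro σ e p hp
    have hm := (D σ).mem_path e p hp
    refine ⟨hsub σ p hm, ?_⟩
    rcases (D σ).label_path e p hp with h | ⟨i, h, h'⟩
    · left; rw [hlab σ p hm, h]; rfl
    · right
      refine ⟨.inr ⟨σ, i⟩, h, ?_⟩
      rcases h' with h' | h'
      · left; exact (K.lift_eq_inr X).2 ⟨i, h', rfl⟩
      · right; exact (K.lift_eq_inr X).2 ⟨i, h', rfl⟩
  have onPath_last : ∀ (l : List GridPt) (a : GridPt), l ≠ [] → OnPath a (l ++ [a]) := by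
    intro l a
    induction l with
    | nil => intro h; exact absurd rfl h
    | cons b l ih =>
      intro _
      cases l with
      | nil => left; simp only [OnSeg]; omega
      | cons c l => right; exact ih (by simp)
  have hall : ∀ σ e p, OnPath p (SPVertex.place F.pin F.pout pos' ((K.graph X).src ⟨σ, e⟩) ::
        (strandBend X pre post (fun σ => (D σ).bend) ⟨σ, e⟩ ++
          [SPVertex.place F.pin F.pout pos' ((K.graph X).tgt ⟨σ, e⟩)])) →
      F.Mem p ∧ (lab p = .inr ⟨σ, e⟩ ∨ ∃ i, p = pos' i ∧
        ((K.graph X).src ⟨σ, e⟩ = .inner i ∨ (K.graph X).tgt ⟨σ, e⟩ = .inner i)) := by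
    intro σ e p hp
    obtain ⟨_, _, _, _, _, _, h⟩ := key σ e
    rcases h p hp with ⟨he, h⟩ | ⟨he, h⟩ | h
    · have hs := ((X σ).src_iff e).2 he
      obtain ⟨h1, h2⟩ := hin σ p h
      -- The wire meets the rectangles only in its terminal, where the drawing of the strand
      -- provides the label; elsewhere `W` does.
      rcases h2 with h2 | ⟨h2, h3⟩
      · apply hmid
        rw [hs, h2]
        exact onPath_head _ _ (by simp)
      · refine ⟨h1, ?_⟩
        rcases h3 with h3 | ⟨v, h3, h4⟩
        · left; rw [hlab' p h2, h3, he]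
        · right; exact ⟨.inl v, h3, .inl ((K.lift_eq_inl X).2 (.inl ⟨hs, h4⟩))⟩
    · have ht := ((X σ).tgt_iff e).2 he
      obtain ⟨h1, h2⟩ := hout σ p h
      rcases h2 with h2 | ⟨h2, h3⟩
      · apply hmid
        rw [ht, h2]
        exact onPath_last (_ :: _) _ (by simp)
      · refine ⟨h1, ?_⟩
        rcases h3 with h3 | ⟨v, h3, h4⟩
        · left; rw [hlab' p h2, h3, he]
        · right; exact ⟨.inl v, h3, .inr ((K.lift_eq_inl X).2 (.inr ⟨ht, h4⟩))⟩
    · exact hmid σ e p h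
  refine ⟨{
    pos := pos'
    bend := strandBend X pre post (fun σ => (D σ).bend)
    label := lab
    sdir := fun e => if e.2 = (X e.1).fst then sd e.1 else (D e.1).sdir e.2
    edir := fun e => if e.2 = (X e.1).lst then ed e.1 else (D e.1).edir e.2
    label_pos := ?_
    mem_pos := ?_
    isPath := ?_
    bend_le := hbend
    mem_path := fun e p h => (hall e.1 e.2 p h).1
    label_path := fun e p h => (hall e.1 e.2 p h).2
    exists_label := ?_
    sdir_up := ?_
    edir_up := ?_
    sdir_source := ?_
    edir_sink := ?_ }, rfl⟩
  · rintro (v | ⟨σ, i⟩)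
    · change lab (pos v) = _
      rw [hlab' _ (hpos v), hW]
    · change lab ((D σ).pos i) = _
      rw [hlab σ _ ((D σ).mem_pos i), (D σ).label_pos]; rfl
  · rintro (v | ⟨σ, i⟩)
    · exact hmem v
    · exact hsub σ _ ((D σ).mem_pos i)
  · rintro ⟨σ, e⟩
    obtain ⟨s, d, h, hs, hd, _, _⟩ := key σ e
    subst hs hd
    exact h
  · rintro ⟨σ, e⟩
    obtain ⟨_, _, _, _, _, h, _⟩ := key σ e
    obtain ⟨p, hp, hp'⟩ := (D σ).exists_label e
    exact ⟨p, h p hp, by rw [hlab σ p ((D σ).mem_path e p hp), hp']; rfl⟩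
  · rintro ⟨σ, e⟩ (v | y) h h'
    · rcases (K.lift_eq_inl X).1 h with ⟨h1, h2⟩ | ⟨h1, _⟩
      · rw [if_pos (((X σ).src_iff e).1 h1)] at h'
        exact hsd σ v h2 h'
      · exact absurd h1 ((X σ).src_ne e)
    · obtain ⟨i, h1, rfl⟩ := (K.lift_eq_inr X).1 h
      have h1 : (X σ).G.src e = .inner i := h1
      have hne : e ≠ (X σ).fst := by
        intro he; rw [((X σ).src_iff e).2 he] at h1; cases h1
      rw [if_neg hne] at h'
      exact K.isJoin_inr X ((D σ).sdir_up e i h1 h')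
  · rintro ⟨σ, e⟩ (v | y) h h'
    · rcases (K.lift_eq_inl X).1 h with ⟨h1, _⟩ | ⟨h1, h2⟩
      · exact absurd h1 ((X σ).tgt_ne e)
      · rw [if_pos (((X σ).tgt_iff e).1 h1)] at h'
        exact hed σ v h2 h'
    · obtain ⟨i, h1, rfl⟩ := (K.lift_eq_inr X).1 h
      have h1 : (X σ).G.tgt e = .inner i := h1
      have hne : e ≠ (X σ).lst := by
        intro he; rw [((X σ).tgt_iff e).2 he] at h1; cases h1
      rw [if_neg hne] at h'
      exact K.isJoin_inr X ((D σ).edir_up e i h1 h')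
  · rintro ⟨σ, e⟩ h
    obtain ⟨h1, h2⟩ := (K.lift_eq_source X).1 h
    rw [if_pos (((X σ).src_iff e).1 h1), ← hhead, ← h2]
  · rintro ⟨σ, e⟩ h
    obtain ⟨h1, h2⟩ := (K.lift_eq_sink X).1 h
    rw [if_pos (((X σ).tgt_iff e).1 h1), ← hlast, ← h2]

end Skeleton

/-- There is a drawing in the frame with the given numbers of bends. -/
def HasDrawing {I E : Type} (G : MultiDigraph (SPVertex I) E) (F : Frame) (n : E → ℕ) : Prop :=
  ∃ D : FrameDrawing G F, ∀ e, (D.bend e).length = n e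

namespace Frame

/-- A frame that is traversed from left to right; `(x, y)` is its upper left corner. -/
def lr (x y w h a b : ℤ) : Frame :=
  ⟨x, x + w, y - h, y, (x, y + a), (x + w, y + b), .right, .right⟩

/-- A frame that is traversed from right to left; `(x, y)` is its upper left corner. -/
def rl (x y w h a b : ℤ) : Frame :=
  ⟨x, x + w, y - h, y, (x + w, y + a), (x, y + b), .left, .left⟩

/-- A frame that is entered at the upper left corner `(x, y)` and left at the lower left corner. -/
def uturn (x y w h : ℤ) : Frame :=
  ⟨x, x + w, y - h, y, (x, y), (x, y - h), .right, .left⟩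

end Frame

/-! ### Translations and reflections of drawings -/

section Transform

variable {T : GridPt ≃ GridPt} {δ : Dir → Dir}

theorem IsPath.map (hδ : ∀ d e, Dir.Perp d e → Dir.Perp (δ d) (δ e))
    (hT : ∀ a b d, SegDir a b d → SegDir (T a) (T b) (δ d)) :
    ∀ {l : List GridPt} {s e : Dir}, IsPath l s e → IsPath (l.map T) (δ s) (δ e)
  | [_, _], _, _, h => ⟨hT _ _ _ h.1, congrArg δ h.2⟩
  | _ :: _ :: _ :: _, _, _, ⟨h1, s', h2, h3⟩ =>
    ⟨hT _ _ _ h1, δ s', hδ _ _ h2, IsPath.map hδ hT h3⟩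

theorem onPath_map (hT : ∀ p a b, OnSeg (T p) (T a) (T b) ↔ OnSeg p a b) (p : GridPt) :
    ∀ l : List GridPt, OnPath (T p) (l.map T) ↔ OnPath p l
  | [] => Iff.rfl
  | [_] => Iff.rfl
  | _ :: b :: l => or_congr (hT _ _ _) (onPath_map hT p (b :: l))

variable {I E : Type} {G : MultiDigraph (SPVertex I) E} {F F' : Frame} {n : E → ℕ}

/-- The labels are carried along by `T`. For the Knuthian condition it is enough that a segment
which points upwards in the image did so before, which is `hup`. -/
theorem HasDrawing.map (hδ : ∀ d e, Dir.Perp d e → Dir.Perp (δ d) (δ e))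
    (hup : ∀ d, δ d = .up → d = .up)
    (hT : ∀ a b d, SegDir a b d → SegDir (T a) (T b) (δ d))
    (hO : ∀ p a b, OnSeg (T p) (T a) (T b) ↔ OnSeg p a b)
    (hF : ∀ p, F'.Mem (T p) ↔ F.Mem p) (hin : T F.pin = F'.pin) (hout : T F.pout = F'.pout)
    (hdin : δ F.din = F'.din) (hdout : δ F.dout = F'.dout) (h : HasDrawing G F n) :
    HasDrawing G F' n := by
  obtain ⟨D, hD⟩ := h
  have hpl : ∀ v, SPVertex.place F'.pin F'.pout (fun i => T (D.pos i)) v =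
      T (SPVertex.place F.pin F.pout D.pos v) := by
    intro v; cases v
    · exact hin.symm
    · exact hout.symm
    · rfl
  have hroute : ∀ e, SPVertex.place F'.pin F'.pout (fun i => T (D.pos i)) (G.src e) ::
      ((D.bend e).map T ++ [SPVertex.place F'.pin F'.pout (fun i => T (D.pos i)) (G.tgt e)]) =
      (SPVertex.place F.pin F.pout D.pos (G.src e) ::
        (D.bend e ++ [SPVertex.place F.pin F.pout D.pos (G.tgt e)])).map T := by
    intro e; simp [hpl]
  have hon : ∀ e p, OnPath p (SPVertex.place F'.pin F'.pout (fun i => T (D.pos i)) (G.src e) ::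
      ((D.bend e).map T ++ [SPVertex.place F'.pin F'.pout (fun i => T (D.pos i)) (G.tgt e)])) →
      OnPath (T.symm p) (SPVertex.place F.pin F.pout D.pos (G.src e) ::
        (D.bend e ++ [SPVertex.place F.pin F.pout D.pos (G.tgt e)])) := by
    intro e p hp
    rw [hroute, ← T.apply_symm_apply p, onPath_map hO] at hp
    exact hp
  refine ⟨{
    pos := fun i => T (D.pos i)
    bend := fun e => (D.bend e).map T
    label := fun p => D.label (T.symm p)
    sdir := fun e => δ (D.sdir e)
    edir := fun e => δ (D.edir e)
    label_pos := fun i => by simp [D.label_pos]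
    mem_pos := fun i => (hF _).2 (D.mem_pos i)
    isPath := fun e => by rw [hroute]; exact (D.isPath e).map hδ hT
    bend_le := fun e => by simpa using D.bend_le e
    mem_path := fun e p hp => by
      rw [← T.apply_symm_apply p]
      exact (hF _).2 (D.mem_path e _ (hon e p hp))
    label_path := fun e p hp => by
      rcases D.label_path e _ (hon e p hp) with h | ⟨i, h, h'⟩
      · exact .inl h
      · exact .inr ⟨i, by simp [← h], h'⟩
    exists_label := fun e => by
      obtain ⟨p, hp, hp'⟩ := D.exists_label e
      exact ⟨T p, by rw [hroute]; exact (onPath_map hO p _).2 hp, by simpa using hp'⟩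
    sdir_up := fun e i h h' => D.sdir_up e i h (hup _ h')
    edir_up := fun e i h h' => D.edir_up e i h (hup _ h')
    sdir_source := fun e h => by rw [D.sdir_source e h, hdin]
    edir_sink := fun e h => by rw [D.edir_sink e h, hdout] }, fun e => by simp [hD]⟩

/-- Translations of the grid. -/
def shiftEquiv (x y : ℤ) : GridPt ≃ GridPt := (Equiv.addRight x).prodCongr (Equiv.addRight y)

/-- A reflection in a vertical line, followed by a vertical translation. -/
def mirrorEquiv (x y : ℤ) : GridPt ≃ GridPt := (Equiv.subLeft x).prodCongr (Equiv.addRight y)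

theorem HasDrawing.shift {x₀ x₁ y₀ y₁ px py qx qy : ℤ} {d e : Dir}
    (h : HasDrawing G ⟨x₀, x₁, y₀, y₁, (px, py), (qx, qy), d, e⟩ n) (x y : ℤ) :
    HasDrawing G ⟨x₀ + x, x₁ + x, y₀ + y, y₁ + y, (px + x, py + y), (qx + x, qy + y), d, e⟩ n := by
  refine HasDrawing.map (F := ⟨x₀, x₁, y₀, y₁, (px, py), (qx, qy), d, e⟩) (T := shiftEquiv x y) (δ := id) (fun _ _ h => h) (fun _ h => h) ?_ ?_ ?_
    rfl rfl rfl rfl h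
  · intro a b d
    cases d <;> simp only [SegDir, shiftEquiv, id, Equiv.prodCongr_apply, Prod.map,
      Equiv.coe_addRight] <;> omega
  · intro p a b
    simp only [OnSeg, shiftEquiv, Equiv.prodCongr_apply, Prod.map, Equiv.coe_addRight]
    omega
  · intro p
    simp only [Frame.Mem, shiftEquiv, Equiv.prodCongr_apply, Prod.map, Equiv.coe_addRight]
    omega

/-- A reflection in a vertical line does not create upward segments. It is what allows strands to be
drawn from right to left inside a U-turn. -/
theorem HasDrawing.mirror {x₀ x₁ y₀ y₁ px py qx qy : ℤ} {d e : Dir}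
    (h : HasDrawing G ⟨x₀, x₁, y₀, y₁, (px, py), (qx, qy), d, e⟩ n) (x y : ℤ) :
    HasDrawing G ⟨x - x₁, x - x₀, y₀ + y, y₁ + y, (x - px, py + y), (x - qx, qy + y),
      d.flip, e.flip⟩ n := by
  refine HasDrawing.map (F := ⟨x₀, x₁, y₀, y₁, (px, py), (qx, qy), d, e⟩) (T := mirrorEquiv x y)
    (δ := Dir.flip) ?_ ?_ ?_ ?_ ?_
    rfl rfl rfl rfl h
  · intro d e
    cases d <;> cases e <;> simp [Dir.Perp, Dir.flip, Dir.IsHor]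
  · intro d
    cases d <;> simp [Dir.flip]
  · intro a b d
    cases d <;> simp only [SegDir, mirrorEquiv, Dir.flip, Equiv.prodCongr_apply, Prod.map,
      Equiv.coe_addRight, Equiv.subLeft_apply] <;> omega
  · intro p a b
    simp only [OnSeg, mirrorEquiv, Equiv.prodCongr_apply, Prod.map, Equiv.coe_addRight,
      Equiv.subLeft_apply]
    omega
  · intro p
    simp only [Frame.Mem, mirrorEquiv, Equiv.prodCongr_apply, Prod.map, Equiv.coe_addRight,
      Equiv.subLeft_apply]
    omega

theorem HasDrawing.lr {w h a b : ℤ} (hD : HasDrawing G (Frame.lr 0 0 w h a b) n) (x y : ℤ) :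
    HasDrawing G (Frame.lr x y w h a b) n := by
  have := HasDrawing.shift hD x y
  convert this using 1
  simp only [Frame.lr, Frame.mk.injEq, Prod.mk.injEq, and_true]
  omega

theorem HasDrawing.rl {w h a b : ℤ} (hD : HasDrawing G (Frame.lr 0 0 w h a b) n) (x y : ℤ) :
    HasDrawing G (Frame.rl x y w h a b) n := by
  have := HasDrawing.mirror hD (x + w) y
  convert this using 1
  simp only [Frame.rl, Frame.mk.injEq, Prod.mk.injEq, Dir.flip, and_true]
  omega

theorem HasDrawing.uturn {w h : ℤ} (hD : HasDrawing G (Frame.uturn 0 0 w h) n) (x y : ℤ) :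
    HasDrawing G (Frame.uturn x y w h) n := by
  have := HasDrawing.shift hD x y
  convert this using 1
  simp only [Frame.uturn, Frame.mk.injEq, Prod.mk.injEq, and_true]
  omega

end Transform

/-! ### Drawings of a single edge -/

theorem TwoTerminal.hasDrawing_single_lr {w h a : ℤ} (hw : 0 < w) (ha : -h ≤ a) (ha' : a ≤ 0) :
    HasDrawing single.G (Frame.lr 0 0 w h a a) (fun _ => 0) := by
  refine ⟨{
    pos := Empty.elim
    bend := fun _ => []
    label := fun _ => .inr ()
    sdir := fun _ => .right
    edir := fun _ => .right
    label_pos := fun i => i.elim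
    mem_pos := fun i => i.elim
    isPath := fun e => ?_
    bend_le := fun e => by simp
    mem_path := fun e p hp => ?_
    label_path := fun e p hp => .inl rfl
    exists_label := fun e => ⟨_, onPath_head _ _ (by simp), rfl⟩
    sdir_up := fun e i => i.elim
    edir_up := fun e i => i.elim
    sdir_source := fun e _ => rfl
    edir_sink := fun e _ => rfl }, fun e => rfl⟩
  · simp only [single, SPVertex.place, Frame.lr, List.nil_append, IsPath, SegDir, true_and, and_true]
    omega
  · simp only [single, SPVertex.place, Frame.lr, List.nil_append, OnPath, OnSeg, or_false] at hp
    simp only [Frame.lr, Frame.Mem]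
    omega

theorem TwoTerminal.hasDrawing_single_uturn {w h : ℤ} (hw : 0 < w) (hh : 0 < h) :
    HasDrawing single.G (Frame.uturn 0 0 w h) (fun _ => 2) := by
  refine ⟨{
    pos := Empty.elim
    bend := fun _ => [(w, 0), (w, -h)]
    label := fun _ => .inr ()
    sdir := fun _ => .right
    edir := fun _ => .left
    label_pos := fun i => i.elim
    mem_pos := fun i => i.elim
    isPath := fun e => ?_
    bend_le := fun e => by simp
    mem_path := fun e p hp => ?_
    label_path := fun e p hp => .inl rfl
    exists_label := fun e => ⟨_, onPath_head _ _ (by simp), rfl⟩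
    sdir_up := fun e i => i.elim
    edir_up := fun e i => i.elim
    sdir_source := fun e _ => rfl
    edir_sink := fun e _ => rfl }, fun e => rfl⟩
  · refine ⟨?_, .down, by simp [Dir.Perp, Dir.IsHor], ?_, .left,
      by simp [Dir.Perp, Dir.IsHor], ?_, rfl⟩ <;>
    simp only [single, SPVertex.place, Frame.uturn, SegDir, true_and] <;> omega
  · simp only [single, SPVertex.place, Frame.uturn, List.cons_append, List.nil_append, OnPath,
      OnSeg, or_false] at hp
    simp only [Frame.uturn, Frame.Mem]
    omega

/-! ### Assembling `node` and `vert` from drawings of their strands -/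

section Strands

variable {V S : Type}

open Classical in
/-- Bend numbers of the edges when the strands are extended by wires. -/
noncomputable def strandCount (X : S → TwoTerminal) (n : ∀ σ, (X σ).E → ℕ) (p q : S → ℕ)
    (e : Σ σ, (X σ).E) : ℕ :=
  (if e.2 = (X e.1).fst then p e.1 else 0) + n e.1 e.2 + (if e.2 = (X e.1).lst then q e.1 else 0)

/-- Combine drawings of the strands of a skeleton. -/
theorem HasDrawing.strands {K : Skeleton V S} {X : S → TwoTerminal} {Q : S → Frame}
    {n : ∀ σ, (X σ).E → ℕ} (hD : ∀ σ, HasDrawing (X σ).G (Q σ) (n σ))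
    (F : Frame) (pos : V → GridPt) (pre post : S → List GridPt)
    (W : GridPt → V ⊕ S × Bool) (sd ed : S → Dir)
    (hpre : ∀ σ, IsPath ((SPVertex.place F.pin F.pout pos (K.a σ) :: pre σ) ++ [(Q σ).pin])
      (sd σ) (Q σ).din)
    (hpost : ∀ σ, IsPath ((Q σ).pout :: (post σ ++ [SPVertex.place F.pin F.pout pos (K.b σ)]))
      (Q σ).dout (ed σ))
    (hdisj : ∀ σ τ p, (Q σ).Mem p → (Q τ).Mem p → σ = τ)
    (hsub : ∀ σ p, (Q σ).Mem p → F.Mem p)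
    (hW : ∀ v, W (pos v) = .inl v) (hmem : ∀ v, F.Mem (pos v)) (hpos : ∀ v σ, ¬ (Q σ).Mem (pos v))
    (hin : ∀ σ p, OnPath p ((SPVertex.place F.pin F.pout pos (K.a σ) :: pre σ) ++ [(Q σ).pin]) →
      F.Mem p ∧ (p = (Q σ).pin ∨ (∀ τ, ¬ (Q τ).Mem p) ∧
        (W p = .inr (σ, false) ∨ ∃ v, p = pos v ∧ K.a σ = .inner v)))
    (hout : ∀ σ p, OnPath p ((Q σ).pout :: (post σ ++ [SPVertex.place F.pin F.pout pos (K.b σ)])) →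
      F.Mem p ∧ (p = (Q σ).pout ∨ (∀ τ, ¬ (Q τ).Mem p) ∧
        (W p = .inr (σ, true) ∨ ∃ v, p = pos v ∧ K.b σ = .inner v)))
    (hsd : ∀ σ v, K.a σ = .inner v → sd σ = .up → IsJoin (K.graph X) (.inl v))
    (hed : ∀ σ v, K.b σ = .inner v → ed σ = .up → IsJoin (K.graph X) (.inl v))
    (hbend : ∀ e, strandCount X n (fun σ => (pre σ).length) (fun σ => (post σ).length) e ≤ 2)
    (hhead : sd K.head = F.din) (hlast : ed K.last = F.dout) :
    HasDrawing (K.graph X) F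
      (strandCount X n (fun σ => (pre σ).length) (fun σ => (post σ).length)) := by
  choose D hD using hD
  have hlen : ∀ e, (Skeleton.strandBend X pre post (fun σ => (D σ).bend) e).length =
      strandCount X n (fun σ => (pre σ).length) (fun σ => (post σ).length) e := by
    intro e
    simp only [Skeleton.strandBend, strandCount, List.length_append, hD]
    split_ifs <;> simp
  obtain ⟨D', hD'⟩ := K.exists_frameDrawing X F pos Q D pre post W sd ed hpre hpost hdisj hsub hW
    hmem hpos hin hout hsd hed (fun e => (hlen e).trans_le (hbend e)) hhead hlast
  exact ⟨D', fun e => by rw [hD', hlen]⟩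

end Strands

/-- The strands of a chain that starts with an edge and a parallel composition. -/
inductive NodeStrand where
  | edge | a | b | r
  deriving DecidableEq

instance : Fintype NodeStrand :=
  ⟨{.edge, .a, .b, .r}, fun σ => by cases σ <;> simp⟩

theorem NodeStrand.sum_univ (f : NodeStrand → ℕ) :
    ∑ σ, f σ = f .edge + f .a + f .b + f .r := by
  change ∑ σ ∈ ({.edge, .a, .b, .r} : Finset NodeStrand), f σ = _
  simp [add_assoc]

/-- The source and the sink of a parallel composition inside a chain. -/
inductive NodeVertex where
  | split | join

instance : Finite NodeVertex :=
  Finite.of_injective (fun v : NodeVertex => match v with | .split => true | .join => false)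
    (by rintro (_ | _) (_ | _) h <;> simp_all)

/-- An edge, two parallel strands, and another strand. -/
def nodeSkeleton : Skeleton NodeVertex NodeStrand where
  a
    | .edge => .source
    | .a => .inner .split
    | .b => .inner .split
    | .r => .inner .join
  b
    | .edge => .inner .split
    | .a => .inner .join
    | .b => .inner .join
    | .r => .sink
  head := .edge
  last := .r
  a_iff := by rintro (_ | _ | _ | _) <;> simp
  b_iff := by rintro (_ | _ | _ | _) <;> simp
  a_ne := by rintro (_ | _ | _ | _) <;> simp
  b_ne := by rintro (_ | _ | _ | _) <;> simp

/-- An edge and another strand. -/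
def vertSkeleton : Skeleton Unit Bool where
  a σ := if σ then .inner () else .source
  b σ := if σ then .sink else .inner ()
  head := false
  last := true
  a_iff := by rintro (_ | _) <;> simp
  b_iff := by rintro (_ | _) <;> simp
  a_ne := by rintro (_ | _) <;> simp
  b_ne := by rintro (_ | _) <;> simp

namespace TwoTerminal

/-- The strands of `node`. -/
def nodeFamily (X Y Z : TwoTerminal) : NodeStrand → TwoTerminal
  | .edge => single
  | .a => X
  | .b => Y
  | .r => Z

/-- An edge, followed by the parallel composition of `X` and `Y`, followed by `Z`. -/
def node (X Y Z : TwoTerminal) : TwoTerminal := subst nodeSkeleton (nodeFamily X Y Z)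

/-- The strands of `vert`. -/
def vertFamily (Z : TwoTerminal) (σ : Bool) : TwoTerminal := if σ then Z else single

/-- An edge followed by `Z`. -/
def vert (Z : TwoTerminal) : TwoTerminal := subst vertSkeleton (vertFamily Z)

end TwoTerminal

open TwoTerminal

/-- Bend numbers on a strand that is extended by wires with `p` and `q` bends. -/
noncomputable def extCount (X : TwoTerminal) (n : X.E → ℕ) (p q : ℕ) (e : X.E) : ℕ :=
  open Classical in (if e = X.fst then p else 0) + n e + (if e = X.lst then q else 0)

/-- Bend numbers on the strands of `node`. -/
noncomputable def nodeCount {X Y Z : TwoTerminal} (n₁ : X.E → ℕ) (n₂ : Y.E → ℕ) (n₃ : Z.E → ℕ)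
    (p₁ q₁ p₂ q₂ p₃ q₃ : ℕ) : (node X Y Z).E → ℕ
  | ⟨.edge, _⟩ => 0
  | ⟨.a, e⟩ => extCount X n₁ p₁ q₁ e
  | ⟨.b, e⟩ => extCount Y n₂ p₂ q₂ e
  | ⟨.r, e⟩ => extCount Z n₃ p₃ q₃ e

theorem sum_extCount (X : TwoTerminal) (n : X.E → ℕ) (p q : ℕ) :
    ∑ e, extCount X n p q e = ∑ e, n e + p + q := by
  classical
  simp only [extCount, Finset.sum_add_distrib, Finset.sum_ite_eq', Finset.mem_univ, if_true]
  omega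

theorem sum_nodeCount {X Y Z : TwoTerminal} (n₁ : X.E → ℕ) (n₂ : Y.E → ℕ) (n₃ : Z.E → ℕ)
    (p₁ q₁ p₂ q₂ p₃ q₃ : ℕ) :
    ∑ e, nodeCount n₁ n₂ n₃ p₁ q₁ p₂ q₂ p₃ q₃ e =
      (∑ e, n₁ e + p₁ + q₁) + (∑ e, n₂ e + p₂ + q₂) + (∑ e, n₃ e + p₃ + q₃) := by
  have h := Fintype.sum_sigma (nodeCount n₁ n₂ n₃ p₁ q₁ p₂ q₂ p₃ q₃)
  refine h.trans ?_
  rw [NodeStrand.sum_univ]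
  have h0 : ∑ e : (nodeFamily X Y Z .edge).E,
      nodeCount n₁ n₂ n₃ p₁ q₁ p₂ q₂ p₃ q₃ ⟨.edge, e⟩ = 0 := Finset.sum_eq_zero fun _ _ => rfl
  rw [← sum_extCount X n₁ p₁ q₁, ← sum_extCount Y n₂ p₂ q₂, ← sum_extCount Z n₃ p₃ q₃]
  refine (congrArg (fun z => z + _ + _ + _) h0).trans ?_
  exact congrArg (fun z => z + _ + _) (zero_add _)

/-- The points of a wire lie in the frame `F`, avoid the rectangles of the strands except at the
terminal `p`, and satisfy `P`. -/
def WireClear (F Q₀ Q₁ Q₂ Q₃ : Frame) (l : List GridPt) (p : GridPt) (P : ℤ → ℤ → Prop) : Prop :=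
  ∀ x y, OnPath (x, y) l → F.Mem (x, y) ∧ ((x, y) = p ∨
    (¬ Q₀.Mem (x, y) ∧ ¬ Q₁.Mem (x, y) ∧ ¬ Q₂.Mem (x, y) ∧ ¬ Q₃.Mem (x, y)) ∧ P x y)

/-- This specializes the gluing of strands to a form in which a layout is checked by linear
arithmetic: `s` and `t` are the places of split and join, the lists are the bends of the wires, and
`code` labels the grid points outside the rectangles. Upward wires have to be excluded only where
they leave the split. The initial edge enters the split horizontally, and the join has two incoming
edges and one outgoing edge. -/
theorem HasDrawing.node {X Y Z : TwoTerminal} {Q₁ Q₂ Q₃ : Frame} {n₁ : X.E → ℕ} {n₂ : Y.E → ℕ}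
    {n₃ : Z.E → ℕ} (h₁ : HasDrawing X.G Q₁ n₁) (h₂ : HasDrawing Y.G Q₂ n₂)
    (h₃ : HasDrawing Z.G Q₃ n₃) (F : Frame) (s t : GridPt) (x y : ℤ)
    (p₁ q₁ p₂ q₂ p₃ q₃ : List GridPt) {d₁ e₁ d₂ e₂ d₃ : Dir} (code : ℤ → ℤ → ℕ)
    (hF : F.pin.2 = y ∧ F.pin.1 < x) (hs : s.2 = y ∧ x + 1 < s.1) (hdin : F.din = .right)
    (ip₁ : IsPath (s :: p₁ ++ [Q₁.pin]) d₁ Q₁.din) (iq₁ : IsPath (Q₁.pout :: (q₁ ++ [t])) Q₁.dout e₁)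
    (ip₂ : IsPath (s :: p₂ ++ [Q₂.pin]) d₂ Q₂.din) (iq₂ : IsPath (Q₂.pout :: (q₂ ++ [t])) Q₂.dout e₂)
    (ip₃ : IsPath (t :: p₃ ++ [Q₃.pin]) d₃ Q₃.din)
    (iq₃ : IsPath (Q₃.pout :: (q₃ ++ [F.pout])) Q₃.dout F.dout)
    (hd₁ : d₁ ≠ .up) (hd₂ : d₂ ≠ .up)
    (hdisj : ∀ u v,
      ¬ ((Frame.lr x y 1 0 0 0).Mem (u, v) ∧ Q₁.Mem (u, v)) ∧
      ¬ ((Frame.lr x y 1 0 0 0).Mem (u, v) ∧ Q₂.Mem (u, v)) ∧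
      ¬ ((Frame.lr x y 1 0 0 0).Mem (u, v) ∧ Q₃.Mem (u, v)) ∧
      ¬ (Q₁.Mem (u, v) ∧ Q₂.Mem (u, v)) ∧ ¬ (Q₁.Mem (u, v) ∧ Q₃.Mem (u, v)) ∧
      ¬ (Q₂.Mem (u, v) ∧ Q₃.Mem (u, v)))
    (hsub : ∀ u v, ((Frame.lr x y 1 0 0 0).Mem (u, v) → F.Mem (u, v)) ∧
      (Q₁.Mem (u, v) → F.Mem (u, v)) ∧ (Q₂.Mem (u, v) → F.Mem (u, v)) ∧
      (Q₃.Mem (u, v) → F.Mem (u, v)))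
    (hcs : code s.1 s.2 = 0) (hct : code t.1 t.2 = 1)
    (hms : F.Mem s ∧ ¬ (Frame.lr x y 1 0 0 0).Mem s ∧ ¬ Q₁.Mem s ∧ ¬ Q₂.Mem s ∧ ¬ Q₃.Mem s)
    (hmt : F.Mem t ∧ ¬ (Frame.lr x y 1 0 0 0).Mem t ∧ ¬ Q₁.Mem t ∧ ¬ Q₂.Mem t ∧ ¬ Q₃.Mem t)
    (w₀ : WireClear F (Frame.lr x y 1 0 0 0) Q₁ Q₂ Q₃ [F.pin, (x, y)] (x, y)
      (fun u v => code u v = 2))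
    (w₀' : WireClear F (Frame.lr x y 1 0 0 0) Q₁ Q₂ Q₃ [(x + 1, y), s] (x + 1, y)
      (fun u v => code u v = 3 ∨ (u, v) = s))
    (w₁ : WireClear F (Frame.lr x y 1 0 0 0) Q₁ Q₂ Q₃ (s :: p₁ ++ [Q₁.pin]) Q₁.pin
      (fun u v => code u v = 4 ∨ (u, v) = s))
    (w₁' : WireClear F (Frame.lr x y 1 0 0 0) Q₁ Q₂ Q₃ (Q₁.pout :: (q₁ ++ [t])) Q₁.pout
      (fun u v => code u v = 5 ∨ (u, v) = t))
    (w₂ : WireClear F (Frame.lr x y 1 0 0 0) Q₁ Q₂ Q₃ (s :: p₂ ++ [Q₂.pin]) Q₂.pin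
      (fun u v => code u v = 6 ∨ (u, v) = s))
    (w₂' : WireClear F (Frame.lr x y 1 0 0 0) Q₁ Q₂ Q₃ (Q₂.pout :: (q₂ ++ [t])) Q₂.pout
      (fun u v => code u v = 7 ∨ (u, v) = t))
    (w₃ : WireClear F (Frame.lr x y 1 0 0 0) Q₁ Q₂ Q₃ (t :: p₃ ++ [Q₃.pin]) Q₃.pin
      (fun u v => code u v = 8 ∨ (u, v) = t))
    (w₃' : WireClear F (Frame.lr x y 1 0 0 0) Q₁ Q₂ Q₃ (Q₃.pout :: (q₃ ++ [F.pout])) Q₃.pout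
      (fun u v => code u v = 9))
    (b₁ : ∀ e, extCount X n₁ p₁.length q₁.length e ≤ 2)
    (b₂ : ∀ e, extCount Y n₂ p₂.length q₂.length e ≤ 2)
    (b₃ : ∀ e, extCount Z n₃ p₃.length q₃.length e ≤ 2) :
    HasDrawing (node X Y Z).G F
      (nodeCount n₁ n₂ n₃ p₁.length q₁.length p₂.length q₂.length p₃.length q₃.length) := by
  let Q : NodeStrand → Frame := fun σ =>
    match σ with | .edge => Frame.lr x y 1 0 0 0 | .a => Q₁ | .b => Q₂ | .r => Q₃
  let n : ∀ σ, (nodeFamily X Y Z σ).E → ℕ := fun σ =>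
    match σ with | .edge => fun _ => 0 | .a => n₁ | .b => n₂ | .r => n₃
  let pre : NodeStrand → List GridPt := fun σ =>
    match σ with | .edge => [] | .a => p₁ | .b => p₂ | .r => p₃
  let post : NodeStrand → List GridPt := fun σ =>
    match σ with | .edge => [] | .a => q₁ | .b => q₂ | .r => q₃
  let sd : NodeStrand → Dir := fun σ =>
    match σ with | .edge => .right | .a => d₁ | .b => d₂ | .r => d₃
  let ed : NodeStrand → Dir := fun σ =>
    match σ with | .edge => .right | .a => e₁ | .b => e₂ | .r => F.dout
  let pos : NodeVertex → GridPt := fun v => match v with | .split => s | .join => t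
  let W : GridPt → NodeVertex ⊕ NodeStrand × Bool := fun p =>
    -- Apart from the codes of split and join, an even code is the wire into a strand, and the next
    -- odd code is the wire out of it.
    match code p.1 p.2 with
    | 0 => .inl .split | 1 => .inl .join
    | 2 => .inr (.edge, false) | 3 => .inr (.edge, true)
    | 4 => .inr (.a, false) | 5 => .inr (.a, true)
    | 6 => .inr (.b, false) | 7 => .inr (.b, true)
    | 8 => .inr (.r, false) | _ => .inr (.r, true)
  have hcount : (nodeCount n₁ n₂ n₃ p₁.length q₁.length p₂.length q₂.length p₃.length q₃.length) =
      strandCount (nodeFamily X Y Z) n (fun σ => (pre σ).length) (fun σ => (post σ).length) := by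
    funext ⟨σ, e⟩
    cases σ
    · change 0 = _
      simp [strandCount, n, pre, post]
    all_goals rfl
  have htau : ∀ p : GridPt, (¬ (Frame.lr x y 1 0 0 0).Mem p ∧ ¬ Q₁.Mem p ∧ ¬ Q₂.Mem p ∧ ¬ Q₃.Mem p) →
      ∀ τ, ¬ (Q τ).Mem p := by
    rintro p ⟨a0, a1, a2, a3⟩ τ
    cases τ <;> assumption
  rw [hcount]
  refine HasDrawing.strands (K := nodeSkeleton) (Q := Q) (n := n) ?_ F pos pre post W sd ed
    ?_ ?_ ?_ ?_ ?_ ?_ ?_ ?_ ?_ ?_ ?_ ?_ ?_ ?_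
  · intro σ
    cases σ
    · exact (hasDrawing_single_lr one_pos (by omega) le_rfl).lr x y
    · exact h₁
    · exact h₂
    · exact h₃
  · intro σ
    cases σ
    · refine ⟨?_, rfl⟩
      change F.pin.2 = y + 0 ∧ F.pin.1 < x
      omega
    · exact ip₁
    · exact ip₂
    · exact ip₃
  · intro σ
    cases σ
    · refine ⟨?_, rfl⟩
      change y + 0 = s.2 ∧ x + 1 < s.1
      omega
    · exact iq₁
    · exact iq₂
    · exact iq₃
  · rintro σ τ ⟨u, v⟩ hσ hτ
    obtain ⟨k1, k2, k3, k4, k5, k6⟩ := hdisj u v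
    cases σ <;> cases τ <;> first
      | rfl
      | exact (k1 ⟨hσ, hτ⟩).elim
      | exact (k2 ⟨hσ, hτ⟩).elim
      | exact (k3 ⟨hσ, hτ⟩).elim
      | exact (k4 ⟨hσ, hτ⟩).elim
      | exact (k5 ⟨hσ, hτ⟩).elim
      | exact (k6 ⟨hσ, hτ⟩).elim
      | exact (k1 ⟨hτ, hσ⟩).elim
      | exact (k2 ⟨hτ, hσ⟩).elim
      | exact (k3 ⟨hτ, hσ⟩).elim
      | exact (k4 ⟨hτ, hσ⟩).elim
      | exact (k5 ⟨hτ, hσ⟩).elim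
      | exact (k6 ⟨hτ, hσ⟩).elim
  · rintro σ ⟨u, v⟩ h
    obtain ⟨k0, k1, k2, k3⟩ := hsub u v
    cases σ
    · exact k0 h
    · exact k1 h
    · exact k2 h
    · exact k3 h
  · rintro (_ | _)
    · simp only [W, pos, hcs]
    · simp only [W, pos, hct]
  · rintro (_ | _)
    · exact hms.1
    · exact hmt.1
  · rintro (_ | _)
    · exact htau s hms.2
    · exact htau t hmt.2
  · rintro σ ⟨u, v⟩ h
    cases σ
    · have h' : OnPath (u, v) [F.pin, (x, y)] := by
        have : OnPath (u, v) [F.pin, (x, y + 0)] := h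
        rwa [add_zero] at this
      obtain ⟨k1, k2⟩ := w₀ u v h'
      refine ⟨k1, ?_⟩
      rcases k2 with k2 | ⟨k2, k3⟩
      · left; rw [k2]; change (x, y) = (x, y + 0); rw [add_zero]
      · exact .inr ⟨htau _ k2, .inl (by simp only [W, k3])⟩
    · obtain ⟨k1, k2⟩ := w₁ u v h
      refine ⟨k1, k2.imp_right fun ⟨k2, k3⟩ => ⟨htau _ k2, k3.imp (fun k3 => by simp only [W, k3])
        fun k3 => ⟨.split, k3, rfl⟩⟩⟩
    · obtain ⟨k1, k2⟩ := w₂ u v h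
      refine ⟨k1, k2.imp_right fun ⟨k2, k3⟩ => ⟨htau _ k2, k3.imp (fun k3 => by simp only [W, k3])
        fun k3 => ⟨.split, k3, rfl⟩⟩⟩
    · obtain ⟨k1, k2⟩ := w₃ u v h
      refine ⟨k1, k2.imp_right fun ⟨k2, k3⟩ => ⟨htau _ k2, k3.imp (fun k3 => by simp only [W, k3])
        fun k3 => ⟨.join, k3, rfl⟩⟩⟩
  · rintro σ ⟨u, v⟩ h
    cases σ
    · have h' : OnPath (u, v) [(x + 1, y), s] := by
        have : OnPath (u, v) [(x + 1, y + 0), s] := h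
        rwa [add_zero] at this
      obtain ⟨k1, k2⟩ := w₀' u v h'
      refine ⟨k1, ?_⟩
      rcases k2 with k2 | ⟨k2, k3⟩
      · left; rw [k2]; change (x + 1, y) = (x + 1, y + 0); rw [add_zero]
      · exact .inr ⟨htau _ k2, k3.imp (fun k3 => by simp only [W, k3]) fun k3 => ⟨.split, k3, rfl⟩⟩
    · obtain ⟨k1, k2⟩ := w₁' u v h
      refine ⟨k1, k2.imp_right fun ⟨k2, k3⟩ => ⟨htau _ k2, k3.imp (fun k3 => by simp only [W, k3])
        fun k3 => ⟨.join, k3, rfl⟩⟩⟩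
    · obtain ⟨k1, k2⟩ := w₂' u v h
      refine ⟨k1, k2.imp_right fun ⟨k2, k3⟩ => ⟨htau _ k2, k3.imp (fun k3 => by simp only [W, k3])
        fun k3 => ⟨.join, k3, rfl⟩⟩⟩
    · obtain ⟨k1, k2⟩ := w₃' u v h
      refine ⟨k1, k2.imp_right fun ⟨k2, k3⟩ => ⟨htau _ k2, .inl (by simp only [W, k3])⟩⟩
  -- Upward wires are harmless at the join; at the split they are excluded by `hd₁` and `hd₂`.
  · have hj : IsJoin (nodeSkeleton.graph (nodeFamily X Y Z)) (.inl .join) := by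
      refine nodeSkeleton.isJoin_inl (nodeFamily X Y Z) (σ₁ := .a) (σ₂ := .b) (σ₃ := .r)
        (by simp) rfl rfl ?_
      intro σ h
      cases σ <;> simp_all [nodeSkeleton]
    rintro σ v h h'
    cases v with
    | join => exact hj
    | split =>
      cases σ
      · simp [sd] at h'
      · exact absurd h' hd₁
      · exact absurd h' hd₂
      · simp [nodeSkeleton] at h
  · have hj : IsJoin (nodeSkeleton.graph (nodeFamily X Y Z)) (.inl .join) := by
      refine nodeSkeleton.isJoin_inl (nodeFamily X Y Z) (σ₁ := .a) (σ₂ := .b) (σ₃ := .r)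
        (by simp) rfl rfl ?_
      intro σ h
      cases σ <;> simp_all [nodeSkeleton]
    rintro σ v h h'
    cases v with
    | join => exact hj
    | split =>
      cases σ
      · simp [ed] at h'
      all_goals simp [nodeSkeleton] at h
  · rintro ⟨σ, e⟩
    rw [← hcount]
    cases σ
    · exact Nat.zero_le 2
    · exact b₁ e
    · exact b₂ e
    · exact b₃ e
  · exact hdin.symm
  · rfl

/-- Bend numbers on the strands of `vert`. -/
noncomputable def vertCount {Z : TwoTerminal} (n : Z.E → ℕ) : (vert Z).E → ℕ
  | ⟨false, _⟩ => 0
  | ⟨true, e⟩ => n e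

theorem sum_vertCount {Z : TwoTerminal} (n : Z.E → ℕ) :
    ∑ e, vertCount n e = ∑ e, n e := by
  refine (Fintype.sum_sigma (vertCount n)).trans ?_
  rw [Fintype.sum_bool]
  have h0 : ∑ e : (vertFamily Z false).E, vertCount n ⟨false, e⟩ = 0 :=
    Finset.sum_eq_zero fun _ _ => rfl
  rw [h0, add_zero]
  rfl

/-- An edge in front of a drawn strand. -/
theorem HasDrawing.vert {Z : TwoTerminal} {x w h a : ℤ} {po po' : GridPt} {d : Dir} {n : Z.E → ℕ}
    (hD : HasDrawing Z.G ⟨4, x, -h, 0, (4, a), po, .right, d⟩ n)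
    (hx : 4 ≤ x) (hw : x ≤ w) (ha : -h ≤ a) (ha' : a ≤ 0) (hq : SegDir po po' d)
    (hb : ∀ e, n e ≤ 2)
    (hq' : ∀ u v, OnSeg (u, v) po po' → (0 ≤ u ∧ u ≤ w ∧ -h ≤ v ∧ v ≤ 0) ∧ ((u, v) = po ∨
      ¬ (4 ≤ u ∧ u ≤ x ∧ -h ≤ v ∧ v ≤ 0) ∧ (4 < u ∨ v ≠ a))) :
    HasDrawing (vert Z).G ⟨0, w, -h, 0, (0, a), po', .right, d⟩ (vertCount n) := by
  let Q : Bool → Frame := fun σ =>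
    match σ with | false => Frame.lr 1 a 1 0 0 0 | true => ⟨4, x, -h, 0, (4, a), po, .right, d⟩
  let m : ∀ σ, (vertFamily Z σ).E → ℕ := fun σ =>
    match σ with | false => fun _ => 0 | true => n
  let ed : Bool → Dir := fun σ => match σ with | false => .right | true => d
  let W : GridPt → Unit ⊕ Bool × Bool := fun p =>
    -- In row `a`, the initial edge has its rectangle between columns 1 and 2, the vertex lies in
    -- column 3, and `Z` starts in column 4. Every other point outside the rectangles is given to
    -- the exit wire.
    if p.2 = a ∧ p.1 ≤ 4 then
      if p.1 = 3 then .inl () else if p.1 < 1 then .inr (false, false)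
      else if p.1 < 3 then .inr (false, true) else .inr (true, false)
    else .inr (true, true)
  have hcount : vertCount n = strandCount (vertFamily Z) m (fun _ => [].length (α := GridPt))
      (fun _ => [].length (α := GridPt)) := by
    funext ⟨σ, e⟩
    cases σ
    · change 0 = _
      simp [strandCount, m]
    · change n e = _
      simp [strandCount, m]
  rw [hcount]
  refine HasDrawing.strands (K := vertSkeleton) (Q := Q) (n := m) ?_ _ (fun _ => (3, a))
    (fun _ => []) (fun _ => []) W (fun _ => .right) ed ?_ ?_ ?_ ?_ ?_ ?_ ?_ ?_ ?_ ?_ ?_ ?_ ?_ ?_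
  · rintro (_ | _)
    · exact (hasDrawing_single_lr one_pos (by omega) le_rfl).lr 1 a
    · exact hD
  · rintro (_ | _) <;>
    · refine ⟨?_, rfl⟩
      simp [vertSkeleton, SPVertex.place, SegDir, Q, Frame.lr]
  · rintro (_ | _)
    · refine ⟨?_, rfl⟩
      simp [vertSkeleton, SPVertex.place, SegDir, Q, Frame.lr]
    · exact ⟨hq, rfl⟩
  · rintro (_ | _) (_ | _) ⟨u, v⟩ h1 h2 <;> simp only [Q, Frame.lr, Frame.Mem] at h1 h2 <;>
      first | rfl | (exfalso; omega)
  · rintro (_ | _) ⟨u, v⟩ h1 <;> simp only [Q, Frame.lr, Frame.Mem] at h1 ⊢ <;> omega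
  · intro _
    simp [W]
  · intro _
    simp only [Frame.Mem]; omega
  · rintro _ (_ | _) <;> simp only [Q, Frame.lr, Frame.Mem] <;> omega
  · rintro (_ | _) ⟨u, v⟩ h1
    · simp only [vertSkeleton, SPVertex.place, Q, Frame.lr, OnPath, OnSeg,
        List.cons_append, List.nil_append, or_false, Bool.false_eq_true, if_false] at h1
      refine ⟨by simp only [Frame.Mem]; omega, ?_⟩
      by_cases hu : u = 1
      · left
        simp only [Q, Frame.lr, Prod.mk.injEq]
        omega
      · right
        refine ⟨?_, .inl ?_⟩
        · rintro (_ | _) <;> simp only [Q, Frame.lr, Frame.Mem] <;> omega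
        · simp only [W]
          rw [if_pos (by omega), if_neg (by omega), if_pos (by omega)]
    · simp only [vertSkeleton, SPVertex.place, Q, OnPath, OnSeg,
        List.cons_append, List.nil_append, or_false, if_true] at h1
      refine ⟨by simp only [Frame.Mem]; omega, ?_⟩
      by_cases hu : u = 4
      · left
        simp only [Q, Prod.mk.injEq]
        omega
      · right
        refine ⟨?_, .inr ⟨(), ?_, rfl⟩⟩
        · rintro (_ | _) <;> simp only [Q, Frame.lr, Frame.Mem] <;> omega
        · simp only [Prod.mk.injEq]; omega
  · rintro (_ | _) ⟨u, v⟩ h1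
    · simp only [vertSkeleton, SPVertex.place, Q, Frame.lr, OnPath, OnSeg,
        List.nil_append, or_false, Bool.false_eq_true, if_false] at h1
      refine ⟨by simp only [Frame.Mem]; omega, ?_⟩
      by_cases hu : u = 2
      · left
        simp only [Q, Frame.lr, Prod.mk.injEq]
        omega
      · right
        refine ⟨?_, .inr ⟨(), ?_, rfl⟩⟩
        · rintro (_ | _) <;> simp only [Q, Frame.lr, Frame.Mem] <;> omega
        · simp only [Prod.mk.injEq]; omega
    · have h2 : OnSeg (u, v) po po' := by
        simpa only [vertSkeleton, SPVertex.place, Q, OnPath, List.nil_append, or_false,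
          if_true] using h1
      obtain ⟨h3, h4⟩ := hq' u v h2
      refine ⟨h3, h4.imp_right fun ⟨h4, h5⟩ => ⟨?_, .inl ?_⟩⟩
      · rintro (_ | _)
        · simp only [Q, Frame.lr, Frame.Mem]
          omega
        · exact h4
      · simp only [W]
        rw [if_neg]
        intro h6
        simp only [OnSeg, SegDir] at h2 hq
        omega
  · rintro σ v _ h; cases h
  · rintro (_ | _) v h h'
    · cases h'
    · cases h
  · rintro ⟨σ, e⟩
    rw [← hcount]
    cases σ
    · exact Nat.zero_le 2
    · exact hb e
  · rfl
  · rfl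

/-! ### Six layouts of a parallel composition inside a chain -/

set_option linter.unusedSimpArgs false
set_option linter.unnecessarySeqFocus false

/-- The strand `X` hangs below and to the left of `Y`, and the join lies in the top row. -/
theorem HasDrawing.node_side_top {X Y Z : TwoTerminal} {n₁ : X.E → ℕ} {n₂ : Y.E → ℕ}
    {n₃ : Z.E → ℕ} {w₁ w₂ x₁ w k h a : ℤ} {po po' : GridPt} {d : Dir}
    (h₁ : HasDrawing X.G (Frame.lr 0 0 w₁ (k - 1) a (-(k - 1))) n₁)
    (h₂ : HasDrawing Y.G (Frame.lr 0 0 w₂ (k - 1) 0 0) n₂)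
    (h₃ : HasDrawing Z.G ⟨w₁ + w₂ + 7, x₁, -h, 0, (w₁ + w₂ + 7, 0), po, .right, d⟩ n₃)
    (hw₁ : 0 < w₁) (hw₂ : 0 < w₂) (hx : w₁ + w₂ + 7 ≤ x₁) (hw : x₁ ≤ w) (hk : 0 < k) (hkh : k ≤ h)
    (ha : -(k - 1) ≤ a) (ha' : a ≤ 0) (hq : SegDir po po' d)
    (hq' : ∀ u v, OnSeg (u, v) po po' → (0 ≤ u ∧ u ≤ w ∧ -h ≤ v ∧ v ≤ 0) ∧ ((u, v) = po ∨
      ¬ (w₁ + w₂ + 7 ≤ u ∧ u ≤ x₁ ∧ -h ≤ v ∧ v ≤ 0) ∧ (w₁ + w₂ + 7 < u ∨ v < -k)))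
    (b₁ : ∀ e, extCount X n₁ 1 1 e ≤ 2) (b₂ : ∀ e, extCount Y n₂ 0 0 e ≤ 2)
    (b₃ : ∀ e, extCount Z n₃ 0 0 e ≤ 2) :
    HasDrawing (TwoTerminal.node X Y Z).G ⟨0, w, -h, 0, (0, 0), po', .right, d⟩
      (nodeCount n₁ n₂ n₃ 1 1 0 0 0 0) := by
  -- `Y` runs straight from split to join. `X` is reached by a bend below the split, ends in row
  -- `-k`, passes below `Y`, and climbs to the join after a second bend. It arrives at the bottom of
  -- the join, as is allowed at a junction.
  refine HasDrawing.node (h₁.lr 4 (-1)) (h₂.lr (5 + w₁) 0) h₃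
    ⟨0, w, -h, 0, (0, 0), po', .right, d⟩ (3, 0) (w₁ + w₂ + 6, 0) 1 0
    [(3, a - 1)] [(w₁ + w₂ + 6, -k)] [] [] [] []
    (d₁ := .down) (e₁ := .up) (d₂ := .right) (e₂ := .right) (d₃ := .right)
    (fun x y => if w₁ + w₂ + 7 < x ∨ y < -k then 9 else if y = 0 then
      (if x ≤ 1 then 2 else if x < 3 then 3 else if x = 3 then 0 else if x = w₁ + w₂ + 6 then 1
      else 6) else if x = 3 then 4 else 5)
    ?_ ?_ rfl ?_ ?_ ?_ ?_ ?_ ?_ (by simp) (by simp) ?_ ?_ ?_ ?_ ?_ ?_ ?_ ?_ ?_ ?_ ?_ ?_ ?_ ?_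
    b₁ b₂ b₃
  iterate 2 (· constructor <;> simp only [Frame.uturn] <;> omega)
  · refine ⟨?_, .right, by simp [Dir.Perp, Dir.IsHor, Frame.lr, Frame.rl, Frame.uturn], ?_, rfl⟩ <;>
      simp only [SegDir, Frame.lr, Frame.rl, Frame.uturn, true_and] <;> omega
  · refine ⟨?_, .up, by simp [Dir.Perp, Dir.IsHor, Frame.lr, Frame.rl, Frame.uturn], ?_, rfl⟩ <;>
      simp only [SegDir, Frame.lr, Frame.rl, Frame.uturn, true_and] <;> omega
  · refine ⟨?_, rfl⟩
    simp only [SegDir, Frame.lr, Frame.rl, Frame.uturn, true_and]; omega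
  · refine ⟨?_, rfl⟩
    simp only [SegDir, Frame.lr, Frame.rl, Frame.uturn, true_and]; omega
  · refine ⟨?_, rfl⟩
    simp only [SegDir, Frame.lr, Frame.rl, Frame.uturn, true_and]; omega
  · exact ⟨hq, rfl⟩
  iterate 2
    · intro u v
      simp only [Frame.lr, Frame.rl, Frame.uturn, Frame.Mem]
      omega
  iterate 2 (· dsimp only; split_ifs <;> first | contradiction | omega)
  iterate 2
    · simp only [Frame.lr, Frame.rl, Frame.uturn, Frame.Mem]
      omega
  iterate 7
    · intro u v h
      simp only [OnPath, OnSeg, or_false, List.cons_append, List.nil_append, Frame.lr, Frame.rl,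
        Frame.uturn, Frame.Mem, Prod.mk.injEq] at h ⊢
      refine ⟨by omega, or_iff_not_imp_left.2 fun hp => ⟨by omega, ?_⟩⟩
      split_ifs <;> omega
  · intro u v h
    simp only [OnPath, or_false, List.nil_append] at h
    -- The exit wire of `Z` lies to the right of the block or below row `-k`. This is the first case
    -- of the code, and it covers both an exit on the right and a return to the left.
    have h' := hq' u v h
    simp only [OnSeg, Frame.lr, Frame.rl, Frame.uturn, Frame.Mem] at h h' ⊢
    refine ⟨h'.1, h'.2.imp_right fun h' => ⟨by omega, ?_⟩⟩
    rw [if_pos]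
    exact h'.2

/-- The strand `X` hangs below and to the left of `Y`, and the join lies in row `-k`. -/
theorem HasDrawing.node_side_bot {X Y Z : TwoTerminal} {n₁ : X.E → ℕ} {n₂ : Y.E → ℕ}
    {n₃ : Z.E → ℕ} {w₁ w₂ x₁ w k h a : ℤ} {po po' : GridPt} {d : Dir}
    (h₁ : HasDrawing X.G (Frame.lr 0 0 w₁ (k - 1) a (-(k - 1))) n₁)
    (h₂ : HasDrawing Y.G (Frame.lr 0 0 w₂ (k - 1) 0 b) n₂)
    (h₃ : HasDrawing Z.G ⟨w₁ + w₂ + 7, x₁, -h, 0, (w₁ + w₂ + 7, -k), po, .right, d⟩ n₃)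
    (hw₁ : 0 < w₁) (hw₂ : 0 < w₂) (hx : w₁ + w₂ + 7 ≤ x₁) (hw : x₁ ≤ w) (hk : 0 < k)
    (hb : -(k - 1) ≤ b) (hb' : b ≤ 0) (hkh : k ≤ h)
    (ha : -(k - 1) ≤ a) (ha' : a ≤ 0) (hq : SegDir po po' d)
    (hq' : ∀ u v, OnSeg (u, v) po po' → (0 ≤ u ∧ u ≤ w ∧ -h ≤ v ∧ v ≤ 0) ∧ ((u, v) = po ∨
      ¬ (w₁ + w₂ + 7 ≤ u ∧ u ≤ x₁ ∧ -h ≤ v ∧ v ≤ 0) ∧ (w₁ + w₂ + 7 < u ∨ v < -k)))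
    (b₁ : ∀ e, extCount X n₁ 1 0 e ≤ 2) (b₂ : ∀ e, extCount Y n₂ 0 1 e ≤ 2)
    (b₃ : ∀ e, extCount Z n₃ 0 0 e ≤ 2) :
    HasDrawing (TwoTerminal.node X Y Z).G ⟨0, w, -h, 0, (0, 0), po', .right, d⟩
      (nodeCount n₁ n₂ n₃ 1 0 0 1 0 0) := by
  -- Now `X` reaches the join straight along row `-k`, and `Y`, ending in row `b`, bends down to it.
  -- `Z` continues in row `-k`.
  refine HasDrawing.node (h₁.lr 4 (-1)) (h₂.lr (5 + w₁) 0) h₃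
    ⟨0, w, -h, 0, (0, 0), po', .right, d⟩ (3, 0) (w₁ + w₂ + 6, -k) 1 0
    [(3, a - 1)] [] [] [(w₁ + w₂ + 6, b)] [] []
    (d₁ := .down) (e₁ := .right) (d₂ := .right) (e₂ := .down) (d₃ := .right)
    (fun x y => if w₁ + w₂ + 7 < x ∨ y < -k then 9 else if y = 0 ∧ x ≤ 3 then
      (if x ≤ 1 then 2 else if x < 3 then 3 else 0) else if x = 3 then 4 else if y = -k then
      (if x = w₁ + w₂ + 6 then 1 else 5) else if w₁ + w₂ + 5 ≤ x then 7 else 6)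
    ?_ ?_ rfl ?_ ?_ ?_ ?_ ?_ ?_ (by simp) (by simp) ?_ ?_ ?_ ?_ ?_ ?_ ?_ ?_ ?_ ?_ ?_ ?_ ?_ ?_
    b₁ b₂ b₃
  iterate 2 (· constructor <;> simp only [Frame.uturn] <;> omega)
  · refine ⟨?_, .right, by simp [Dir.Perp, Dir.IsHor, Frame.lr, Frame.rl, Frame.uturn], ?_, rfl⟩ <;>
      simp only [SegDir, Frame.lr, Frame.rl, Frame.uturn, true_and] <;> omega
  · refine ⟨?_, rfl⟩
    simp only [SegDir, Frame.lr, Frame.rl, Frame.uturn, true_and]; omega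
  · refine ⟨?_, rfl⟩
    simp only [SegDir, Frame.lr, Frame.rl, Frame.uturn, true_and]; omega
  · refine ⟨?_, .down, by simp [Dir.Perp, Dir.IsHor, Frame.lr, Frame.rl, Frame.uturn], ?_, rfl⟩ <;>
      simp only [SegDir, Frame.lr, Frame.rl, Frame.uturn, true_and] <;> omega
  · refine ⟨?_, rfl⟩
    simp only [SegDir, Frame.lr, Frame.rl, Frame.uturn, true_and]; omega
  · exact ⟨hq, rfl⟩
  iterate 2
    · intro u v
      simp only [Frame.lr, Frame.rl, Frame.uturn, Frame.Mem]
      omega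
  iterate 2 (· dsimp only; split_ifs <;> first | contradiction | omega)
  iterate 2
    · simp only [Frame.lr, Frame.rl, Frame.uturn, Frame.Mem]
      omega
  iterate 7
    · intro u v h
      simp only [OnPath, OnSeg, or_false, List.cons_append, List.nil_append, Frame.lr, Frame.rl,
        Frame.uturn, Frame.Mem, Prod.mk.injEq] at h ⊢
      refine ⟨by omega, or_iff_not_imp_left.2 fun hp => ⟨by omega, ?_⟩⟩
      split_ifs <;> omega
  · intro u v h
    simp only [OnPath, or_false, List.nil_append] at h
    have h' := hq' u v h
    simp only [OnSeg, Frame.lr, Frame.rl, Frame.uturn, Frame.Mem] at h h' ⊢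
    refine ⟨h'.1, h'.2.imp_right fun h' => ⟨by omega, ?_⟩⟩
    rw [if_pos]
    exact h'.2

set_option maxHeartbeats 1000000 in
/-- The strand `Y` makes a turn to the right of the join in row `-k`, the strand `X` is to the left of the
join, and the edge that leaves the join passes below `Y` and climbs to the top row. -/
theorem HasDrawing.node_wrap_top {X Y Z : TwoTerminal} {n₁ : X.E → ℕ} {n₂ : Y.E → ℕ}
    {n₃ : Z.E → ℕ} {w₁ w₂ x₁ w k h a : ℤ} {po po' : GridPt} {d : Dir}
    (h₁ : HasDrawing X.G (Frame.lr 0 0 w₁ (k - 1) a (-(k - 1))) n₁)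
    (h₂ : HasDrawing Y.G (Frame.uturn 0 0 w₂ (k - 1)) n₂)
    (h₃ : HasDrawing Z.G ⟨w₁ + w₂ + 8, x₁, -h, 0, (w₁ + w₂ + 8, 0), po, .right, d⟩ n₃)
    (hw₁ : 0 < w₁) (hw₂ : 0 < w₂) (hx : w₁ + w₂ + 8 ≤ x₁) (hw : x₁ ≤ w) (hk : 1 < k) (hkh : k ≤ h)
    (ha : -(k - 1) ≤ a) (ha' : a ≤ 0) (hq : SegDir po po' d)
    (hq' : ∀ u v, OnSeg (u, v) po po' → (0 ≤ u ∧ u ≤ w ∧ -h ≤ v ∧ v ≤ 0) ∧ ((u, v) = po ∨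
      ¬ (w₁ + w₂ + 8 ≤ u ∧ u ≤ x₁ ∧ -h ≤ v ∧ v ≤ 0) ∧ (w₁ + w₂ + 8 < u ∨ v < -k)))
    (b₁ : ∀ e, extCount X n₁ 1 0 e ≤ 2) (b₂ : ∀ e, extCount Y n₂ 0 1 e ≤ 2)
    (b₃ : ∀ e, extCount Z n₃ 2 0 e ≤ 2) :
    HasDrawing (TwoTerminal.node X Y Z).G ⟨0, w, -h, 0, (0, 0), po', .right, d⟩
      (nodeCount n₁ n₂ n₃ 1 0 0 1 2 0) := by
  -- `X` meets the join from the left and `Y`, after its turn, from above. The edge that leaves the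
  -- join follows row `-k` below `Y` and climbs in column `w₁ + w₂ + 7`; its two bends belong to the
  -- first edge of `Z`.
  refine HasDrawing.node (h₁.lr 4 (-1)) (h₂.uturn (6 + w₁) 0) h₃
    ⟨0, w, -h, 0, (0, 0), po', .right, d⟩ (3, 0) (w₁ + 5, -k) 1 0
    [(3, a - 1)] [] [] [(w₁ + 5, -(k - 1))]
    [(w₁ + w₂ + 7, -k), (w₁ + w₂ + 7, 0)] []
    (d₁ := .down) (e₁ := .right) (d₂ := .right) (e₂ := .down) (d₃ := .right)
    (fun x y => if w₁ + w₂ + 8 < x ∨ y < -k then 9 else if w₁ + w₂ + 7 ≤ x then 8 else if y = -k then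
      (if x = 3 then 4 else if x < w₁ + 5 then 5 else if x = w₁ + 5 then 1 else 8) else if y = 0 then
      (if x ≤ 1 then 2 else if x < 3 then 3 else if x = 3 then 0 else 6) else
      if x = 3 then 4 else 7)
    ?_ ?_ rfl ?_ ?_ ?_ ?_ ?_ ?_ (by simp) (by simp) ?_ ?_ ?_ ?_ ?_ ?_ ?_ ?_ ?_ ?_ ?_ ?_ ?_ ?_
    b₁ b₂ b₃
  iterate 2 (· constructor <;> simp only [Frame.uturn] <;> omega)
  · refine ⟨?_, .right, by simp [Dir.Perp, Dir.IsHor, Frame.lr, Frame.rl, Frame.uturn], ?_, rfl⟩ <;>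
      simp only [SegDir, Frame.lr, Frame.rl, Frame.uturn, true_and] <;> omega
  · refine ⟨?_, rfl⟩
    simp only [SegDir, Frame.lr, Frame.rl, Frame.uturn, true_and]; omega
  · refine ⟨?_, rfl⟩
    simp only [SegDir, Frame.lr, Frame.rl, Frame.uturn, true_and]; omega
  · refine ⟨?_, .down, by simp [Dir.Perp, Dir.IsHor, Frame.lr, Frame.rl, Frame.uturn], ?_, rfl⟩ <;>
      simp only [SegDir, Frame.lr, Frame.rl, Frame.uturn, true_and] <;> omega
  · refine ⟨?_, .up, by simp [Dir.Perp, Dir.IsHor], ?_, .right, by simp [Dir.Perp, Dir.IsHor],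
      ?_, rfl⟩ <;>
      simp only [SegDir, true_and] <;> omega
  · exact ⟨hq, rfl⟩
  iterate 2
    · intro u v
      simp only [Frame.lr, Frame.rl, Frame.uturn, Frame.Mem]
      omega
  iterate 2 (· dsimp only; split_ifs <;> first | contradiction | omega)
  iterate 2
    · simp only [Frame.lr, Frame.rl, Frame.uturn, Frame.Mem]
      omega
  iterate 7
    · intro u v h
      simp only [OnPath, OnSeg, or_false, List.cons_append, List.nil_append, Frame.lr, Frame.rl,
        Frame.uturn, Frame.Mem, Prod.mk.injEq] at h ⊢
      refine ⟨by omega, or_iff_not_imp_left.2 fun hp => ⟨by omega, ?_⟩⟩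
      split_ifs <;> omega
  · intro u v h
    simp only [OnPath, or_false, List.nil_append] at h
    have h' := hq' u v h
    simp only [OnSeg, Frame.lr, Frame.rl, Frame.uturn, Frame.Mem] at h h' ⊢
    refine ⟨h'.1, h'.2.imp_right fun h' => ⟨by omega, ?_⟩⟩
    rw [if_pos]
    exact h'.2

set_option maxHeartbeats 1000000 in
/-- The strand `Y` makes a turn to the right of the join in row `-k`, the strand `X` is to the left of the
join, and the edge that leaves the join passes below `Y`. -/
theorem HasDrawing.node_wrap_bot {X Y Z : TwoTerminal} {n₁ : X.E → ℕ} {n₂ : Y.E → ℕ}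
    {n₃ : Z.E → ℕ} {w₁ w₂ x₁ w k h a : ℤ} {po po' : GridPt} {d : Dir}
    (h₁ : HasDrawing X.G (Frame.lr 0 0 w₁ (k - 1) a (-(k - 1))) n₁)
    (h₂ : HasDrawing Y.G (Frame.uturn 0 0 w₂ (k - 1)) n₂)
    (h₃ : HasDrawing Z.G ⟨w₁ + w₂ + 8, x₁, -h, 0, (w₁ + w₂ + 8, -k), po, .right, d⟩ n₃)
    (hw₁ : 0 < w₁) (hw₂ : 0 < w₂) (hx : w₁ + w₂ + 8 ≤ x₁) (hw : x₁ ≤ w) (hk : 1 < k) (hkh : k ≤ h)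
    (ha : -(k - 1) ≤ a) (ha' : a ≤ 0) (hq : SegDir po po' d)
    (hq' : ∀ u v, OnSeg (u, v) po po' → (0 ≤ u ∧ u ≤ w ∧ -h ≤ v ∧ v ≤ 0) ∧ ((u, v) = po ∨
      ¬ (w₁ + w₂ + 8 ≤ u ∧ u ≤ x₁ ∧ -h ≤ v ∧ v ≤ 0) ∧ (w₁ + w₂ + 8 < u ∨ v < -k)))
    (b₁ : ∀ e, extCount X n₁ 1 0 e ≤ 2) (b₂ : ∀ e, extCount Y n₂ 0 1 e ≤ 2)
    (b₃ : ∀ e, extCount Z n₃ 0 0 e ≤ 2) :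
    HasDrawing (TwoTerminal.node X Y Z).G ⟨0, w, -h, 0, (0, 0), po', .right, d⟩
      (nodeCount n₁ n₂ n₃ 1 0 0 1 0 0) := by
  -- The same arrangement of `X` and `Y`; since `Z` starts in row `-k`, the edge that leaves the
  -- join needs no bend.
  refine HasDrawing.node (h₁.lr 4 (-1)) (h₂.uturn (6 + w₁) 0) h₃
    ⟨0, w, -h, 0, (0, 0), po', .right, d⟩ (3, 0) (w₁ + 5, -k) 1 0
    [(3, a - 1)] [] [] [(w₁ + 5, -(k - 1))] [] []
    (d₁ := .down) (e₁ := .right) (d₂ := .right) (e₂ := .down) (d₃ := .right)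
    (fun x y => if w₁ + w₂ + 8 < x ∨ y < -k then 9 else if w₁ + w₂ + 7 ≤ x then 8 else if y = -k then
      (if x = 3 then 4 else if x < w₁ + 5 then 5 else if x = w₁ + 5 then 1 else 8) else if y = 0 then
      (if x ≤ 1 then 2 else if x < 3 then 3 else if x = 3 then 0 else 6) else
      if x = 3 then 4 else 7)
    ?_ ?_ rfl ?_ ?_ ?_ ?_ ?_ ?_ (by simp) (by simp) ?_ ?_ ?_ ?_ ?_ ?_ ?_ ?_ ?_ ?_ ?_ ?_ ?_ ?_
    b₁ b₂ b₃
  iterate 2 (· constructor <;> simp only [Frame.uturn] <;> omega)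
  · refine ⟨?_, .right, by simp [Dir.Perp, Dir.IsHor, Frame.lr, Frame.rl, Frame.uturn], ?_, rfl⟩ <;>
      simp only [SegDir, Frame.lr, Frame.rl, Frame.uturn, true_and] <;> omega
  · refine ⟨?_, rfl⟩
    simp only [SegDir, Frame.lr, Frame.rl, Frame.uturn, true_and]; omega
  · refine ⟨?_, rfl⟩
    simp only [SegDir, Frame.lr, Frame.rl, Frame.uturn, true_and]; omega
  · refine ⟨?_, .down, by simp [Dir.Perp, Dir.IsHor, Frame.lr, Frame.rl, Frame.uturn], ?_, rfl⟩ <;>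
      simp only [SegDir, Frame.lr, Frame.rl, Frame.uturn, true_and] <;> omega
  · refine ⟨?_, rfl⟩
    simp only [SegDir, Frame.lr, Frame.rl, Frame.uturn, true_and]; omega
  · exact ⟨hq, rfl⟩
  iterate 2
    · intro u v
      simp only [Frame.lr, Frame.rl, Frame.uturn, Frame.Mem]
      omega
  iterate 2 (· dsimp only; split_ifs <;> first | contradiction | omega)
  iterate 2
    · simp only [Frame.lr, Frame.rl, Frame.uturn, Frame.Mem]
      omega
  iterate 7
    · intro u v h
      simp only [OnPath, OnSeg, or_false, List.cons_append, List.nil_append, Frame.lr, Frame.rl,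
        Frame.uturn, Frame.Mem, Prod.mk.injEq] at h ⊢
      refine ⟨by omega, or_iff_not_imp_left.2 fun hp => ⟨by omega, ?_⟩⟩
      split_ifs <;> omega
  · intro u v h
    simp only [OnPath, or_false, List.nil_append] at h
    have h' := hq' u v h
    simp only [OnSeg, Frame.lr, Frame.rl, Frame.uturn, Frame.Mem] at h h' ⊢
    refine ⟨h'.1, h'.2.imp_right fun h' => ⟨by omega, ?_⟩⟩
    rw [if_pos]
    exact h'.2

/-- The strand `Y` makes a turn on the right, and `X` and `Z` are drawn from right to left below the
initial edge. The join lies in row `-1`. -/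
theorem HasDrawing.node_back_high {X Y Z : TwoTerminal} {n₁ : X.E → ℕ} {n₂ : Y.E → ℕ}
    {n₃ : Z.E → ℕ} {w₁ w₂ w₃ h : ℤ}
    (h₁ : HasDrawing X.G (Frame.lr 0 0 w₁ (h - 2) 0 0) n₁)
    (h₂ : HasDrawing Y.G (Frame.uturn 0 0 w₂ h) n₂)
    (h₃ : HasDrawing Z.G (Frame.lr 0 0 w₃ (h - 1) 0 (-(h - 1))) n₃)
    (hw₁ : 0 < w₁) (hw₂ : 0 < w₂) (hw₃ : 0 < w₃) (hh : 1 < h)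
    (b₁ : ∀ e, extCount X n₁ 1 0 e ≤ 2) (b₂ : ∀ e, extCount Y n₂ 0 1 e ≤ 2)
    (b₃ : ∀ e, extCount Z n₃ 0 0 e ≤ 2) :
    HasDrawing (TwoTerminal.node X Y Z).G (Frame.uturn 0 0 (w₁ + w₂ + w₃ + 5) h)
      (nodeCount n₁ n₂ n₃ 1 0 0 1 0 0) := by
  -- `Y` turns with the full height `h`, returns along the bottom row below `X`, and climbs to the
  -- join, which it enters at the bottom. `X` leaves the split downwards and runs to the left in row
  -- `-1`, where the join and the start of `Z` are.
  refine HasDrawing.node (h₁.rl (w₃ + 3) (-1)) (h₂.uturn (w₁ + w₃ + 5) 0) (h₃.rl 1 (-1))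
    (Frame.uturn 0 0 (w₁ + w₂ + w₃ + 5) h) (w₁ + w₃ + 4, 0) (w₃ + 2, -1) 1 0
    [(w₁ + w₃ + 4, -1)] [] [] [(w₃ + 2, -h)] [] []
    (d₁ := .down) (e₁ := .left) (d₂ := .right) (e₂ := .up) (d₃ := .left)
    (fun x y => if y = 0 then (if x ≤ 1 then 2 else if x < w₁ + w₃ + 4 then 3 else
      if x = w₁ + w₃ + 4 then 0 else 6) else if x = w₁ + w₃ + 4 ∧ -h < y then 4 else
      if x < w₃ + 2 then 9 else if x = w₃ + 2 ∧ y = -1 then 1 else 7)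
    ?_ ?_ rfl ?_ ?_ ?_ ?_ ?_ ?_ (by simp) (by simp) ?_ ?_ ?_ ?_ ?_ ?_ ?_ ?_ ?_ ?_ ?_ ?_ ?_ ?_
    b₁ b₂ b₃
  iterate 2 (· constructor <;> simp only [Frame.uturn] <;> omega)
  · refine ⟨?_, .left, by simp [Dir.Perp, Dir.IsHor, Frame.lr, Frame.rl, Frame.uturn], ?_, rfl⟩ <;>
      simp only [SegDir, Frame.lr, Frame.rl, Frame.uturn, true_and] <;> omega
  · refine ⟨?_, rfl⟩
    simp only [SegDir, Frame.lr, Frame.rl, Frame.uturn, true_and]; omega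
  · refine ⟨?_, rfl⟩
    simp only [SegDir, Frame.lr, Frame.rl, Frame.uturn, true_and]; omega
  · refine ⟨?_, .up, by simp [Dir.Perp, Dir.IsHor, Frame.lr, Frame.rl, Frame.uturn], ?_, rfl⟩ <;>
      simp only [SegDir, Frame.lr, Frame.rl, Frame.uturn, true_and] <;> omega
  · refine ⟨?_, rfl⟩
    simp only [SegDir, Frame.lr, Frame.rl, Frame.uturn, true_and]; omega
  · refine ⟨?_, rfl⟩
    simp only [SegDir, Frame.lr, Frame.rl, Frame.uturn, true_and]; omega
  iterate 2
    · intro u v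
      simp only [Frame.lr, Frame.rl, Frame.uturn, Frame.Mem]
      omega
  iterate 2 (· dsimp only; split_ifs <;> first | contradiction | omega)
  iterate 2
    · simp only [Frame.lr, Frame.rl, Frame.uturn, Frame.Mem]
      omega
  iterate 8
    · intro u v h
      simp only [OnPath, OnSeg, or_false, List.cons_append, List.nil_append, Frame.lr, Frame.rl,
        Frame.uturn, Frame.Mem, Prod.mk.injEq] at h ⊢
      refine ⟨by omega, or_iff_not_imp_left.2 fun hp => ⟨by omega, ?_⟩⟩
      split_ifs <;> omega

/-- The strand `Y` makes a turn on the right, and `X` and `Z` are drawn from right to left below the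
initial edge. The join lies in the bottom row. -/
theorem HasDrawing.node_back_low {X Y Z : TwoTerminal} {n₁ : X.E → ℕ} {n₂ : Y.E → ℕ}
    {n₃ : Z.E → ℕ} {w₁ w₂ w₃ h b : ℤ}
    (h₁ : HasDrawing X.G (Frame.lr 0 0 w₁ (h - 2) 0 b) n₁)
    (h₂ : HasDrawing Y.G (Frame.uturn 0 0 w₂ h) n₂)
    (h₃ : HasDrawing Z.G (Frame.lr 0 0 w₃ (h - 1) (-(h - 1)) (-(h - 1))) n₃)
    (hw₁ : 0 < w₁) (hw₂ : 0 < w₂) (hw₃ : 0 < w₃) (hh : 1 < h) (hb : -(h - 2) ≤ b) (hb' : b ≤ 0)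
    (b₁ : ∀ e, extCount X n₁ 1 1 e ≤ 2) (b₂ : ∀ e, extCount Y n₂ 0 0 e ≤ 2)
    (b₃ : ∀ e, extCount Z n₃ 0 0 e ≤ 2) :
    HasDrawing (TwoTerminal.node X Y Z).G (Frame.uturn 0 0 (w₁ + w₂ + w₃ + 5) h)
      (nodeCount n₁ n₂ n₃ 1 1 0 0 0 0) := by
  -- Here `Y` returns straight into the join in row `-h`, and `X` comes down to it with a bend, so
  -- that `Z` stays in the bottom row from its start.
  refine HasDrawing.node (h₁.rl (w₃ + 3) (-1)) (h₂.uturn (w₁ + w₃ + 5) 0) (h₃.rl 1 (-1))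
    (Frame.uturn 0 0 (w₁ + w₂ + w₃ + 5) h) (w₁ + w₃ + 4, 0) (w₃ + 2, -h) 1 0
    [(w₁ + w₃ + 4, -1)] [(w₃ + 2, b - 1)] [] [] [] []
    (d₁ := .down) (e₁ := .down) (d₂ := .right) (e₂ := .left) (d₃ := .left)
    (fun x y => if y = 0 then (if x ≤ 1 then 2 else if x < w₁ + w₃ + 4 then 3 else
      if x = w₁ + w₃ + 4 then 0 else 6) else if x = w₁ + w₃ + 4 ∧ -h < y then 4 else
      if x < w₃ + 2 then 9 else if x = w₃ + 2 then (if y = -h then 1 else 5) else 7)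
    ?_ ?_ rfl ?_ ?_ ?_ ?_ ?_ ?_ (by simp) (by simp) ?_ ?_ ?_ ?_ ?_ ?_ ?_ ?_ ?_ ?_ ?_ ?_ ?_ ?_
    b₁ b₂ b₃
  iterate 2 (· constructor <;> simp only [Frame.uturn] <;> omega)
  · refine ⟨?_, .left, by simp [Dir.Perp, Dir.IsHor, Frame.lr, Frame.rl, Frame.uturn], ?_, rfl⟩ <;>
      simp only [SegDir, Frame.lr, Frame.rl, Frame.uturn, true_and] <;> omega
  · refine ⟨?_, .down, by simp [Dir.Perp, Dir.IsHor, Frame.lr, Frame.rl, Frame.uturn], ?_, rfl⟩ <;>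
      simp only [SegDir, Frame.lr, Frame.rl, Frame.uturn, true_and] <;> omega
  · refine ⟨?_, rfl⟩
    simp only [SegDir, Frame.lr, Frame.rl, Frame.uturn, true_and]; omega
  · refine ⟨?_, rfl⟩
    simp only [SegDir, Frame.lr, Frame.rl, Frame.uturn, true_and]; omega
  · refine ⟨?_, rfl⟩
    simp only [SegDir, Frame.lr, Frame.rl, Frame.uturn, true_and]; omega
  · refine ⟨?_, rfl⟩
    simp only [SegDir, Frame.lr, Frame.rl, Frame.uturn, true_and]; omega
  iterate 2
    · intro u v
      simp only [Frame.lr, Frame.rl, Frame.uturn, Frame.Mem]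
      omega
  iterate 2 (· dsimp only; split_ifs <;> first | contradiction | omega)
  iterate 2
    · simp only [Frame.lr, Frame.rl, Frame.uturn, Frame.Mem]
      omega
  iterate 8
    · intro u v h
      simp only [OnPath, OnSeg, or_false, List.cons_append, List.nil_append, Frame.lr, Frame.rl,
        Frame.uturn, Frame.Mem, Prod.mk.injEq] at h ⊢
      refine ⟨by omega, or_iff_not_imp_left.2 fun hp => ⟨by omega, ?_⟩⟩
      split_ifs <;> omega

/-! ### Chains and the counting of bends -/

/-- Chains: an edge, or an edge and a vertex followed by a chain, or an edge and the parallel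
composition of two chains followed by a chain. -/
inductive Chain where
  | edge : Chain
  | vert (R : Chain) : Chain
  | node (A B R : Chain) : Chain

theorem TwoTerminal.node_fst_ne_lst (X Y Z : TwoTerminal) : (node X Y Z).fst ≠ (node X Y Z).lst :=
  fun h => by cases congrArg Sigma.fst h

theorem TwoTerminal.vert_fst_ne_lst (Z : TwoTerminal) : (vert Z).fst ≠ (vert Z).lst :=
  fun h => by cases congrArg Sigma.fst h

theorem HasDrawing.le_two {I E : Type} {G : MultiDigraph (SPVertex I) E} {F : Frame} {n : E → ℕ}
    (h : HasDrawing G F n) (e : E) : n e ≤ 2 := by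
  obtain ⟨D, hD⟩ := h
  exact hD e ▸ D.bend_le e

/-- Only the first and the last edge gain bends from the wires; `hpq` is for strands that consist of
a single edge, which gains both. -/
theorem extCount_le {X : TwoTerminal} {n : X.E → ℕ} {p q : ℕ} (hn : ∀ e, n e ≤ 2)
    (hp : p + n X.fst ≤ 2) (hq : n X.lst + q ≤ 2) (hpq : X.fst = X.lst → p + n X.fst + q ≤ 2)
    (e : X.E) : extCount X n p q e ≤ 2 := by
  have := hn e
  unfold extCount
  split_ifs with h1 h2 h2
  · have h3 := hpq (h1.symm.trans h2)
    rw [← h1] at h3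
    exact h3
  · rw [← h1] at hp; omega
  · rw [← h2] at hq; omega
  · omega

theorem extCount_zero {X : TwoTerminal} (n : X.E → ℕ) (e : X.E) : extCount X n 0 0 e = n e := by
  simp [extCount]

/-- The bends of the wire into `Z` are charged to its first edge; the hypothesis keeps them off its
last edge. -/
theorem nodeCount_lst {X Y Z : TwoTerminal} (n₁ : X.E → ℕ) (n₂ : Y.E → ℕ) (n₃ : Z.E → ℕ)
    (p₁ q₁ p₂ q₂ p₃ q₃ : ℕ) (h : p₃ = 0 ∨ Z.fst ≠ Z.lst) :
    nodeCount n₁ n₂ n₃ p₁ q₁ p₂ q₂ p₃ q₃ (node X Y Z).lst = n₃ Z.lst + q₃ := by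
  change extCount Z n₃ p₃ q₃ Z.lst = _
  rcases h with rfl | h
  · simp [extCount]
  · simp [extCount, Ne.symm h]

/-- The binary length of `par` is the measure for the rows: it drops from a parallel composition to
each light child. -/
theorem Nat.size_lt_size_of_two_mul_le {m n : ℕ} (h : 2 * m ≤ n) (hn : 0 < n) :
    m.size < n.size := by
  rw [Nat.lt_size]
  rcases Nat.eq_zero_or_pos m with rfl | hm
  · simpa using Nat.one_le_iff_ne_zero.2 hn.ne'
  · obtain ⟨s, hs⟩ : ∃ s, m.size = s + 1 :=
      ⟨m.size - 1, (Nat.succ_pred_eq_of_pos (Nat.size_pos.2 hm)).symm⟩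
    have : 2 ^ s ≤ m := Nat.lt_size.1 (by omega)
    rw [hs, pow_succ]
    omega

namespace Chain

/-- The two-terminal digraph of a chain. -/
def tg : Chain → TwoTerminal
  | edge => single
  | vert R => TwoTerminal.vert R.tg
  | node A B R => TwoTerminal.node A.tg B.tg R.tg

/-- The number of parallel compositions. -/
def par : Chain → ℕ
  | edge => 0
  | vert R => R.par
  | node A B R => A.par + B.par + R.par + 1

/-- The number of constructors other than `edge`. -/
def size : Chain → ℕ
  | edge => 0
  | vert R => R.size + 1
  | node A B R => A.size + B.size + R.size + 1

/-- The number of parallel compositions on the heavy path. -/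
def heavy : Chain → ℕ
  | edge => 0
  | vert R => R.heavy
  -- The threshold makes the other branch light in both cases: either `2 * B.par` or `2 * R.par` is
  -- at most the total. Only steps into `B` count, since only they save bends in a U-turn.
  | node A B R => if A.par + B.par + 1 ≤ R.par then R.heavy else B.heavy + 1

/-- In all parallel compositions, the second part is at least as heavy as the first one. -/
def Sorted : Chain → Prop
  | edge => True
  | vert R => R.Sorted
  | node A B R => A.par ≤ B.par ∧ A.Sorted ∧ B.Sorted ∧ R.Sorted

theorem heavy_le_par : ∀ c : Chain, c.heavy ≤ c.par
  | edge => le_rfl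
  | vert R => R.heavy_le_par
  | node A B R => by
    have := B.heavy_le_par
    have := R.heavy_le_par
    simp only [heavy, par]
    split_ifs <;> omega

theorem fst_ne_lst {c : Chain} (h : c.par ≠ 0) : c.tg.fst ≠ c.tg.lst := by
  cases c with
  | edge => exact absurd rfl h
  | vert R => exact vert_fst_ne_lst _
  | node A B R => exact node_fst_ne_lst _ _ _

/-! ### The three kinds of drawings of a chain -/

/-- A drawing from left to right, with both terminals in the top row. -/
def DrawsTop (c : Chain) (h : ℤ) : Prop :=
  ∃ (w : ℤ) (n : c.tg.E → ℕ), 0 < w ∧ w ≤ 20 * c.size + 1 ∧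
    -- Unbent terminal edges leave room for the bends of the wires attached later. The last edge may
    -- be bent if there is a parallel composition, for it may have to climb from a join to the top
    -- row.
    HasDrawing c.tg.G (Frame.lr 0 0 w h 0 0) n ∧ n c.tg.fst = 0 ∧ (c.par = 0 → n c.tg.lst = 0) ∧
    2 * ∑ e, n e ≤ 5 * c.par

/-- A drawing from left to right that ends in the bottom row, and starts in the top row if the
chain is not just a path. -/
def DrawsDown (c : Chain) (h : ℤ) : Prop :=
  ∃ (w : ℤ) (n : c.tg.E → ℕ), 0 < w ∧ w ≤ 20 * c.size + 1 ∧
    -- A path has no bends to spend, so it stays in the bottom row instead of descending to it.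
    HasDrawing c.tg.G (Frame.lr 0 0 w h (if c.par = 0 then -h else 0) (-h)) n ∧
    n c.tg.fst = 0 ∧ n c.tg.lst = 0 ∧ 2 * ∑ e, n e ≤ 5 * c.par

/-- A drawing that starts and ends on the left side. -/
def DrawsTurn (c : Chain) (h : ℤ) : Prop :=
  ∃ (w : ℤ) (n : c.tg.E → ℕ), 0 < w ∧ w ≤ 20 * c.size + 1 ∧
    HasDrawing c.tg.G (Frame.uturn 0 0 w h) n ∧
    -- The summand 4 pays for the two bends of the edge at the end of the heavy path; `heavy`
    -- records the half bends saved on the way.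
    (c.par ≠ 0 → n c.tg.fst = 0 ∧ n c.tg.lst = 0) ∧ 2 * ∑ e, n e + c.heavy ≤ 5 * c.par + 4

theorem drawsTop_edge {h : ℤ} (hh : 0 ≤ h) : edge.DrawsTop h :=
  ⟨1, fun _ => 0, one_pos, by simp [size], hasDrawing_single_lr one_pos (by omega) le_rfl, rfl,
    fun _ => rfl, by simp⟩

theorem drawsDown_edge {h : ℤ} (hh : 0 ≤ h) : edge.DrawsDown h :=
  ⟨1, fun _ => 0, one_pos, by simp [size], hasDrawing_single_lr one_pos le_rfl (by simp [par, hh]),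
    rfl, rfl, by simp⟩

theorem drawsTurn_edge {h : ℤ} (hh : 1 ≤ h) : edge.DrawsTurn h := by
  refine ⟨1, fun _ => 2, one_pos, by simp [size], hasDrawing_single_uturn one_pos (by omega),
    fun h => absurd rfl h, ?_⟩
  change 2 * ∑ _ : Unit, 2 + 0 ≤ _
  simp

theorem HasDrawing.vert_lr {Z : TwoTerminal} {w h a b : ℤ} {n : Z.E → ℕ} (hw : 0 < w)
    (hD : HasDrawing Z.G (Frame.lr 0 0 w h a b) n) (ha : -h ≤ a) (ha' : a ≤ 0) (hb : -h ≤ b)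
    (hb' : b ≤ 0) :
    HasDrawing (TwoTerminal.vert Z).G (Frame.lr 0 0 (w + 5) h a b) (vertCount n) := by
  have h1 := hD.lr 4 0
  simp only [Frame.lr, zero_sub, zero_add] at h1 ⊢
  refine HasDrawing.vert h1 (by omega) (by omega) ha ha' ?_ hD.le_two ?_
  · simp only [SegDir, true_and]; omega
  · intro u v h2
    simp only [OnSeg, Prod.mk.injEq] at h2 ⊢
    omega

theorem DrawsTop.vert {R : Chain} {h : ℤ} (hh : 0 ≤ h) (hR : R.DrawsTop h) :
    R.vert.DrawsTop h := by
  obtain ⟨w, n, h1, h2, h3, h4, h5, h6⟩ := hR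
  refine ⟨w + 5, vertCount n, by omega, by simp only [size]; push_cast; omega,
    HasDrawing.vert_lr h1 h3 (by omega) le_rfl (by omega) le_rfl, rfl, h5, ?_⟩
  exact (congrArg (2 * ·) (sum_vertCount n)).trans_le h6

theorem DrawsDown.vert {R : Chain} {h : ℤ} (hh : 0 ≤ h) (hR : R.DrawsDown h) :
    R.vert.DrawsDown h := by
  obtain ⟨w, n, h1, h2, h3, h4, h5, h6⟩ := hR
  refine ⟨w + 5, vertCount n, by omega, by simp only [size]; push_cast; omega,
    HasDrawing.vert_lr h1 h3 (by split_ifs <;> omega) (by split_ifs <;> omega) (by omega)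
      (by omega), rfl, h5, ?_⟩
  exact (congrArg (2 * ·) (sum_vertCount n)).trans_le h6

theorem DrawsTurn.vert {R : Chain} {h : ℤ} (hh : 1 ≤ h) (hR : R.DrawsTurn h) :
    R.vert.DrawsTurn h := by
  obtain ⟨w, n, h1, h2, h3, h4, h5⟩ := hR
  refine ⟨w + 5, vertCount n, by omega, by simp only [size]; push_cast; omega, ?_,
    fun h => ⟨rfl, (h4 h).2⟩, ?_⟩
  · have h1 := h3.uturn 4 0
    simp only [Frame.uturn, zero_sub] at h1 ⊢
    refine HasDrawing.vert h1 (by omega) (by omega) (by omega) le_rfl ?_ h3.le_two ?_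
    · simp only [SegDir, true_and]; omega
    · intro u v h2
      simp only [OnSeg, Prod.mk.injEq] at h2 ⊢
      omega
  · exact (congrArg (2 * · + R.heavy) (sum_vertCount n)).trans_le h5

/-! ### Blocks in front of an arbitrary continuation -/

/-- The parallel composition of `A` and `B` can be drawn in `k` rows below the initial edge,
in front of any drawing that starts in the top row. -/
def BlockTop (A B : Chain) (k : ℤ) : Prop :=
  ∃ x : ℤ, 0 < x ∧ x ≤ 20 * (A.size + B.size) + 10 ∧
    ∀ (Z : TwoTerminal) (n₃ : Z.E → ℕ) (x₁ w h : ℤ) (po po' : GridPt) (d : Dir),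
      -- The exit of `Z` is left open, so that the same block can precede drawings of all three
      -- kinds.
      HasDrawing Z.G ⟨x, x₁, -h, 0, (x, 0), po, .right, d⟩ n₃ → x ≤ x₁ → x₁ ≤ w → k ≤ h →
      SegDir po po' d →
      (∀ u v, OnSeg (u, v) po po' → (0 ≤ u ∧ u ≤ w ∧ -h ≤ v ∧ v ≤ 0) ∧ ((u, v) = po ∨
        ¬ (x ≤ u ∧ u ≤ x₁ ∧ -h ≤ v ∧ v ≤ 0) ∧ (x < u ∨ v < -k))) →
      n₃ Z.fst = 0 →
      ∃ n, HasDrawing (TwoTerminal.node A.tg B.tg Z).G ⟨0, w, -h, 0, (0, 0), po', .right, d⟩ n ∧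
        n (TwoTerminal.node A.tg B.tg Z).fst = 0 ∧
        (Z.fst ≠ Z.lst → n (TwoTerminal.node A.tg B.tg Z).lst = n₃ Z.lst) ∧
        2 * ∑ e, n e ≤ 2 * ∑ e, n₃ e + 5 * (A.par + B.par + 1)

/-- Like `BlockTop`, with the end of the parallel composition in row `-k`. -/
def BlockBot (A B : Chain) (k : ℤ) : Prop :=
  ∃ x : ℤ, 0 < x ∧ x ≤ 20 * (A.size + B.size) + 10 ∧
    ∀ (Z : TwoTerminal) (n₃ : Z.E → ℕ) (x₁ w h : ℤ) (po po' : GridPt) (d : Dir),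
      HasDrawing Z.G ⟨x, x₁, -h, 0, (x, -k), po, .right, d⟩ n₃ → x ≤ x₁ → x₁ ≤ w → k ≤ h →
      SegDir po po' d →
      (∀ u v, OnSeg (u, v) po po' → (0 ≤ u ∧ u ≤ w ∧ -h ≤ v ∧ v ≤ 0) ∧ ((u, v) = po ∨
        ¬ (x ≤ u ∧ u ≤ x₁ ∧ -h ≤ v ∧ v ≤ 0) ∧ (x < u ∨ v < -k))) →
      ∃ n, HasDrawing (TwoTerminal.node A.tg B.tg Z).G ⟨0, w, -h, 0, (0, 0), po', .right, d⟩ n ∧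
        n (TwoTerminal.node A.tg B.tg Z).fst = 0 ∧
        n (TwoTerminal.node A.tg B.tg Z).lst = n₃ Z.lst ∧
        2 * ∑ e, n e ≤ 2 * ∑ e, n₃ e + 5 * (A.par + B.par + 1)

/-- Both new bends lie on the strand of `A`; twice their number is within the allowance of 5. The
price is a row for `B`. -/
theorem blockTop_side {A B : Chain} {k : ℤ} (hk : 0 < k) (hA : A.DrawsDown (k - 1))
    (hB : B.DrawsTop (k - 1)) : BlockTop A B k := by
  obtain ⟨w₁, n₁, a1, a2, a3, a4, a5, a6⟩ := hA
  obtain ⟨w₂, n₂, b1, b2, b3, b4, b5, b6⟩ := hB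
  refine ⟨w₁ + w₂ + 7, by omega, by omega, fun Z n₃ x₁ w h po po' d h₃ hx hw hkh hq hq' h0 => ?_⟩
  refine ⟨_, HasDrawing.node_side_top a3 b3 h₃ a1 b1 hx hw hk hkh (by split_ifs <;> omega)
    (by split_ifs <;> omega) hq hq' ?_ ?_ ?_, rfl, fun hne => ?_, ?_⟩
  · exact extCount_le a3.le_two (by omega) (by omega) (fun _ => by omega)
  · intro e; rw [extCount_zero]; exact b3.le_two e
  · intro e; rw [extCount_zero]; exact h₃.le_two e
  · rw [nodeCount_lst _ _ _ _ _ _ _ _ _ (.inl rfl)]; rfl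
  · rw [sum_nodeCount]; omega

/-- There are four new bends, and the turn of `B` exceeds the budget of `B` by 4 minus its heavy
count in doubled bends. So `8 + 4 - 7 = 5` explains the bound 7. -/
theorem blockTop_wrap {A B : Chain} {k : ℤ} (hk : 1 < k) (hA : A.DrawsDown (k - 1))
    (hB : B.DrawsTurn (k - 1)) (hB' : 7 ≤ B.heavy) : BlockTop A B k := by
  obtain ⟨w₁, n₁, a1, a2, a3, a4, a5, a6⟩ := hA
  obtain ⟨w₂, n₂, b1, b2, b3, b4, b5⟩ := hB
  have hp : B.par ≠ 0 := by have := B.heavy_le_par; omega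
  obtain ⟨b6, b7⟩ := b4 hp
  refine ⟨w₁ + w₂ + 8, by omega, by omega, fun Z n₃ x₁ w h po po' d h₃ hx hw hkh hq hq' h0 => ?_⟩
  refine ⟨_, HasDrawing.node_wrap_top a3 b3 h₃ a1 b1 hx hw hk hkh (by split_ifs <;> omega)
    (by split_ifs <;> omega) hq hq' ?_ ?_ ?_, rfl, fun hne => ?_, ?_⟩
  · exact extCount_le a3.le_two (by omega) (by omega) (fun _ => by omega)
  · exact extCount_le b3.le_two (by omega) (by omega) (fun _ => by omega)
  -- The wire from the join puts two bends on the first edge of `Z`, which is why it must be unbent.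
  · exact extCount_le h₃.le_two (by omega) (h₃.le_two _) (fun _ => by omega)
  · rw [nodeCount_lst _ _ _ _ _ _ _ _ _ (.inr hne)]; rfl
  · rw [sum_nodeCount]; omega

/-- Without the climb back to the top row only two bends are new. -/
theorem blockBot_wrap {A B : Chain} {k : ℤ} (hk : 1 < k) (hA : A.DrawsDown (k - 1))
    (hB : B.DrawsTurn (k - 1)) (hB' : 7 ≤ B.heavy) : BlockBot A B k := by
  obtain ⟨w₁, n₁, a1, a2, a3, a4, a5, a6⟩ := hA
  obtain ⟨w₂, n₂, b1, b2, b3, b4, b5⟩ := hB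
  have hp : B.par ≠ 0 := by have := B.heavy_le_par; omega
  obtain ⟨b6, b7⟩ := b4 hp
  refine ⟨w₁ + w₂ + 8, by omega, by omega, fun Z n₃ x₁ w h po po' d h₃ hx hw hkh hq hq' => ?_⟩
  refine ⟨_, HasDrawing.node_wrap_bot a3 b3 h₃ a1 b1 hx hw hk hkh (by split_ifs <;> omega)
    (by split_ifs <;> omega) hq hq' ?_ ?_ ?_, rfl, ?_, ?_⟩
  · exact extCount_le a3.le_two (by omega) (by omega) (fun _ => by omega)
  · exact extCount_le b3.le_two (by omega) (by omega) (fun _ => by omega)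
  · intro e; rw [extCount_zero]; exact h₃.le_two e
  · rw [nodeCount_lst _ _ _ _ _ _ _ _ _ (.inl rfl)]; rfl
  · rw [sum_nodeCount]; omega

/-- `B` has to start in the top row and to end with an unbent edge, in any row. A path does so in a
top drawing, every other chain in a descending one. -/
theorem blockBot_side {A B : Chain} {k : ℤ} (hk : 0 < k) (hA : A.DrawsDown (k - 1))
    (hB : B.DrawsTop (k - 1)) (hB' : B.DrawsDown (k - 1)) : BlockBot A B k := by
  obtain ⟨w₁, n₁, a1, a2, a3, a4, a5, a6⟩ := hA
  obtain ⟨w₂, n₂, b, b1, b2, b3, b4, b5, b6, b7, b8⟩ : ∃ (w : ℤ) (n : B.tg.E → ℕ) (b : ℤ), 0 < w ∧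
      w ≤ 20 * B.size + 1 ∧ HasDrawing B.tg.G (Frame.lr 0 0 w (k - 1) 0 b) n ∧ n B.tg.fst = 0 ∧
      n B.tg.lst = 0 ∧ 2 * ∑ e, n e ≤ 5 * B.par ∧ -(k - 1) ≤ b ∧ b ≤ 0 := by
    by_cases hp : B.par = 0
    · obtain ⟨w₂, n₂, b1, b2, b3, b4, b5, b6⟩ := hB
      exact ⟨w₂, n₂, 0, b1, b2, b3, b4, b5 hp, b6, by omega, le_rfl⟩
    · obtain ⟨w₂, n₂, b1, b2, b3, b4, b5, b6⟩ := hB'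
      rw [if_neg hp] at b3
      exact ⟨w₂, n₂, -(k - 1), b1, b2, b3, b4, b5, b6, by omega, by omega⟩
  refine ⟨w₁ + w₂ + 7, by omega, by omega, fun Z n₃ x₁ w h po po' d h₃ hx hw hkh hq hq' => ?_⟩
  refine ⟨_, HasDrawing.node_side_bot a3 b3 h₃ a1 b1 hx hw hk b7 b8 hkh (by split_ifs <;> omega)
    (by split_ifs <;> omega) hq hq' ?_ ?_ ?_, rfl, ?_, ?_⟩
  · exact extCount_le a3.le_two (by omega) (by omega) (fun _ => by omega)
  · exact extCount_le b3.le_two (by omega) (by omega) (fun _ => by omega)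
  · intro e; rw [extCount_zero]; exact h₃.le_two e
  · rw [nodeCount_lst _ _ _ _ _ _ _ _ _ (.inl rfl)]; rfl
  · rw [sum_nodeCount]; omega

theorem BlockTop.drawsTop {A B R : Chain} {k : ℤ} (hk : 0 < k) (hP : BlockTop A B k)
    (hR : R.DrawsTop k) : (node A B R).DrawsTop k := by
  obtain ⟨x, h1, h2, h3⟩ := hP
  obtain ⟨w, n₃, r1, r2, r3, r4, r5, r6⟩ := hR
  have r3 := r3.lr x 0
  simp only [Frame.lr, zero_sub, add_zero] at r3
  obtain ⟨n, m1, m2, m3, m4⟩ := h3 R.tg n₃ (x + w) (x + w + 1) k (x + w, 0) (x + w + 1, 0) .right r3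
    (by omega) (by omega) le_rfl (by simp [SegDir])
    (by intro u v h; simp only [OnSeg, Prod.mk.injEq] at h ⊢; omega) r4
  refine ⟨x + w + 1, n, by omega, by simp only [size]; push_cast; omega, ?_, m2,
    fun h => absurd h (by simp [par]), ?_⟩
  · simp only [Frame.lr, zero_sub, zero_add, add_zero]
    exact m1
  · exact m4.trans (by simp only [par]; omega)

theorem BlockTop.drawsDown {A B R : Chain} {k : ℤ} (hk : 0 < k) (hP : BlockTop A B k)
    (hR : R.DrawsDown k) (hp : R.par ≠ 0) : (node A B R).DrawsDown k := by
  obtain ⟨x, h1, h2, h3⟩ := hP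
  obtain ⟨w, n₃, r1, r2, r3, r4, r5, r6⟩ := hR
  have r3 := r3.lr x 0
  simp only [Frame.lr, if_neg hp, zero_sub, zero_add, add_zero] at r3
  obtain ⟨n, m1, m2, m3, m4⟩ := h3 R.tg n₃ (x + w) (x + w + 1) k (x + w, -k) (x + w + 1, -k) .right
    r3 (by omega) (by omega) le_rfl (by simp [SegDir])
    (by intro u v h; simp only [OnSeg, Prod.mk.injEq] at h ⊢; omega) r4
  refine ⟨x + w + 1, n, by omega, by simp only [size]; push_cast; omega, ?_, m2,
    (m3 (fst_ne_lst hp)).trans r5, ?_⟩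
  · rw [if_neg (by simp [par])]
    simp only [Frame.lr, zero_sub, zero_add, add_zero]
    exact m1
  · exact m4.trans (by simp only [par]; omega)

/-- If `R` is a path, it must run straight along the bottom row, so the descent has to be over at
the join. -/
theorem BlockBot.drawsDown {A B R : Chain} {k : ℤ} (hk : 0 < k) (hP : BlockBot A B k)
    (hR : R.DrawsDown k) (hp : R.par = 0) : (node A B R).DrawsDown k := by
  obtain ⟨x, h1, h2, h3⟩ := hP
  obtain ⟨w, n₃, r1, r2, r3, r4, r5, r6⟩ := hR
  have r3 := r3.lr x 0
  simp only [Frame.lr, if_pos hp, zero_sub, zero_add] at r3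
  obtain ⟨n, m1, m2, m3, m4⟩ := h3 R.tg n₃ (x + w) (x + w + 1) k (x + w, -k) (x + w + 1, -k) .right
    r3 (by omega) (by omega) le_rfl (by simp [SegDir])
    (by intro u v h; simp only [OnSeg, Prod.mk.injEq] at h ⊢; omega)
  refine ⟨x + w + 1, n, by omega, by simp only [size]; push_cast; omega, ?_, m2, m3.trans r5, ?_⟩
  · rw [if_neg (by simp [par])]
    simp only [Frame.lr, zero_sub, zero_add, add_zero]
    exact m1
  · exact m4.trans (by simp only [par]; omega)

/-- The block takes only `h - 1` rows, so the wire that returns from the turn of `R` passes below it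
in row `-h`. The heavy part `R` keeps all its rows. -/
theorem BlockTop.drawsTurn {A B R : Chain} {h : ℤ} (hh : 1 < h) (hP : BlockTop A B (h - 1))
    (hR : R.DrawsTurn h) (hp : A.par + B.par + 1 ≤ R.par) : (node A B R).DrawsTurn h := by
  obtain ⟨x, h1, h2, h3⟩ := hP
  obtain ⟨w, n₃, r1, r2, r3, r4, r5⟩ := hR
  obtain ⟨r6, r7⟩ := r4 (by omega)
  have r3 := r3.uturn x 0
  simp only [Frame.uturn, zero_sub] at r3
  obtain ⟨n, m1, m2, m3, m4⟩ := h3 R.tg n₃ (x + w) (x + w + 1) h (x, -h) (0, -h) .left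
    r3 (by omega) (by omega) (by omega) (by simp only [SegDir, true_and]; omega)
    (by intro u v h; simp only [OnSeg, Prod.mk.injEq] at h ⊢; omega) r6
  refine ⟨x + w + 1, n, by omega, by simp only [size]; push_cast; omega, ?_,
    fun _ => ⟨m2, (m3 (fst_ne_lst (by omega))).trans r7⟩, ?_⟩
  · simp only [Frame.uturn, zero_sub, zero_add]
    exact m1
  · have m4 : 2 * ∑ e : (node A B R).tg.E, n e ≤
      2 * ∑ e, n₃ e + 5 * (A.par + B.par + 1) := m4
    simp only [heavy, if_pos hp]
    simp only [par]
    omega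

/-- The heavy part `B` turns with the full height. The two new bends use 4 of the allowance 5, and
the remaining unit pays for the increment of `heavy`. -/
theorem drawsTurn_back_high {A B R : Chain} {h : ℤ} (hh : 1 < h) (hA : A.DrawsTop (h - 2))
    (hB : B.DrawsTurn h) (hR : R.DrawsDown (h - 1)) (hR' : R.par ≠ 0) (hB' : B.par ≠ 0)
    (hp : R.par < A.par + B.par + 1) : (node A B R).DrawsTurn h := by
  obtain ⟨w₁, n₁, a1, a2, a3, a4, a5, a6⟩ := hA
  obtain ⟨w₂, n₂, b1, b2, b3, b4, b5⟩ := hB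
  obtain ⟨w₃, n₃, r1, r2, r3, r4, r5, r6⟩ := hR
  obtain ⟨b6, b7⟩ := b4 hB'
  rw [if_neg hR'] at r3
  refine ⟨w₁ + w₂ + w₃ + 5, _, by omega, by simp only [size]; push_cast; omega,
    HasDrawing.node_back_high a3 b3 r3 a1 b1 r1 hh ?_ ?_ ?_, fun _ => ⟨rfl, ?_⟩, ?_⟩
  · exact extCount_le a3.le_two (by omega) (a3.le_two _) (fun _ => by omega)
  · exact extCount_le b3.le_two (by omega) (by omega) (fun _ => by omega)
  · intro e; rw [extCount_zero]; exact r3.le_two e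
  · exact (nodeCount_lst _ _ _ _ _ _ _ _ _ (.inl rfl)).trans r5
  · refine (congrArg (2 * · + _) (sum_nodeCount _ _ _ _ _ _ _ _ _)).trans_le ?_
    rw [heavy, if_neg (by omega), par]
    omega

/-- The count is that of the other backward layout. As `R` is a path it lies in the bottom row, so
the join does too, and `A` needs an unbent last edge in order to bend down to it. -/
theorem drawsTurn_back_low {A B R : Chain} {h : ℤ} (hh : 1 < h) (hA : A.DrawsTop (h - 2))
    (hA' : A.DrawsDown (h - 2)) (hB : B.DrawsTurn h) (hR : R.DrawsDown (h - 1)) (hR' : R.par = 0) :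
    (node A B R).DrawsTurn h := by
  obtain ⟨w₁, n₁, b, a1, a2, a3, a4, a5, a6, a7, a8⟩ : ∃ (w : ℤ) (n : A.tg.E → ℕ) (b : ℤ), 0 < w ∧
      w ≤ 20 * A.size + 1 ∧ HasDrawing A.tg.G (Frame.lr 0 0 w (h - 2) 0 b) n ∧ n A.tg.fst = 0 ∧
      n A.tg.lst = 0 ∧ 2 * ∑ e, n e ≤ 5 * A.par ∧ -(h - 2) ≤ b ∧ b ≤ 0 := by
    by_cases hp : A.par = 0
    · obtain ⟨w₂, n₂, b1, b2, b3, b4, b5, b6⟩ := hA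
      exact ⟨w₂, n₂, 0, b1, b2, b3, b4, b5 hp, b6, by omega, le_rfl⟩
    · obtain ⟨w₂, n₂, b1, b2, b3, b4, b5, b6⟩ := hA'
      rw [if_neg hp] at b3
      exact ⟨w₂, n₂, -(h - 2), b1, b2, b3, b4, b5, b6, by omega, by omega⟩
  obtain ⟨w₂, n₂, b1, b2, b3, b4, b5⟩ := hB
  obtain ⟨w₃, n₃, r1, r2, r3, r4, r5, r6⟩ := hR
  rw [if_pos hR'] at r3
  refine ⟨w₁ + w₂ + w₃ + 5, _, by omega, by simp only [size]; push_cast; omega,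
    HasDrawing.node_back_low a3 b3 r3 a1 b1 r1 hh a7 a8 ?_ ?_ ?_, fun _ => ⟨rfl, ?_⟩, ?_⟩
  · exact extCount_le a3.le_two (by omega) (by omega) (fun _ => by omega)
  · intro e; rw [extCount_zero]; exact b3.le_two e
  · intro e; rw [extCount_zero]; exact r3.le_two e
  · exact (nodeCount_lst _ _ _ _ _ _ _ _ _ (.inl rfl)).trans r5
  · refine (congrArg (2 * · + _) (sum_nodeCount _ _ _ _ _ _ _ _ _)).trans_le ?_
    rw [heavy, if_neg (by omega), par]
    omega

/-! ### The induction over chains -/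

/-- A number of rows that suffices for drawings from left to right. -/
def rows (c : Chain) : ℕ := 10 * c.par.size + min c.heavy 8

/-- Light children have ten rows fewer in the leading term, which covers the rows lost in any layout
and the bounded term `min heavy 8`. Along the heavy path a U-turn keeps its height. A drawing from
left to right keeps it on entering `R`; on entering `B` it either loses one row while `heavy` drops
by one, or switches to a U-turn. -/
theorem draws (c : Chain) (hc : c.Sorted) :
    (∀ h : ℤ, c.rows ≤ h → c.DrawsTop h) ∧ (∀ h : ℤ, c.rows ≤ h → c.DrawsDown h) ∧
      (∀ h : ℤ, 10 * (c.par.size : ℤ) + 1 ≤ h → c.DrawsTurn h) := by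
  induction c with
  | edge =>
    exact ⟨fun h hh => drawsTop_edge (by omega), fun h hh => drawsDown_edge (by omega),
      fun h hh => drawsTurn_edge (by omega)⟩
  | vert R ih =>
    obtain ⟨h1, h2, h3⟩ := ih hc
    exact ⟨fun h hh => (h1 h hh).vert (by omega), fun h hh => (h2 h hh).vert (by omega),
      fun h hh => (h3 h hh).vert (by omega)⟩
  | node A B R ihA ihB ihR =>
    obtain ⟨hAB, hA, hB, hR⟩ := hc
    obtain ⟨a1, a2, a3⟩ := ihA hA
    obtain ⟨b1, b2, b3⟩ := ihB hB
    obtain ⟨r1, r2, r3⟩ := ihR hR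
    have hpar : (node A B R).par = A.par + B.par + R.par + 1 := rfl
    have hpos : 0 < (node A B R).par := by omega
    -- `A` is light in any case, because it is not heavier than `B`.
    have sA : A.par.size < (node A B R).par.size :=
      Nat.size_lt_size_of_two_mul_le (by omega) hpos
    have sB : B.par.size ≤ (node A B R).par.size := Nat.size_le_size (by omega)
    have sR : R.par.size ≤ (node A B R).par.size := Nat.size_le_size (by omega)
    by_cases hheavy : A.par + B.par + 1 ≤ R.par
    · have sB' : B.par.size < (node A B R).par.size :=
        Nat.size_lt_size_of_two_mul_le (by omega) hpos
      have hhv : (node A B R).heavy = R.heavy := if_pos hheavy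
      have hblock : ∀ k : ℤ, 10 * ((node A B R).par.size : ℤ) ≤ k → BlockTop A B k := by
        intro k hk
        have hA := a2 (k - 1) (by simp only [rows]; push_cast; omega)
        by_cases h7 : 7 ≤ B.heavy
        · exact blockTop_wrap (by omega) hA (b3 (k - 1) (by omega)) h7
        · exact blockTop_side (by omega) hA (b1 (k - 1) (by simp only [rows]; push_cast; omega))
      refine ⟨fun h hh => ?_, fun h hh => ?_, fun h hh => ?_⟩
      · simp only [rows, hhv] at hh
        push_cast at hh
        exact (hblock h (by omega)).drawsTop (by omega)
          (r1 h (by simp only [rows]; push_cast; omega))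
      · simp only [rows, hhv] at hh
        push_cast at hh
        exact (hblock h (by omega)).drawsDown (by omega)
          (r2 h (by simp only [rows]; push_cast; omega)) (by omega)
      -- One of the `10 * size + 1` rows is for the returning wire; the block fits into the others.
      · exact (hblock (h - 1) (by omega)).drawsTurn (by omega) (r3 h (by omega)) hheavy
    · have sR' : R.par.size < (node A B R).par.size :=
        Nat.size_lt_size_of_two_mul_le (by omega) hpos
      have hhv : (node A B R).heavy = B.heavy + 1 := if_neg hheavy
      refine ⟨fun h hh => ?_, fun h hh => ?_, fun h hh => ?_⟩
      · simp only [rows, hhv] at hh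
        push_cast at hh
        have hA := a2 (h - 1) (by simp only [rows]; push_cast; omega)
        have hR := r1 h (by simp only [rows]; push_cast; omega)
        -- If `B.heavy ≤ 6`, the minimum in `rows` is not yet attained at 8, so `B` needs a row less
        -- than the whole. Otherwise the eight extra rows leave enough for the U-turn, which needs
        -- just one beyond the leading term.
        by_cases h7 : 7 ≤ B.heavy
        · exact (blockTop_wrap (by omega) hA (b3 (h - 1) (by omega)) h7).drawsTop (by omega) hR
        · exact (blockTop_side (by omega) hA
            (b1 (h - 1) (by simp only [rows]; push_cast; omega))).drawsTop (by omega) hR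
      · simp only [rows, hhv] at hh
        push_cast at hh
        have hA := a2 (h - 1) (by simp only [rows]; push_cast; omega)
        have hR := r2 h (by simp only [rows]; push_cast; omega)
        by_cases h7 : 7 ≤ B.heavy
        · have hB := b3 (h - 1) (by omega)
          by_cases hp : R.par = 0
          · exact (blockBot_wrap (by omega) hA hB h7).drawsDown (by omega) hR hp
          · exact (blockTop_wrap (by omega) hA hB h7).drawsDown (by omega) hR hp
        · have hB := b1 (h - 1) (by simp only [rows]; push_cast; omega)
          by_cases hp : R.par = 0
          · exact (blockBot_side (by omega) hA hB
              (b2 (h - 1) (by simp only [rows]; push_cast; omega))).drawsDown (by omega) hR hp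
          · exact (blockTop_side (by omega) hA hB).drawsDown (by omega) hR hp
      · have hA := a1 (h - 2) (by simp only [rows]; push_cast; omega)
        have hB := b3 h (by omega)
        have hR := r2 (h - 1) (by simp only [rows]; push_cast; omega)
        by_cases hp : R.par = 0
        · exact drawsTurn_back_low (by omega) hA
            (a2 (h - 2) (by simp only [rows]; push_cast; omega)) hB hR hp
        · exact drawsTurn_back_high (by omega) hA hB hR hp (by omega) (by omega)

end Chain

/-! ### From decomposition trees to chains -/

/-- Isomorphisms of digraphs with two terminals. -/
structure PointedIso {I E I' E' : Type} (G : MultiDigraph (SPVertex I) E)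
    (G' : MultiDigraph (SPVertex I') E') where
  inner : I ≃ I'
  edge : E ≃ E'
  src_edge : ∀ e, G'.src (edge e) = (G.src e).map inner
  tgt_edge : ∀ e, G'.tgt (edge e) = (G.tgt e).map inner

namespace PointedIso

variable {I E I' E' I'' E'' : Type} {G : MultiDigraph (SPVertex I) E}
  {G' : MultiDigraph (SPVertex I') E'} {G'' : MultiDigraph (SPVertex I'') E''}

theorem _root_.SPVertex.map_map (f : I → I') (g : I' → I'') (v : SPVertex I) :
    (v.map f).map g = v.map (g ∘ f) := by
  cases v <;> rfl

/-- Composition of isomorphisms. -/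
def trans (φ : PointedIso G G') (ψ : PointedIso G' G'') : PointedIso G G'' where
  inner := φ.inner.trans ψ.inner
  edge := φ.edge.trans ψ.edge
  src_edge e := by
    simp only [Equiv.trans_apply, ψ.src_edge, φ.src_edge, SPVertex.map_map, Equiv.coe_trans]
  tgt_edge e := by
    simp only [Equiv.trans_apply, ψ.tgt_edge, φ.tgt_edge, SPVertex.map_map, Equiv.coe_trans]

/-- The inverse isomorphism. -/
def symm (φ : PointedIso G G') : PointedIso G' G where
  inner := φ.inner.symm
  edge := φ.edge.symm
  src_edge e := by
    have := φ.src_edge (φ.edge.symm e)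
    rw [Equiv.apply_symm_apply] at this
    rw [this, SPVertex.map_map]
    cases G.src (φ.edge.symm e) <;> simp
  tgt_edge e := by
    have := φ.tgt_edge (φ.edge.symm e)
    rw [Equiv.apply_symm_apply] at this
    rw [this, SPVertex.map_map]
    cases G.tgt (φ.edge.symm e) <;> simp

end PointedIso

namespace SPTree

theorem src_ne_sink : ∀ (T : SPTree) (e : T.Edge), T.graph.src e ≠ .sink
  | edge, _ => nofun
  | series a b, .inl e => by
    have := src_ne_sink a e
    change serL a b (a.graph.src e) ≠ _
    cases h : a.graph.src e with
    | sink => exact absurd h this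
    | source => exact nofun
    | inner i => exact nofun
  | series a b, .inr e => by
    have := src_ne_sink b e
    change serR a b (b.graph.src e) ≠ _
    cases h : b.graph.src e with
    | sink => exact absurd h this
    | source => exact nofun
    | inner i => exact nofun
  | parallel a b, .inl e => by
    have := src_ne_sink a e
    change parL a b (a.graph.src e) ≠ _
    cases h : a.graph.src e with
    | sink => exact absurd h this
    | source => exact nofun
    | inner i => exact nofun
  | parallel a b, .inr e => by
    have := src_ne_sink b e
    change parR a b (b.graph.src e) ≠ _
    cases h : b.graph.src e with
    | sink => exact absurd h this
    | source => exact nofun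
    | inner i => exact nofun

theorem tgt_ne_source : ∀ (T : SPTree) (e : T.Edge), T.graph.tgt e ≠ .source
  | edge, _ => nofun
  | series a b, .inl e => by
    have := tgt_ne_source a e
    change serL a b (a.graph.tgt e) ≠ _
    cases h : a.graph.tgt e with
    | source => exact absurd h this
    | sink => exact nofun
    | inner i => exact nofun
  | series a b, .inr e => by
    have := tgt_ne_source b e
    change serR a b (b.graph.tgt e) ≠ _
    cases h : b.graph.tgt e with
    | source => exact absurd h this
    | sink => exact nofun
    | inner i => exact nofun
  | parallel a b, .inl e => by
    have := tgt_ne_source a e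
    change parL a b (a.graph.tgt e) ≠ _
    cases h : a.graph.tgt e with
    | source => exact absurd h this
    | sink => exact nofun
    | inner i => exact nofun
  | parallel a b, .inr e => by
    have := tgt_ne_source b e
    change parR a b (b.graph.tgt e) ≠ _
    cases h : b.graph.tgt e with
    | source => exact absurd h this
    | sink => exact nofun
    | inner i => exact nofun

/-- Series composition respects isomorphisms of its second part. -/
def seriesCongr (a : SPTree) {b b' : SPTree} (φ : PointedIso b.graph b'.graph) :
    PointedIso (series a b).graph (series a b').graph where
  inner := (Equiv.refl a.Inner).sumCongr ((Equiv.refl Unit).sumCongr φ.inner)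
  edge := (Equiv.refl a.Edge).sumCongr φ.edge
  src_edge := by
    rintro (e | e)
    · change serL a b' (a.graph.src e) = (serL a b (a.graph.src e)).map _
      cases a.graph.src e <;> rfl
    · change serR a b' (b'.graph.src (φ.edge e)) = (serR a b (b.graph.src e)).map _
      rw [φ.src_edge]
      cases b.graph.src e <;> rfl
  tgt_edge := by
    rintro (e | e)
    · change serL a b' (a.graph.tgt e) = (serL a b (a.graph.tgt e)).map _
      cases a.graph.tgt e <;> rfl
    · change serR a b' (b'.graph.tgt (φ.edge e)) = (serR a b (b.graph.tgt e)).map _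
      rw [φ.tgt_edge]
      cases b.graph.tgt e <;> rfl

/-- Series composition is associative. -/
def seriesAssoc (a b c : SPTree) :
    PointedIso (series a (series b c)).graph (series (series a b) c).graph where
  inner :=
    { toFun := fun i => match i with
        | .inl i => .inl (.inl i)
        | .inr (.inl u) => .inl (.inr (.inl u))
        | .inr (.inr (.inl i)) => .inl (.inr (.inr i))
        | .inr (.inr (.inr (.inl u))) => .inr (.inl u)
        | .inr (.inr (.inr (.inr i))) => .inr (.inr i)
      invFun := fun i => match i with
        | .inl (.inl i) => .inl i
        | .inl (.inr (.inl u)) => .inr (.inl u)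
        | .inl (.inr (.inr i)) => .inr (.inr (.inl i))
        | .inr (.inl u) => .inr (.inr (.inr (.inl u)))
        | .inr (.inr i) => .inr (.inr (.inr (.inr i)))
      left_inv := by rintro (i | u | i | u | i) <;> rfl
      right_inv := by rintro ((i | u | i) | u | i) <;> rfl }
  edge := (Equiv.sumAssoc a.Edge b.Edge c.Edge).symm
  src_edge := by
    rintro (e | e | e)
    · change serL _ _ (serL a b (a.graph.src e)) = (serL a _ (a.graph.src e)).map _
      cases a.graph.src e <;> rfl
    · change serL _ _ (serR a b (b.graph.src e)) = (serR a _ (serL b c (b.graph.src e))).map _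
      cases b.graph.src e <;> rfl
    · change serR _ _ (c.graph.src e) = (serR a _ (serR b c (c.graph.src e))).map _
      cases c.graph.src e <;> rfl
  tgt_edge := by
    rintro (e | e | e)
    · change serL _ _ (serL a b (a.graph.tgt e)) = (serL a _ (a.graph.tgt e)).map _
      cases a.graph.tgt e <;> rfl
    · change serL _ _ (serR a b (b.graph.tgt e)) = (serR a _ (serL b c (b.graph.tgt e))).map _
      cases b.graph.tgt e <;> rfl
    · change serR _ _ (c.graph.tgt e) = (serR a _ (serR b c (c.graph.tgt e))).map _
      cases c.graph.tgt e <;> rfl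

/-- The digraph of a single edge. -/
def edgeIso : PointedIso edge.graph single.G where
  inner := Equiv.refl Empty
  edge := Equiv.refl Unit
  src_edge _ := rfl
  tgt_edge _ := rfl

/-- An edge in front of a series-parallel digraph. -/
def vertIso {x : SPTree} {Z : TwoTerminal} (γ : PointedIso x.graph Z.G) :
    PointedIso (series edge x).graph (TwoTerminal.vert Z).G where
  inner :=
    { toFun := fun i => match i with
        | .inl i => i.elim
        | .inr (.inl _) => .inl ()
        | .inr (.inr i) => .inr ⟨true, γ.inner i⟩
      invFun := fun i => match i with
        | .inl _ => .inr (.inl ())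
        | .inr ⟨false, i⟩ => Empty.elim i
        | .inr ⟨true, i⟩ => .inr (.inr (γ.inner.symm i))
      left_inv := by
        rintro (i | u | i)
        · exact i.elim
        · rfl
        · exact congrArg (fun i => Sum.inr (Sum.inr i)) (γ.inner.symm_apply_apply i)
      right_inv := by
        rintro (u | ⟨_ | _, i⟩)
        · rfl
        · exact Empty.elim i
        · exact congrArg (fun i => (Sum.inr ⟨true, i⟩ : Unit ⊕ Σ σ, (vertFamily Z σ).I)) (γ.inner.apply_symm_apply i) }
  edge :=
    { toFun := fun i => match i with
        | .inl _ => ⟨false, ()⟩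
        | .inr i => ⟨true, γ.edge i⟩
      invFun := fun i => match i with
        | ⟨false, _⟩ => .inl ()
        | ⟨true, i⟩ => .inr (γ.edge.symm i)
      left_inv := by
        rintro (i | i)
        · rfl
        · exact congrArg Sum.inr (γ.edge.symm_apply_apply i)
      right_inv := by
        rintro ⟨_ | _, i⟩
        · rfl
        · exact congrArg (fun i => (⟨true, i⟩ : Σ σ, (vertFamily Z σ).E))
            (γ.edge.apply_symm_apply i) }
  src_edge := by
    rintro (e | e)
    · rfl
    · change vertSkeleton.lift (vertFamily Z) true (Z.G.src (γ.edge e)) =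
        (serR edge x (x.graph.src e)).map _
      rw [γ.src_edge]
      cases x.graph.src e <;> rfl
  tgt_edge := by
    rintro (e | e)
    · rfl
    · change vertSkeleton.lift (vertFamily Z) true (Z.G.tgt (γ.edge e)) =
        (serR edge x (x.graph.tgt e)).map _
      rw [γ.tgt_edge]
      cases x.graph.tgt e <;> rfl

/-- An edge and a parallel composition in front of a series-parallel digraph. -/
def nodeIso {a b x : SPTree} {X Y Z : TwoTerminal} (α : PointedIso a.graph X.G)
    (β : PointedIso b.graph Y.G) (γ : PointedIso x.graph Z.G) :
    PointedIso (series edge (series (parallel a b) x)).graph (TwoTerminal.node X Y Z).G where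
  inner :=
    { toFun := fun i => match i with
        | .inl i => i.elim
        | .inr (.inl _) => .inl .split
        | .inr (.inr (.inl (.inl i))) => .inr ⟨.a, α.inner i⟩
        | .inr (.inr (.inl (.inr i))) => .inr ⟨.b, β.inner i⟩
        | .inr (.inr (.inr (.inl _))) => .inl .join
        | .inr (.inr (.inr (.inr i))) => .inr ⟨.r, γ.inner i⟩
      invFun := fun i => match i with
        | .inl .split => .inr (.inl ())
        | .inl .join => .inr (.inr (.inr (.inl ())))
        | .inr ⟨.edge, i⟩ => Empty.elim i
        | .inr ⟨.a, i⟩ => .inr (.inr (.inl (.inl (α.inner.symm i))))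
        | .inr ⟨.b, i⟩ => .inr (.inr (.inl (.inr (β.inner.symm i))))
        | .inr ⟨.r, i⟩ => .inr (.inr (.inr (.inr (γ.inner.symm i))))
      left_inv := by
        rintro (i | u | (i | i) | u | i)
        · exact i.elim
        · rfl
        · exact congrArg (fun i => Sum.inr (Sum.inr (Sum.inl (Sum.inl i))))
            (α.inner.symm_apply_apply i)
        · exact congrArg (fun i => Sum.inr (Sum.inr (Sum.inl (Sum.inr i))))
            (β.inner.symm_apply_apply i)
        · rfl
        · exact congrArg (fun i => Sum.inr (Sum.inr (Sum.inr (Sum.inr i))))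
            (γ.inner.symm_apply_apply i)
      right_inv := by
        rintro ((_ | _) | ⟨_ | _ | _ | _, i⟩)
        · rfl
        · rfl
        · exact Empty.elim i
        · exact congrArg (fun i => (Sum.inr ⟨.a, i⟩ : NodeVertex ⊕ Σ σ, (nodeFamily X Y Z σ).I))
            (α.inner.apply_symm_apply i)
        · exact congrArg (fun i => (Sum.inr ⟨.b, i⟩ : NodeVertex ⊕ Σ σ, (nodeFamily X Y Z σ).I))
            (β.inner.apply_symm_apply i)
        · exact congrArg (fun i => (Sum.inr ⟨.r, i⟩ : NodeVertex ⊕ Σ σ, (nodeFamily X Y Z σ).I))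
            (γ.inner.apply_symm_apply i) }
  edge :=
    { toFun := fun i => match i with
        | .inl _ => ⟨.edge, ()⟩
        | .inr (.inl (.inl i)) => ⟨.a, α.edge i⟩
        | .inr (.inl (.inr i)) => ⟨.b, β.edge i⟩
        | .inr (.inr i) => ⟨.r, γ.edge i⟩
      invFun := fun i => match i with
        | ⟨.edge, _⟩ => .inl ()
        | ⟨.a, i⟩ => .inr (.inl (.inl (α.edge.symm i)))
        | ⟨.b, i⟩ => .inr (.inl (.inr (β.edge.symm i)))
        | ⟨.r, i⟩ => .inr (.inr (γ.edge.symm i))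
      left_inv := by
        rintro (i | (i | i) | i)
        · rfl
        · exact congrArg (fun i => Sum.inr (Sum.inl (Sum.inl i))) (α.edge.symm_apply_apply i)
        · exact congrArg (fun i => Sum.inr (Sum.inl (Sum.inr i))) (β.edge.symm_apply_apply i)
        · exact congrArg (fun i => Sum.inr (Sum.inr i)) (γ.edge.symm_apply_apply i)
      right_inv := by
        rintro ⟨_ | _ | _ | _, i⟩
        · rfl
        · exact congrArg (fun i => (⟨.a, i⟩ : Σ σ, (nodeFamily X Y Z σ).E))
            (α.edge.apply_symm_apply i)
        · exact congrArg (fun i => (⟨.b, i⟩ : Σ σ, (nodeFamily X Y Z σ).E))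
            (β.edge.apply_symm_apply i)
        · exact congrArg (fun i => (⟨.r, i⟩ : Σ σ, (nodeFamily X Y Z σ).E))
            (γ.edge.apply_symm_apply i) }
  src_edge := by
    rintro (e | (e | e) | e)
    · rfl
    · change nodeSkeleton.lift (nodeFamily X Y Z) .a (X.G.src (α.edge e)) =
        (serR edge _ (serL _ x (parL a b (a.graph.src e)))).map _
      rw [α.src_edge]
      cases a.graph.src e <;> rfl
    · change nodeSkeleton.lift (nodeFamily X Y Z) .b (Y.G.src (β.edge e)) =
        (serR edge _ (serL _ x (parR a b (b.graph.src e)))).map _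
      rw [β.src_edge]
      cases b.graph.src e <;> rfl
    · change nodeSkeleton.lift (nodeFamily X Y Z) .r (Z.G.src (γ.edge e)) =
        (serR edge _ (serR (parallel a b) x (x.graph.src e))).map _
      rw [γ.src_edge]
      cases x.graph.src e <;> rfl
  tgt_edge := by
    rintro (e | (e | e) | e)
    · rfl
    · change nodeSkeleton.lift (nodeFamily X Y Z) .a (X.G.tgt (α.edge e)) =
        (serR edge _ (serL _ x (parL a b (a.graph.tgt e)))).map _
      rw [α.tgt_edge]
      cases a.graph.tgt e <;> rfl
    · change nodeSkeleton.lift (nodeFamily X Y Z) .b (Y.G.tgt (β.edge e)) =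
        (serR edge _ (serL _ x (parR a b (b.graph.tgt e)))).map _
      rw [β.tgt_edge]
      cases b.graph.tgt e <;> rfl
    · change nodeSkeleton.lift (nodeFamily X Y Z) .r (Z.G.tgt (γ.edge e)) =
        (serR edge _ (serR (parallel a b) x (x.graph.tgt e))).map _
      rw [γ.tgt_edge]
      cases x.graph.tgt e <;> rfl

/-- Parallel composition is commutative. -/
def parallelComm (a b : SPTree) : PointedIso (parallel a b).graph (parallel b a).graph where
  inner := Equiv.sumComm a.Inner b.Inner
  edge := Equiv.sumComm a.Edge b.Edge
  src_edge := by
    rintro (e | e)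
    · change parR b a (a.graph.src e) = (parL a b (a.graph.src e)).map _
      cases a.graph.src e <;> rfl
    · change parL b a (b.graph.src e) = (parR a b (b.graph.src e)).map _
      cases b.graph.src e <;> rfl
  tgt_edge := by
    rintro (e | e)
    · change parR b a (a.graph.tgt e) = (parL a b (a.graph.tgt e)).map _
      cases a.graph.tgt e <;> rfl
    · change parL b a (b.graph.tgt e) = (parR a b (b.graph.tgt e)).map _
      cases b.graph.tgt e <;> rfl

/-- Series composition respects isomorphisms of its first part. -/
def seriesCongrLeft {a a' : SPTree} (φ : PointedIso a.graph a'.graph) (b : SPTree) :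
    PointedIso (series a b).graph (series a' b).graph where
  inner := φ.inner.sumCongr (Equiv.refl (Unit ⊕ b.Inner))
  edge := φ.edge.sumCongr (Equiv.refl b.Edge)
  src_edge := by
    rintro (e | e)
    · change serL a' b (a'.graph.src (φ.edge e)) = (serL a b (a.graph.src e)).map _
      rw [φ.src_edge]
      cases a.graph.src e <;> rfl
    · change serR a' b (b.graph.src e) = (serR a b (b.graph.src e)).map _
      cases b.graph.src e <;> rfl
  tgt_edge := by
    rintro (e | e)
    · change serL a' b (a'.graph.tgt (φ.edge e)) = (serL a b (a.graph.tgt e)).map _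
      rw [φ.tgt_edge]
      cases a.graph.tgt e <;> rfl
    · change serR a' b (b.graph.tgt e) = (serR a b (b.graph.tgt e)).map _
      cases b.graph.tgt e <;> rfl

/-- The out-degree of the source. -/
def outSource : SPTree → ℕ
  | edge => 1
  | series a _ => a.outSource
  | parallel a b => a.outSource + b.outSource

/-- The in-degree of the sink. -/
def inSink : SPTree → ℕ
  | edge => 1
  | series _ b => b.inSink
  | parallel a b => a.inSink + b.inSink

theorem outSource_pos : ∀ T : SPTree, 0 < T.outSource
  | edge => one_pos
  | series a _ => a.outSource_pos
  | parallel a _ => Nat.add_pos_left a.outSource_pos _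

theorem inSink_pos : ∀ T : SPTree, 0 < T.inSink
  | edge => one_pos
  | series _ b => b.inSink_pos
  | parallel a _ => Nat.add_pos_left a.inSink_pos _

/-- All inner vertices have total degree at most three. -/
def InnerDegreeThree : SPTree → Prop
  | edge => True
  | series a b => a.InnerDegreeThree ∧ b.InnerDegreeThree ∧ a.inSink + b.outSource ≤ 3
  | parallel a b => a.InnerDegreeThree ∧ b.InnerDegreeThree

/-- The digraph, with an edge in front of it unless `j = 1`, is a chain. -/
def IsChain (j : ℕ) (X : SPTree) : Prop :=
  ∃ c : Chain, c.Sorted ∧ (j = 1 ∧ Nonempty (PointedIso X.graph c.tg.G) ∨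
    j ≠ 1 ∧ Nonempty (PointedIso (series edge X).graph c.tg.G))

theorem isChain_one {X : SPTree} {c : Chain} (hc : c.Sorted) (φ : PointedIso X.graph c.tg.G) :
    IsChain 1 X :=
  ⟨c, hc, .inl ⟨rfl, ⟨φ⟩⟩⟩

theorem IsChain.exists_of_one {X : SPTree} (h : IsChain 1 X) :
    ∃ c : Chain, c.Sorted ∧ Nonempty (PointedIso X.graph c.tg.G) := by
  obtain ⟨c, hc, ⟨_, h⟩ | ⟨h, _⟩⟩ := h
  · exact ⟨c, hc, h⟩
  · exact absurd rfl h

theorem IsChain.congr {j : ℕ} {X Y : SPTree} (h : IsChain j X) (φ : PointedIso Y.graph X.graph) :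
    IsChain j Y := by
  obtain ⟨c, hc, ⟨hj, ⟨ψ⟩⟩ | ⟨hj, ⟨ψ⟩⟩⟩ := h
  · exact ⟨c, hc, .inl ⟨hj, ⟨φ.trans ψ⟩⟩⟩
  · exact ⟨c, hc, .inr ⟨hj, ⟨(seriesCongr edge φ).trans ψ⟩⟩⟩

theorem isChain_edge_series {j : ℕ} {X : SPTree} (h : IsChain j X) : IsChain 1 (series edge X) := by
  obtain ⟨c, hc, ⟨hj, ⟨ψ⟩⟩ | ⟨hj, ⟨ψ⟩⟩⟩ := h
  · exact isChain_one (c := .vert c) hc (vertIso ψ)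
  · exact isChain_one hc ψ

/-- The two parts may be exchanged up to isomorphism, which makes the resulting chain sorted. -/
theorem isChain_parallel_series {a b X : SPTree} (ha : IsChain 1 a) (hb : IsChain 1 b)
    (hX : IsChain 1 X) : IsChain 2 (series (parallel a b) X) := by
  obtain ⟨A, hA, ⟨α⟩⟩ := ha.exists_of_one
  obtain ⟨B, hB, ⟨β⟩⟩ := hb.exists_of_one
  obtain ⟨R, hR, ⟨γ⟩⟩ := hX.exists_of_one
  rcases le_total A.par B.par with h | h
  · exact ⟨.node A B R, ⟨h, hA, hB, hR⟩, .inr ⟨by decide, ⟨nodeIso α β γ⟩⟩⟩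
  · exact IsChain.congr (X := series (parallel b a) X)
      ⟨.node B A R, ⟨h, hB, hA, hR⟩, .inr ⟨by decide, ⟨nodeIso β α γ⟩⟩⟩ (seriesCongrLeft (parallelComm a b) X)

/-- Chains are read from left to right, so the induction carries a continuation `X` whose source has
out-degree `j`, as far as the degree bound is concerned. A nested series composition is reassociated
to the right. Two consecutive parallel compositions without an edge between them would violate the
bound 3; this is why the continuation of a parallel composition is itself a chain. -/
theorem isChain_of_innerDegreeThree (T : SPTree) (hT : T.InnerDegreeThree) (ho : T.outSource ≤ 2)
    (hi : T.inSink ≤ 2) :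
    (∀ j X, 1 ≤ j → T.inSink + j ≤ 3 → IsChain j X → IsChain T.outSource (series T X)) ∧
      (T.inSink = 1 → IsChain T.outSource T) := by
  induction T with
  | edge => exact ⟨fun j X _ _ h => isChain_edge_series h,
      fun _ => isChain_one (c := .edge) trivial edgeIso⟩
  | series a b iha ihb =>
    obtain ⟨h1, h2, h3⟩ := hT
    have := a.inSink_pos
    have := b.outSource_pos
    obtain ⟨a1, a2⟩ := iha h1 ho (by omega)
    obtain ⟨b1, b2⟩ := ihb h2 (by omega) hi
    refine ⟨fun j X hj hij hX => ?_, fun h => a1 _ _ (by omega) h3 (b2 h)⟩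
    exact (a1 _ _ (by omega) h3 (b1 j X hj hij hX)).congr (seriesAssoc a b X).symm
  | parallel a b iha ihb =>
    obtain ⟨h1, h2⟩ := hT
    have := a.inSink_pos
    have := b.inSink_pos
    have := a.outSource_pos
    have := b.outSource_pos
    simp only [outSource, inSink] at ho hi
    have ha := (iha h1 (by omega) (by omega)).2 (by omega)
    have hb := (ihb h2 (by omega) (by omega)).2 (by omega)
    rw [show a.outSource = 1 by omega] at ha
    rw [show b.outSource = 1 by omega] at hb
    refine ⟨fun j X hj hij hX => ?_, fun h => ?_⟩
    · simp only [inSink] at hij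
      -- Two strands already enter the sink of a parallel composition.
      obtain rfl : j = 1 := by omega
      simp only [outSource]
      rw [show a.outSource + b.outSource = 2 by omega]
      exact isChain_parallel_series ha hb hX
    · simp only [inSink] at h
      omega

/-- With edges in front of it and behind it, a digraph of total degree at most three is a chain. -/
theorem exists_chain (T : SPTree) (hT : T.InnerDegreeThree) (ho : T.outSource ≤ 2)
    (hi : T.inSink ≤ 2) :
    ∃ c : Chain, c.Sorted ∧ Nonempty (PointedIso (series edge (series T edge)).graph c.tg.G) := by
  have := (T.isChain_of_innerDegreeThree hT ho hi).1 1 edge le_rfl (by omega)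
    (isChain_one (c := .edge) trivial edgeIso)
  exact (isChain_edge_series this).exists_of_one

end SPTree

/-! ### From labelled grid points to planar drawings -/

/-- If a segment of an orthogonal path with at most two bends contains both ends of the path, and
these are neighbouring grid points, then there are no other grid points on the path. -/
theorem IsOrthogonalPath.eq_or_eq_of_unit {a b : GridPt} {l : List GridPt} (hl : l.length ≤ 2)
    (h : IsOrthogonalPath (a :: (l ++ [b]))) {s : GridPt × GridPt}
    (hs : s ∈ pathSegs (a :: (l ++ [b]))) (ha : OnSeg a s.1 s.2) (hb : OnSeg b s.1 s.2)
    (h₁ : |a.1 - b.1| ≤ 1) (h₂ : |a.2 - b.2| ≤ 1) {p : GridPt}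
    (hp : OnPath p (a :: (l ++ [b]))) : p = a ∨ p = b := by
  obtain ⟨a1, a2⟩ := a
  obtain ⟨b1, b2⟩ := b
  obtain ⟨p1, p2⟩ := p
  rw [abs_le] at h₁ h₂
  match l, hl with
  | [], _ =>
    have h3 := h.1 ((a1, a2), (b1, b2)) (by simp [pathSegs])
    simp only [SegHorizontal, SegVertical, List.nil_append, OnPath, OnSeg, or_false,
      Prod.mk.injEq] at *
    omega
  | [c], _ =>
    obtain ⟨c1, c2⟩ := c
    have h3 := h.2
    simp only [pathSegs, List.cons_append, List.nil_append, List.tail_cons, List.zip_cons_cons,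
      List.zip_nil_right, List.isChain_cons_cons, List.IsChain.singleton, and_true,
      List.mem_cons, List.not_mem_nil, or_false] at h3 hs
    rcases hs with rfl | rfl <;>
    simp only [SegHorizontal, SegVertical, OnSeg] at * <;> omega
  | [c, d], _ =>
    obtain ⟨c1, c2⟩ := c
    obtain ⟨d1, d2⟩ := d
    have h3 := h.2
    simp only [pathSegs, List.cons_append, List.nil_append, List.tail_cons, List.zip_cons_cons,
      List.zip_nil_right, List.isChain_cons_cons, List.IsChain.singleton, and_true,
      List.mem_cons, List.not_mem_nil, or_false] at h3 hs
    rcases hs with rfl | rfl | rfl <;>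
    simp only [SegHorizontal, SegVertical, OnSeg] at * <;> omega

theorem onPath_of_mem_bend {p a b : GridPt} {l : List GridPt} (hp : p ∈ l) :
    OnPath p (a :: (l ++ [b])) := by
  induction l generalizing a with
  | nil => simp at hp
  | cons c l ih =>
    rcases List.mem_cons.1 hp with rfl | hp
    · left
      simp only [OnSeg]
      omega
    · exact .inr (ih hp)

namespace FrameDrawing

variable {I E' : Type} {H : MultiDigraph (SPVertex I) E'} {F : Frame} (D : FrameDrawing H F)

/-- The polygonal path of an edge. -/
def route (e : E') : List GridPt :=
  SPVertex.place F.pin F.pout D.pos (H.src e) ::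
    (D.bend e ++ [SPVertex.place F.pin F.pout D.pos (H.tgt e)])

/-- The vertices on the route of an edge are its ends. -/
theorem incident_of_pos_onPath {e : E'} {i : I} (h : OnPath (D.pos i) (D.route e)) :
    H.src e = .inner i ∨ H.tgt e = .inner i := by
  have h0 := D.label_pos i
  rcases D.label_path e _ h with h1 | ⟨j, h1, h2⟩
  · rw [h0] at h1; cases h1
  · rw [h1, D.label_pos] at h0
    cases h0
    exact h2

/-- Grid points on two routes are common end vertices. -/
theorem exists_pos_of_onPath {e f : E'} (hef : e ≠ f) {p : GridPt} (he : OnPath p (D.route e))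
    (hf : OnPath p (D.route f)) :
    ∃ i, p = D.pos i ∧ (H.src e = .inner i ∨ H.tgt e = .inner i) ∧
      (H.src f = .inner i ∨ H.tgt f = .inner i) := by
  have key : ∃ i, p = D.pos i := by
    rcases D.label_path e p he with h1 | ⟨i, h1, _⟩
    · rcases D.label_path f p hf with h2 | ⟨i, h2, _⟩
      · rw [h1] at h2
        exact absurd (Sum.inr.inj h2) hef
      · exact ⟨i, h2⟩
    · exact ⟨i, h1⟩
  obtain ⟨i, rfl⟩ := key
  exact ⟨i, rfl, D.incident_of_pos_onPath he, D.incident_of_pos_onPath hf⟩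

/-- An axis-parallel segment between grid points that contains `x` also contains the roundings of
`x` down and up. Both are therefore on both routes, and by the labels they are common end vertices.
If they are equal, then `x` is that vertex. -/
theorem eq_toPlane_of_mem_pathPoints {e f : E'} (hef : e ≠ f) {x : ℝ × ℝ}
    (he : x ∈ pathPoints (D.route e)) (hf : x ∈ pathPoints (D.route f)) :
    ∃ i, x = (D.pos i).toPlane ∧ (H.src e = .inner i ∨ H.tgt e = .inner i) ∧
      (H.src f = .inner i ∨ H.tgt f = .inner i) := by
  obtain ⟨s, hs, hxs⟩ := he
  obtain ⟨t, ht, hxt⟩ := hf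
  obtain ⟨s1, s2⟩ := onSeg_floor_ceil hxs
  obtain ⟨t1, t2⟩ := onSeg_floor_ceil hxt
  obtain ⟨i, hi, hie, hif⟩ := D.exists_pos_of_onPath hef (onPath_of_mem_pathSegs s1 hs)
    (onPath_of_mem_pathSegs t1 ht)
  obtain ⟨j, hj, hje, hjf⟩ := D.exists_pos_of_onPath hef (onPath_of_mem_pathSegs s2 hs)
    (onPath_of_mem_pathSegs t2 ht)
  by_cases hij : i = j
  · subst hij
    have h1 := hi.trans hj.symm
    simp only [Prod.mk.injEq] at h1
    refine ⟨i, ?_, hie, hif⟩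
    rw [← hi]
    have a1 := Int.floor_le x.1
    have a2 := Int.le_ceil x.1
    have a3 := Int.floor_le x.2
    have a4 := Int.le_ceil x.2
    rw [← h1.1] at a2
    rw [← h1.2] at a4
    exact Prod.ext (le_antisymm a2 a1) (le_antisymm a4 a3)
  · exfalso
    -- Otherwise the two ends of `e` are neighbours on one segment, so its route has no other grid
    -- points, and none is left to carry the label of `e`.
    obtain ⟨p, hp, hpe⟩ := D.exists_label e
    have b1 : (D.pos i).1 ≤ (D.pos j).1 ∧ (D.pos j).1 ≤ (D.pos i).1 + 1 := by
      rw [← hi, ← hj]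
      exact ⟨Int.floor_le_ceil _, Int.ceil_le_floor_add_one _⟩
    have b2 : (D.pos i).2 ≤ (D.pos j).2 ∧ (D.pos j).2 ≤ (D.pos i).2 + 1 := by
      rw [← hi, ← hj]
      exact ⟨Int.floor_le_ceil _, Int.ceil_le_floor_add_one _⟩
    have ho := (D.isPath e).isOrthogonalPath
    rw [hi] at s1
    rw [hj] at s2
    have fin : p = D.pos i ∨ p = D.pos j := by
      rcases hie with h1 | h1 <;> rcases hje with h2 | h2
      · rw [h1] at h2
        exact absurd (SPVertex.inner.inj h2) hij
      · simp only [route, h1, h2] at hs ho hp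
        exact ho.eq_or_eq_of_unit (D.bend_le e) hs s1 s2
          (by rw [abs_le]; exact ⟨by simp only [SPVertex.place]; omega,
            by simp only [SPVertex.place]; omega⟩)
          (by rw [abs_le]; exact ⟨by simp only [SPVertex.place]; omega,
            by simp only [SPVertex.place]; omega⟩) hp
      · simp only [route, h1, h2] at hs ho hp
        exact (ho.eq_or_eq_of_unit (D.bend_le e) hs s2 s1
          (by rw [abs_le]; exact ⟨by simp only [SPVertex.place]; omega,
            by simp only [SPVertex.place]; omega⟩)
          (by rw [abs_le]; exact ⟨by simp only [SPVertex.place]; omega,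
            by simp only [SPVertex.place]; omega⟩) hp).symm
      · rw [h1] at h2
        exact absurd (SPVertex.inner.inj h2) hij
    rcases fin with rfl | rfl <;> rw [D.label_pos] at hpe <;> cases hpe

/-- A drawing in a frame gives drawings of the subgraphs that avoid the terminals. -/
theorem exists_orthogonalDrawing {V E : Type*} (G : MultiDigraph V E) {φ : V → I} {ψ : E → E'}
    (hφ : Function.Injective φ) (hψ : Function.Injective ψ)
    (hsrc : ∀ e, H.src (ψ e) = .inner (φ (G.src e)))
    (htgt : ∀ e, H.tgt (ψ e) = .inner (φ (G.tgt e)))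
    (hj : ∀ v, IsJoin H (φ v) → G.IsJunction v) :
    ∃ D' : OrthogonalDrawing G, D'.IsKnuthian ∧ (∀ v, D'.pos v = D.pos (φ v)) ∧
      ∀ e, D'.bend e = D.bend (ψ e) := by
  have hroute : ∀ e, D.pos (φ (G.src e)) :: (D.bend (ψ e) ++ [D.pos (φ (G.tgt e))]) =
      D.route (ψ e) := by
    intro e
    simp only [route, hsrc, htgt, SPVertex.place]
  have hinc : ∀ e v, (H.src (ψ e) = .inner (φ v) ∨ H.tgt (ψ e) = .inner (φ v)) →
      v = G.src e ∨ v = G.tgt e := by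
    intro e v h
    rw [hsrc, htgt] at h
    exact h.imp (fun h => (hφ (SPVertex.inner.inj h)).symm)
      (fun h => (hφ (SPVertex.inner.inj h)).symm)
  refine ⟨{
    pos := fun v => D.pos (φ v)
    bend := fun e => D.bend (ψ e)
    pos_injective := fun u v h => ?_
    orthogonal := fun e => by rw [hroute]; exact (D.isPath (ψ e)).isOrthogonalPath
    simple := fun e => IsOrthogonalPath.isSimplePath (D.bend_le _) (by
      rw [hroute]; exact (D.isPath (ψ e)).isOrthogonalPath)
    avoids := fun e v h => ?_
    noncrossing := fun e f hef x he hf => ?_ }, ?_, fun _ => rfl, fun _ => rfl⟩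
  · have h1 := D.label_pos (φ u)
    have h : D.pos (φ u) = D.pos (φ v) := h
    rw [h, D.label_pos] at h1
    exact hφ (Sum.inl.inj h1).symm
  · rw [hroute] at h
    exact hinc e v (D.incident_of_pos_onPath (toPlane_mem_pathPoints h))
  · rw [hroute] at he hf
    obtain ⟨i, hi, h1, h2⟩ := D.eq_toPlane_of_mem_pathPoints (fun h => hef (hψ h)) he hf
    obtain ⟨v, rfl⟩ : ∃ v, φ v = i := by
      rw [hsrc, htgt] at h1
      rcases h1 with h1 | h1
      · exact ⟨_, SPVertex.inner.inj h1⟩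
      · exact ⟨_, SPVertex.inner.inj h1⟩
    exact ⟨v, hinc e v h1, hinc f v h2, hi⟩
  · intro v hv
    refine ⟨fun e he s hs hu => hv (hj v ?_), fun e he s hs hu => hv (hj v ?_)⟩
    · refine D.edir_up (ψ e) _ (by rw [htgt, he]) ?_
      refine (D.isPath (ψ e)).getLast_upward s ?_ hu
      rwa [OrthogonalDrawing.route, hroute] at hs
    · refine D.sdir_up (ψ e) _ (by rw [hsrc, he]) ?_
      refine (D.isPath (ψ e)).head_upward s ?_ hu
      rwa [OrthogonalDrawing.route, hroute] at hs

theorem mem_frame_of_mem_bend {e : E'} {p : GridPt} (hp : p ∈ D.bend e) : F.Mem p :=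
  D.mem_path e p (onPath_of_mem_bend hp)

end FrameDrawing

/-! ### Degrees in series-parallel digraphs and the attached edges -/

theorem ncard_setOf_sum {α β : Type*} [Finite α] [Finite β] (p : α ⊕ β → Prop) :
    {x | p x}.ncard = {a | p (.inl a)}.ncard + {b | p (.inr b)}.ncard := by
  change Nat.card {x // p x} = Nat.card {a // p (.inl a)} + Nat.card {b // p (.inr b)}
  rw [← Nat.card_sum]
  exact Nat.card_congr Equiv.subtypeSum

theorem MultiDigraph.Iso.inDeg_eq {V V' E E' : Type*} {G : MultiDigraph V E}
    {G' : MultiDigraph V' E'} (φ : G.Iso G') (v : V) : G'.inDeg (φ.vert v) = G.inDeg v :=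
  (Nat.card_congr (φ.edge.subtypeEquiv fun e => by
    simp only [Set.mem_ofPred_eq, φ.tgt_edge, φ.vert.apply_eq_iff_eq])).symm

theorem MultiDigraph.Iso.outDeg_eq {V V' E E' : Type*} {G : MultiDigraph V E}
    {G' : MultiDigraph V' E'} (φ : G.Iso G') (v : V) : G'.outDeg (φ.vert v) = G.outDeg v :=
  (Nat.card_congr (φ.edge.subtypeEquiv fun e => by
    simp only [Set.mem_ofPred_eq, φ.src_edge, φ.vert.apply_eq_iff_eq])).symm

namespace SPTree

theorem finite_edge : ∀ T : SPTree, Finite T.Edge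
  | edge => inferInstanceAs (Finite Unit)
  | series a b =>
    have := a.finite_edge
    have := b.finite_edge
    inferInstanceAs (Finite (a.Edge ⊕ b.Edge))
  | parallel a b =>
    have := a.finite_edge
    have := b.finite_edge
    inferInstanceAs (Finite (a.Edge ⊕ b.Edge))

instance (T : SPTree) : Finite T.Edge := T.finite_edge

variable (a b : SPTree)

theorem inDeg_series (v : SPVertex (series a b).Inner) : (series a b).graph.inDeg v =
    {e | serL a b (a.graph.tgt e) = v}.ncard + {e | serR a b (b.graph.tgt e) = v}.ncard :=
  ncard_setOf_sum (α := a.Edge) (β := b.Edge) fun e => (series a b).graph.tgt e = v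

theorem outDeg_series (v : SPVertex (series a b).Inner) : (series a b).graph.outDeg v =
    {e | serL a b (a.graph.src e) = v}.ncard + {e | serR a b (b.graph.src e) = v}.ncard :=
  ncard_setOf_sum (α := a.Edge) (β := b.Edge) fun e => (series a b).graph.src e = v

theorem inDeg_parallel (v : SPVertex (parallel a b).Inner) : (parallel a b).graph.inDeg v =
    {e | parL a b (a.graph.tgt e) = v}.ncard + {e | parR a b (b.graph.tgt e) = v}.ncard :=
  ncard_setOf_sum (α := a.Edge) (β := b.Edge) fun e => (parallel a b).graph.tgt e = v

theorem outDeg_parallel (v : SPVertex (parallel a b).Inner) : (parallel a b).graph.outDeg v =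
    {e | parL a b (a.graph.src e) = v}.ncard + {e | parR a b (b.graph.src e) = v}.ncard :=
  ncard_setOf_sum (α := a.Edge) (β := b.Edge) fun e => (parallel a b).graph.src e = v

variable {a b}

theorem serL_eq_source {v : SPVertex a.Inner} : serL a b v = .source ↔ v = .source :=
  ⟨fun h => by cases v <;> cases h <;> rfl, fun h => by rw [h]; rfl⟩

theorem serL_ne_sink {v : SPVertex a.Inner} : serL a b v ≠ .sink := by
  cases v <;> intro h <;> cases h

theorem serL_eq_middle {v : SPVertex a.Inner} :
    serL a b v = .inner (Sum.inr (Sum.inl ())) ↔ v = .sink :=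
  ⟨fun h => by cases v <;> cases h <;> rfl, fun h => by rw [h]; rfl⟩

theorem serL_eq_inl {v : SPVertex a.Inner} {i : a.Inner} :
    serL a b v = .inner (Sum.inl i) ↔ v = .inner i :=
  ⟨fun h => by cases v <;> cases h <;> rfl, fun h => by rw [h]; rfl⟩

theorem serL_ne_inr {v : SPVertex a.Inner} {i : b.Inner} :
    serL a b v ≠ .inner (Sum.inr (Sum.inr i)) := by
  cases v <;> intro h <;> cases h

theorem serR_ne_source {v : SPVertex b.Inner} : serR a b v ≠ .source := by
  cases v <;> intro h <;> cases h

theorem serR_eq_sink {v : SPVertex b.Inner} : serR a b v = .sink ↔ v = .sink :=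
  ⟨fun h => by cases v <;> cases h <;> rfl, fun h => by rw [h]; rfl⟩

theorem serR_eq_middle {v : SPVertex b.Inner} :
    serR a b v = .inner (Sum.inr (Sum.inl ())) ↔ v = .source :=
  ⟨fun h => by cases v <;> cases h <;> rfl, fun h => by rw [h]; rfl⟩

theorem serR_ne_inl {v : SPVertex b.Inner} {i : a.Inner} :
    serR a b v ≠ .inner (Sum.inl i) := by
  cases v <;> intro h <;> cases h

theorem serR_eq_inr {v : SPVertex b.Inner} {i : b.Inner} :
    serR a b v = .inner (Sum.inr (Sum.inr i)) ↔ v = .inner i :=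
  ⟨fun h => by cases v <;> cases h <;> rfl, fun h => by rw [h]; rfl⟩

theorem parL_eq_source {v : SPVertex a.Inner} : parL a b v = .source ↔ v = .source :=
  ⟨fun h => by cases v <;> cases h <;> rfl, fun h => by rw [h]; rfl⟩

theorem parL_eq_sink {v : SPVertex a.Inner} : parL a b v = .sink ↔ v = .sink :=
  ⟨fun h => by cases v <;> cases h <;> rfl, fun h => by rw [h]; rfl⟩

theorem parL_eq_inl {v : SPVertex a.Inner} {i : a.Inner} :
    parL a b v = .inner (Sum.inl i) ↔ v = .inner i :=
  ⟨fun h => by cases v <;> cases h <;> rfl, fun h => by rw [h]; rfl⟩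

theorem parL_ne_inr {v : SPVertex a.Inner} {i : b.Inner} : parL a b v ≠ .inner (Sum.inr i) := by
  cases v <;> intro h <;> cases h

theorem parR_eq_source {v : SPVertex b.Inner} : parR a b v = .source ↔ v = .source :=
  ⟨fun h => by cases v <;> cases h <;> rfl, fun h => by rw [h]; rfl⟩

theorem parR_eq_sink {v : SPVertex b.Inner} : parR a b v = .sink ↔ v = .sink :=
  ⟨fun h => by cases v <;> cases h <;> rfl, fun h => by rw [h]; rfl⟩

theorem parR_ne_inl {v : SPVertex b.Inner} {i : a.Inner} : parR a b v ≠ .inner (Sum.inl i) := by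
  cases v <;> intro h <;> cases h

theorem parR_eq_inr {v : SPVertex b.Inner} {i : b.Inner} :
    parR a b v = .inner (Sum.inr i) ↔ v = .inner i :=
  ⟨fun h => by cases v <;> cases h <;> rfl, fun h => by rw [h]; rfl⟩

theorem outDeg_source (T : SPTree) : T.graph.outDeg .source = T.outSource := by
  induction T with
  | edge =>
    change Set.ncard {e : Unit | SPVertex.source = SPVertex.source} = 1
    simp
  | series a b iha _ =>
    rw [outDeg_series]
    simp only [serL_eq_source, serR_ne_source, Set.ofPred_false, Set.ncard_empty, add_zero]
    exact iha
  | parallel a b iha ihb =>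
    rw [outDeg_parallel]
    simp only [parL_eq_source, parR_eq_source]
    exact congrArg₂ _ iha ihb

theorem inDeg_sink (T : SPTree) : T.graph.inDeg .sink = T.inSink := by
  induction T with
  | edge =>
    change Set.ncard {e : Unit | SPVertex.sink = SPVertex.sink} = 1
    simp
  | series a b _ ihb =>
    rw [inDeg_series]
    simp only [serL_ne_sink, serR_eq_sink, Set.ofPred_false, Set.ncard_empty, zero_add]
    exact ihb
  | parallel a b iha ihb =>
    rw [inDeg_parallel]
    simp only [parL_eq_sink, parR_eq_sink]
    exact congrArg₂ _ iha ihb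

theorem innerDegreeThree (T : SPTree)
    (h : ∀ i, T.graph.inDeg (.inner i) + T.graph.outDeg (.inner i) ≤ 3) : T.InnerDegreeThree := by
  induction T with
  | edge => trivial
  | series a b iha ihb =>
    refine ⟨iha fun i => ?_, ihb fun i => ?_, ?_⟩
    · have := h (Sum.inl i)
      rw [inDeg_series, outDeg_series] at this
      simp only [serL_eq_inl, serR_ne_inl, Set.ofPred_false, Set.ncard_empty, add_zero] at this
      exact this
    · have := h (Sum.inr (Sum.inr i))
      rw [inDeg_series, outDeg_series] at this
      simp only [serL_ne_inr, serR_eq_inr, Set.ofPred_false, Set.ncard_empty, zero_add] at this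
      exact this
    · have := h (Sum.inr (Sum.inl ()))
      rw [inDeg_series, outDeg_series] at this
      simp only [serL_eq_middle, serR_eq_middle, src_ne_sink, tgt_ne_source, Set.ofPred_false,
        Set.ncard_empty, zero_add, add_zero] at this
      rw [← inDeg_sink, ← outDeg_source]
      exact this
  | parallel a b iha ihb =>
    refine ⟨iha fun i => ?_, ihb fun i => ?_⟩
    · have := h (Sum.inl i)
      rw [inDeg_parallel, outDeg_parallel] at this
      simp only [parL_eq_inl, parR_ne_inl, Set.ofPred_false, Set.ncard_empty, add_zero] at this
      exact this
    · have := h (Sum.inr i)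
      rw [inDeg_parallel, outDeg_parallel] at this
      simp only [parL_ne_inr, parR_eq_inr, Set.ofPred_false, Set.ncard_empty, zero_add] at this
      exact this

/-- The vertices of a digraph are the inner vertices once edges have been attached to the
terminals. -/
def vertexEquiv (T : SPTree) : SPVertex T.Inner ≃ (series edge (series T edge)).Inner where
  toFun
    | .source => .inr (.inl ())
    | .sink => .inr (.inr (.inr (.inl ())))
    | .inner i => .inr (.inr (.inl i))
  invFun
    | .inl i => Empty.elim i
    | .inr (.inl _) => .source
    | .inr (.inr (.inl i)) => .inner i
    | .inr (.inr (.inr (.inl _))) => .sink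
    | .inr (.inr (.inr (.inr i))) => Empty.elim i
  left_inv := by rintro (_ | _ | i) <;> rfl
  right_inv := by
    rintro (i | _ | i | _ | i)
    · exact Empty.elim i
    · rfl
    · rfl
    · rfl
    · exact Empty.elim i

/-- The edges of the digraph after edges have been attached to the terminals. -/
def edgeEmb (T : SPTree) (e : T.Edge) : (series edge (series T edge)).Edge := .inr (.inl e)

theorem edgeEmb_injective (T : SPTree) : Function.Injective T.edgeEmb :=
  Sum.inr_injective.comp Sum.inl_injective

theorem src_edgeEmb (T : SPTree) (e : T.Edge) :
    (series edge (series T edge)).graph.src (T.edgeEmb e) = .inner (T.vertexEquiv (T.graph.src e)) := by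
  change serR edge _ (serL T edge (T.graph.src e)) = _
  cases T.graph.src e <;> rfl

theorem tgt_edgeEmb (T : SPTree) (e : T.Edge) :
    (series edge (series T edge)).graph.tgt (T.edgeEmb e) = .inner (T.vertexEquiv (T.graph.tgt e)) := by
  change serR edge _ (serL T edge (T.graph.tgt e)) = _
  cases T.graph.tgt e <;> rfl

/-- The new incoming edge is the only one at the source. -/
theorem tgt_eq_vertexEquiv {T : SPTree} {v : SPVertex T.Inner}
    {e : (series edge (series T edge)).Edge}
    (h : (series edge (series T edge)).graph.tgt e = .inner (T.vertexEquiv v)) :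
    (v = .source ∧ e = .inl ()) ∨ v ≠ .source ∧ ∃ e', e = T.edgeEmb e' := by
  rcases e with e | e | e
  · left
    have h : SPVertex.inner (T.vertexEquiv .source) = .inner (T.vertexEquiv v) := h
    exact ⟨(T.vertexEquiv.injective (SPVertex.inner.inj h)).symm, rfl⟩
  · right
    have h := (T.tgt_edgeEmb e).symm.trans h
    have h := T.vertexEquiv.injective (SPVertex.inner.inj h)
    exact ⟨fun hv => T.tgt_ne_source e (h.trans hv), e, rfl⟩
  · have h : SPVertex.sink = SPVertex.inner (T.vertexEquiv v) := h
    cases h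

end SPTree

/-! ### Numerical bounds and conclusion -/

namespace Chain

theorem par_le_size : ∀ c : Chain, c.par ≤ c.size
  | edge => le_rfl
  | vert R => R.par_le_size.trans (Nat.le_succ _)
  | node A B R => by
    have := A.par_le_size
    have := B.par_le_size
    have := R.par_le_size
    simp only [par, size]
    omega

/-- A `vert` adds one vertex, a `node` adds a split and a join; the second of these is what `par`
counts. -/
theorem card_inner (c : Chain) : Nat.card c.tg.I = c.size + c.par := by
  induction c with
  | edge => exact Nat.card_of_isEmpty (α := Empty)
  | vert R ih =>
    have h : Nat.card (Unit ⊕ Σ σ, (vertFamily R.tg σ).I) = 1 + (R.size + R.par) := by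
      rw [Nat.card_sum, Nat.card_sigma, Fintype.sum_bool, ← ih, Nat.card_unique]
      have h0 : Nat.card (vertFamily R.tg false).I = 0 := Nat.card_of_isEmpty (α := Empty)
      rw [h0]
      rfl
    refine h.trans ?_
    simp only [size, par]
    omega
  | node A B R ihA ihB ihR =>
    have h : Nat.card (NodeVertex ⊕ Σ σ, (nodeFamily A.tg B.tg R.tg σ).I) =
        2 + (0 + (A.size + A.par) + (B.size + B.par) + (R.size + R.par)) := by
      rw [Nat.card_sum, Nat.card_sigma, NodeStrand.sum_univ, ← ihA, ← ihB, ← ihR]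
      have h0 : Nat.card (nodeFamily A.tg B.tg R.tg .edge).I = 0 :=
        Nat.card_of_isEmpty (α := Empty)
      have h2 : Nat.card NodeVertex = 2 := by
        rw [← Nat.card_eq_fintype_card.trans Fintype.card_bool]
        exact Nat.card_congr
          ⟨fun v => match v with | .split => true | .join => false,
            fun v => match v with | true => .split | false => .join,
            by rintro (_ | _) <;> rfl, by rintro (_ | _) <;> rfl⟩
      rw [h0, h2]
      rfl
    refine h.trans ?_
    simp only [size, par]
    omega

theorem rows_le_log {c : Chain} {n : ℕ} (hn : 2 ≤ n) (hc : 2 * c.par ≤ n) :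
    (c.rows : ℝ) ≤ 36 * Real.log n := by
  -- With this bound, `10 * size` is at most `20 * log n` and 8 is at most `16 * log n`, whence 36.
  have hl : 1 / 2 ≤ Real.log 2 := by
    have := Real.log_two_gt_d9
    linarith
  have h2 : Real.log 2 ≤ Real.log n := Real.log_le_log (by norm_num) (by exact_mod_cast hn)
  have h1 : (c.par.size : ℝ) * Real.log 2 ≤ Real.log n := by
    rw [← Real.log_pow]
    refine Real.log_le_log (by positivity) ?_
    have : 2 ^ c.par.size ≤ n := by
      rcases Nat.eq_zero_or_pos c.par with h | h
      · rw [h, Nat.size_zero]; omega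
      · obtain ⟨s, hs⟩ : ∃ s, c.par.size = s + 1 :=
          ⟨_, (Nat.succ_pred_eq_of_pos (Nat.size_pos.2 h)).symm⟩
        have : 2 ^ s ≤ c.par := Nat.lt_size.1 (by omega)
        rw [hs, pow_succ]
        omega
    exact_mod_cast this
  have h3 : c.rows ≤ 10 * c.par.size + 8 := by
    simp only [rows]; omega
  have h4 : (c.rows : ℝ) ≤ 10 * (c.par.size : ℝ) + 8 := by exact_mod_cast h3
  have h5 : (c.par.size : ℝ) * (1 / 2) ≤ c.par.size * Real.log 2 :=
    mul_le_mul_of_nonneg_left hl (Nat.cast_nonneg _)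
  linarith

end Chain

theorem exists_drawing_of_spTree {V E : Type*} [Fintype V] [Fintype E] {G : MultiDigraph V E}
    {T : SPTree} (φ : G.Iso T.graph) (hG : G.IsDegreeThree) :
    ∃ D : OrthogonalDrawing G, D.IsKnuthian ∧
      (∃ w h : ℕ, D.FitsIn w h ∧ (w : ℝ) ≤ 36 * (Fintype.card V : ℝ) ∧
        (h : ℝ) ≤ 36 * Real.log (Fintype.card V : ℝ)) ∧
      (∀ e : E, D.bends e ≤ 2) ∧
      ((∑ e : E, D.bends e : ℕ) : ℝ) ≤ 1.25 * (Fintype.card V : ℝ) := by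
  have hdeg : ∀ v, T.graph.inDeg v + T.graph.outDeg v ≤ 3 ∧ T.graph.inDeg v ≤ 2 ∧
      T.graph.outDeg v ≤ 2 := by
    intro v
    rw [← φ.vert.apply_symm_apply v, φ.inDeg_eq, φ.outDeg_eq]
    exact hG _
  obtain ⟨c, hc, ⟨Φ⟩⟩ := T.exists_chain (T.innerDegreeThree fun i => (hdeg _).1)
    (T.outDeg_source ▸ (hdeg _).2.2) (T.inDeg_sink ▸ (hdeg _).2.1)
  let α : V ≃ c.tg.I := φ.vert.trans (T.vertexEquiv.trans Φ.inner)
  let ψ : E → c.tg.E := fun e => Φ.edge (T.edgeEmb (φ.edge e))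
  have hψ : Function.Injective ψ :=
    Φ.edge.injective.comp (T.edgeEmb_injective.comp φ.edge.injective)
  have hcard : Fintype.card V = c.size + c.par := by
    rw [← c.card_inner, ← Nat.card_congr α, Nat.card_eq_fintype_card]
  have hpar := c.par_le_size
  have htwo : 2 ≤ Fintype.card V := by
    rw [Nat.succ_le_iff, Fintype.one_lt_card_iff]
    exact ⟨φ.vert.symm .source, φ.vert.symm .sink, fun h => by
      cases φ.vert.symm.injective h⟩
  have hsrc : ∀ e, c.tg.G.src (ψ e) = .inner (α (G.src e)) := by
    intro e
    rw [Φ.src_edge, T.src_edgeEmb, φ.src_edge]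
    rfl
  have htgt : ∀ e, c.tg.G.tgt (ψ e) = .inner (α (G.tgt e)) := by
    intro e
    rw [Φ.tgt_edge, T.tgt_edgeEmb, φ.tgt_edge]
    rfl
  -- Removing the attached edges does not spoil joins. The source loses its only incoming edge, so
  -- it was not a join; every other vertex keeps its incoming edges, and out-degrees do not grow.
  have hj : ∀ v, IsJoin c.tg.G (α v) → G.IsJunction v := by
    rintro v ⟨⟨e, f, hef, he, hf⟩, hout⟩
    have h1 : G.outDeg v ≤ 1 := by
      refine (Set.ncard_le_one).2 fun e he f hf => hψ (hout _ _ ?_ ?_)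
      · rw [hsrc, he]
      · rw [hsrc, hf]
    have key : ∀ e, c.tg.G.tgt e = .inner (α v) → (φ.vert v = .source ∧ e = Φ.edge (.inl ())) ∨
        φ.vert v ≠ .source ∧ ∃ e', e = ψ e' ∧ G.tgt e' = v := by
      intro e he
      obtain ⟨e, rfl⟩ := Φ.edge.surjective e
      have h : (SPTree.series .edge (.series T .edge)).graph.tgt e =
          .inner (T.vertexEquiv (φ.vert v)) := by
        rw [Φ.tgt_edge] at he
        generalize (SPTree.series .edge (.series T .edge)).graph.tgt e = u at he
        cases u with
        | source => cases he
        | sink => cases he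
        | inner i => exact congrArg _ (Φ.inner.injective (SPVertex.inner.inj he))
      rcases SPTree.tgt_eq_vertexEquiv h with ⟨h1, rfl⟩ | ⟨h1, e', rfl⟩
      · exact .inl ⟨h1, rfl⟩
      · obtain ⟨e', rfl⟩ := φ.edge.surjective e'
        have h2 := (htgt e').symm.trans he
        exact .inr ⟨h1, e', rfl, α.injective (SPVertex.inner.inj h2)⟩
    have h2 : 1 < G.inDeg v := by
      refine (Set.one_lt_ncard).2 ?_
      rcases key e he with ⟨h1, h2⟩ | ⟨h1, e', rfl, h2⟩ <;>
        rcases key f hf with ⟨h3, h4⟩ | ⟨h3, f', rfl, h4⟩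
      · exact absurd (h2.trans h4.symm) hef
      · exact absurd h1 h3
      · exact absurd h3 h1
      · exact ⟨e', h2, f', h4, fun h => hef (congrArg ψ h)⟩
    exact h1.trans_lt h2
  obtain ⟨w, n, hw, hw', ⟨D, hD⟩, -, -, hn⟩ := (c.draws hc).1 c.rows le_rfl
  obtain ⟨D', hK, hpos, hbend⟩ := D.exists_orthogonalDrawing G α.injective hψ hsrc htgt hj
  have hmem : ∀ p : GridPt, (Frame.lr 0 0 w c.rows 0 0).Mem p →
      p ∈ Set.Icc (0 : ℤ) (0 + (w.toNat : ℤ)) ×ˢ Set.Icc (-(c.rows : ℤ)) (-c.rows + (c.rows : ℕ)) := by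
    intro p hp
    simp only [Frame.lr, Frame.Mem] at hp
    rw [Set.mem_prod, Set.mem_Icc, Set.mem_Icc]
    omega
  refine ⟨D', hK, ⟨w.toNat, c.rows, ⟨0, -c.rows, fun v => ?_, fun e p hp => ?_⟩, ?_, ?_⟩,
    fun e => ?_, ?_⟩
  · rw [hpos]
    exact hmem _ (D.mem_pos _)
  · rw [hbend] at hp
    exact hmem _ (D.mem_frame_of_mem_bend hp)
  · have : w.toNat ≤ 36 * Fintype.card V := by omega
    exact_mod_cast this
  · exact Chain.rows_le_log htwo (by omega)
  · rw [OrthogonalDrawing.bends, hbend]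
    exact D.bend_le _
  · have h1 : ∑ e : E, D'.bends e ≤ ∑ e, n e := by
      calc ∑ e : E, D'.bends e = ∑ e : E, n (ψ e) :=
            Finset.sum_congr rfl fun e _ => by rw [OrthogonalDrawing.bends, hbend, hD]
        _ = ∑ e ∈ Finset.univ.map ⟨ψ, hψ⟩, n e := by rw [Finset.sum_map]; rfl
        _ ≤ ∑ e, n e := Finset.sum_le_sum_of_subset (Finset.subset_univ _)
    -- Twice the bends is at most `5 * par`, and `2 * par ≤ size + par`, which is the number of
    -- vertices.
    have h2 : 4 * ∑ e : E, D'.bends e ≤ 5 * Fintype.card V := by omega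
    have h3 : (4 : ℝ) * ((∑ e : E, D'.bends e : ℕ) : ℝ) ≤ 5 * (Fintype.card V : ℝ) := by
      exact_mod_cast h2
    linarith

theorem theorem1 :
    ∃ C : ℝ, ∀ (V : Type*) (E : Type*) [Fintype V] [Fintype E] (G : MultiDigraph V E),
      G.IsSeriesParallel → G.IsDegreeThree →
      ∃ D : OrthogonalDrawing G,
        D.IsKnuthian ∧
        (∃ w h : ℕ, D.FitsIn w h ∧
          (w : ℝ) ≤ C * (Fintype.card V : ℝ) ∧
          (h : ℝ) ≤ C * Real.log (Fintype.card V : ℝ)) ∧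
        (∀ e : E, D.bends e ≤ 2) ∧
        ((∑ e : E, D.bends e : ℕ) : ℝ) ≤ 1.25 * (Fintype.card V : ℝ) := by
  refine ⟨36, fun V E _ _ G hG hG' => ?_⟩
  rcases hG with ⟨T, ⟨φ⟩⟩ | ⟨⟨_⟩, _⟩
  · exact exists_drawing_of_spTree φ hG'
  -- For a single vertex the height bound is `log 1 = 0`, so the drawing is one point.
  · refine ⟨⟨fun _ => (0, 0), fun _ => [], fun _ _ _ => Subsingleton.elim _ _, isEmptyElim,
      isEmptyElim, isEmptyElim, isEmptyElim⟩, fun _ _ => ⟨isEmptyElim, isEmptyElim⟩,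
      ⟨0, 0, ⟨0, 0, fun _ => by simp, isEmptyElim⟩, by simp, by simp⟩, isEmptyElim, ?_⟩
    norm_num
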